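/- Let $G=(V,E)$ be the complete undirected graph on a finite vertex set $V$ with metric edge lengths $c\colon E\to\mathbb{R}_{\ge 0}$, a root $r\in V$ and penalties $\pi\colon V\to\mathbb{R}_{\ge 0}$ with $\pi_r=0$. For $S\subseteq V$ let $\delta(S)$ be the set of edges with exactly one endpoint in $S$, and write $\delta(v)=\delta(\{v\})$; $\chi^F$ denotes the characteristic vector of a set $F$ of edges. Let $x\in\mathbb{R}_{\ge 0}^E$ and $y\in[0,1]^V$ be feasible for the prize-collecting TSP relaxation, i.e., $y_r=1$, $x(\delta(r))\le 2$, $x(\delta(v))=2y_v$ for all $v\in V\setminus\{r\}$, and $x(\delta(S))\ge 2y_v$ for all $S\subseteq V\setminus\{r\}$ and $v\in S$. Let $V_1=\{v\in V\colon y_v=1\}$ and suppose that $e_0\in E$ is an edge with both endpoints in $V_1$ and $x_{e_0}\ge 1$. Let $\mathcal{T}$ be a finite family of trees that are subgraphs of $G$, with weights $\mu\in[0,1]^{\mathcal{T}}$, such that 1. $x=\sum_{T\in\mathcal{T}}\mu_T\chi^{E[T]}+\chi^{e_0}$; 2. $\sum_{T\in\mathcal{T}\colon v\in V[T]}\mu_T=y_v$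 for every $v\in V\setminus V_1$; 3. $|V[T]\cap V_1|=2$ for every $T\in\mathcal{T}$; 4. in the multigraph $G_1$ on $V_1$ that consists of $e_0$ and, for each $T\in\mathcal{T}$, an edge $e_T$ joining the two vertices of $V[T]\cap V_1$, the edge weighting $z$ with $z_{e_0}=1$ and $z_{e_T}=\mu_T$ (parallel edges kept distinct) lies in the Held-Karp polytope of $G_1$: $z\ge 0$, $z(\delta_{G_1}(v))=2$ for all $v\in V_1$, and $z(\delta_{G_1}(S))\ge 2$ for all $\emptyset\ne S\subsetneq V_1$. For $T\in\mathcal{T}$ let the backbone $B_T$ be the set of edges of the path in $T$ between the two vertices of $V[T]\cap V_1$, and let $L_T=E[T]\setminus B_T$ be the set of limbs. Then there is a random multigraph $H$ (with finitely many outcomes) on a subset of $V$, with edges in $E$, such that (i) $H$ is always connected, contains all vertices of $V_1$, and all of its vertices outside $V_1$ have even degree in $H$; (ii) $$\mathbb{E}\bigl[c(E[H])+\pi(V\setminus V[H])\bigr]\le\sum_{T\in\mathcal{T}}\mu_T\Bigl(c(B_T)+\tfrac32\,c(L_T)\Bigr)+\sum_{v\in V\setminus V_1}\pi_v\exp\Bigl(-\frac{3y_v}{4}\Bigr).$$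 Moreover, such an $H$ can be sampled efficiently: there is a single randomized algorithm that, given $(V,c,r,\pi,x,y,e_0,\mathcal{T},\mu)$ as above with all numbers rational, uses a number of independent fair random bits that is polynomial in the binary encoding length of the input, always halts within time polynomial in this length, and outputs a multigraph $H$ with the properties (i) and (ii). -/

import Mathlib

open scoped BigOperators

noncomputable section

namespace PrizeCollecting

/-! # Edges, cuts and the linear relaxation

The input graph is the complete graph on a finite set `V`.  Its edges are the non-diagonal elements
of `Sym2 V`; the values of a function `Sym2 V → ℝ` on the diagonal are never used. -/

/-- The vertex set (or edge) `f` crosses `S`: `|f ∩ S| = |f \ S| = 1`. -/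
def Crosses {V : Type*} [DecidableEq V] (f S : Finset V) : Prop :=
  (f ∩ S).card = 1 ∧ (f \ S).card = 1

open Classical in
/-- The cut `δ(S)` in the complete graph on `V`. -/
def cut {V : Type*} [Fintype V] [DecidableEq V] (S : Finset V) : Finset (Sym2 V) :=
  Finset.univ.filter fun e => Crosses e.toFinset S

/-- Edge lengths `c` and penalties `pen` of a metric prize-collecting TSP instance with root `r`
(with the convention that the penalty of the root is zero). -/
structure IsInstance {V : Type*} (c : Sym2 V → ℝ) (r : V) (pen : V → ℝ) : Prop where
  length_nonneg : ∀ e : Sym2 V, ¬ e.IsDiag → 0 ≤ c e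
  triangle : ∀ u v w : V, u ≠ v → v ≠ w → u ≠ w → c s(u, w) ≤ c s(u, v) + c s(v, w)
  pen_nonneg : ∀ v, 0 ≤ pen v
  pen_root : pen r = 0

/-- `(x, y)` is feasible for the linear relaxation of prize-collecting TSP. -/
structure LPFeasible {V : Type*} [Fintype V] [DecidableEq V] (r : V)
    (x : Sym2 V → ℝ) (y : V → ℝ) : Prop where
  degree : ∀ v, v ≠ r → ∑ e ∈ cut {v}, x e = 2 * y v
  degree_root : ∑ e ∈ cut {r}, x e ≤ 2
  connectivity : ∀ S : Finset V, r ∉ S → ∀ v ∈ S, 2 * y v ≤ ∑ e ∈ cut S, x e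
  y_root : y r = 1
  x_nonneg : ∀ e : Sym2 V, ¬ e.IsDiag → 0 ≤ x e
  y_mem : ∀ v, y v ∈ Set.Icc (0 : ℝ) 1

open Classical in
/-- The set `V₁` of vertices with `y v = 1`. -/
def core {V : Type*} [Fintype V] (y : V → ℝ) : Finset V :=
  Finset.univ.filter fun v => y v = 1

open Classical in
/-- `z` lies in the Held-Karp polytope of the multigraph with vertex set `U`, edge index set `κ`,
and edge `k` having the set `ends k` of endpoints. -/
structure InHeldKarp {V κ : Type*} [Fintype κ] [DecidableEq V] (U : Finset V)
    (ends : κ → Finset V) (z : κ → ℝ) : Prop where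
  nonneg : ∀ k, 0 ≤ z k
  degree : ∀ v ∈ U, (∑ k with Crosses (ends k) {v}, z k) = 2
  connectivity : ∀ S : Finset V, S ⊂ U → S.Nonempty → 2 ≤ ∑ k with Crosses (ends k) S, z k

/-! # Trees, backbones and limbs -/

/-- Subgraphs of the complete graph on `V`. -/
abbrev CompleteSub (V : Type*) := (⊤ : SimpleGraph V).Subgraph

open Classical in
/-- The set `V[T] ∩ U`.  If it has two elements, these are the anchors of `T` in `U`, and the
set is the edge `e_T` joining them. -/
def anchors {V : Type*} (U : Finset V) (T : CompleteSub V) : Finset V :=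
  U.filter fun v => v ∈ T.verts

/-- The edges of the tree `T` on the path of `T` between its two anchors in `U`. -/
def backbone {V : Type*} (U : Finset V) (T : CompleteSub V) : Set (Sym2 V) :=
  {e | ∃ a ∈ anchors U T, ∃ b ∈ anchors U T, a ≠ b ∧
    ∃ p : T.spanningCoe.Walk a b, p.IsPath ∧ e ∈ p.edges}

/-- The edges of `T` outside its backbone. -/
def limbs {V : Type*} (U : Finset V) (T : CompleteSub V) : Set (Sym2 V) :=
  T.edgeSet \ backbone U T

open Classical in
/-- The total length `c(F)` of a set `F` of edges. -/
def setCost {V : Type*} [Fintype V] (c : Sym2 V → ℝ) (F : Set (Sym2 V)) : ℝ :=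
  ∑ e with e ∈ F, c e

open Classical in
/-- The trees `T i` with weights `μ i` form a decomposition of the solution `(x, y)` relative to the
edge `e₀`.  The trees are given as a family; in particular, this covers sets of trees. -/
structure IsDecomposition {V ι : Type*} [Fintype V] [DecidableEq V] [Fintype ι]
    (x : Sym2 V → ℝ) (y : V → ℝ) (e₀ : Sym2 V) (T : ι → CompleteSub V) (μ : ι → ℝ) : Prop where
  isTree : ∀ i, (T i).coe.IsTree
  weight_mem : ∀ i, μ i ∈ Set.Icc (0 : ℝ) 1
  partition : ∀ e : Sym2 V, ¬ e.IsDiag →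
    x e = (∑ i, μ i * (if e ∈ (T i).edgeSet then 1 else 0)) + (if e = e₀ then 1 else 0)
  incident : ∀ v, v ∉ core y → (∑ i with v ∈ (T i).verts, μ i) = y v
  two_anchors : ∀ i, (anchors (core y) (T i)).card = 2
  /-- The multigraph `G₁` has one edge for `e₀` (index `none`) and one for each tree. -/
  heldKarp : InHeldKarp (κ := Option ι) (core y)
    (fun k => k.elim e₀.toFinset fun i => anchors (core y) (T i))
    (fun k => k.elim 1 μ)

/-! # Multigraphs -/

/-- A (loopless) multigraph on a subset of `V`. -/
structure Multigraph (V : Type*) where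
  verts : Finset V
  /-- The multiplicity of each edge. -/
  mult : Sym2 V → ℕ
  loopless : ∀ e : Sym2 V, e.IsDiag → mult e = 0
  incident : ∀ e, mult e ≠ 0 → ∀ v ∈ e, v ∈ verts

namespace Multigraph

/-- The simple graph underlying a multigraph. -/
def graph {V : Type*} (H : Multigraph V) : SimpleGraph H.verts where
  Adj u v := u ≠ v ∧ H.mult s(u.1, v.1) ≠ 0
  symm := ⟨fun u v h => ⟨h.1.symm, by rw [Sym2.eq_swap]; exact h.2⟩⟩
  loopless := ⟨fun _ h => h.1 rfl⟩

open Classical in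
/-- The degree of a vertex, counting multiplicities. -/
def degree {V : Type*} [Fintype V] (H : Multigraph V) (v : V) : ℕ :=
  ∑ e with v ∈ e, H.mult e

/-- The length `c(E[H])`, counting multiplicities. -/
def cost {V : Type*} [Fintype V] (H : Multigraph V) (c : Sym2 V → ℝ) : ℝ :=
  ∑ e, (H.mult e : ℝ) * c e

open Classical in
/-- The penalty `π(V \ V[H])`. -/
def penalty {V : Type*} [Fintype V] (H : Multigraph V) (pen : V → ℝ) : ℝ :=
  ∑ v with v ∉ H.verts, pen v

end Multigraph

/-! # Inputs and the required output distribution -/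

/-- The data from which `H` is sampled: an instance of prize-collecting TSP, an LP solution, the
distinguished edge `e₀`, and weighted trees; `K` is the type of the numbers. -/
structure Input (K V ι : Type*) where
  c : Sym2 V → K
  r : V
  pen : V → K
  x : Sym2 V → K
  y : V → K
  e₀ : Sym2 V
  T : ι → CompleteSub V
  μ : ι → K

namespace Input

/-- The input with rational numbers, viewed as an input with real numbers. -/
def toReal {V ι : Type*} (I : Input ℚ V ι) : Input ℝ V ι where
  c e := (I.c e : ℝ)
  r := I.r
  pen v := (I.pen v : ℝ)
  x e := (I.x e : ℝ)
  y v := (I.y v : ℝ)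
  e₀ := I.e₀
  T := I.T
  μ i := (I.μ i : ℝ)

/-- The assumptions on the input: a metric instance, a feasible LP solution, an edge `e₀` inside
`V₁` of value at least one, and a decomposition of the solution. -/
structure Valid {V ι : Type*} [Fintype V] [DecidableEq V] [Fintype ι] (I : Input ℝ V ι) :
    Prop where
  isInstance : IsInstance I.c I.r I.pen
  feasible : LPFeasible I.r I.x I.y
  e₀_edge : ¬ I.e₀.IsDiag
  e₀_core : ∀ v ∈ I.e₀, v ∈ core I.y
  e₀_value : 1 ≤ I.x I.e₀
  decomposition : IsDecomposition I.x I.y I.e₀ I.T I.μ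

/-- The upper bound on the expected cost plus penalty. -/
def bound {V ι : Type*} [Fintype V] [DecidableEq V] [Fintype ι] (I : Input ℝ V ι) : ℝ :=
  (∑ i, I.μ i * (setCost I.c (backbone (core I.y) (I.T i))
      + 3 / 2 * setCost I.c (limbs (core I.y) (I.T i))))
    + ∑ v ∈ (core I.y)ᶜ, I.pen v * Real.exp (-(3 * I.y v / 4))

/-- The random multigraph `H`, on a finite sample space `Ω` with distribution `P`, is connected,
spans `V₁`, has even degrees outside `V₁`, and satisfies the bound in expectation. -/
structure GoodSample {V ι Ω : Type*} [Fintype V] [DecidableEq V] [Fintype ι] [Fintype Ω]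
    (I : Input ℝ V ι) (P : PMF Ω) (H : Ω → Multigraph V) : Prop where
  connected : ∀ ω, (H ω).graph.Connected
  spans : ∀ ω, core I.y ⊆ (H ω).verts
  even_degree : ∀ ω, ∀ v ∈ (H ω).verts, v ∉ core I.y → Even ((H ω).degree v)
  expectation_le :
    ∑ ω, (P ω).toReal * ((H ω).cost I.c + (H ω).penalty I.pen) ≤ I.bound

end Input

/-! # A model of computation with running times

Programs work on binary trees whose leaves carry integers.  Every elementary operation costs one
plus the number of bits of its argument and of its result, so that this model and Turing machines
simulate each other with polynomial overhead. -/

/-- The values on which programs operate. -/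
inductive Data where
  | num (z : ℤ)
  | pair (a b : Data)

namespace Data

/-- The size of a value, with integers in binary. -/
def size : Data → ℕ
  | num z => 1 + Nat.size z.natAbs
  | pair a b => 1 + a.size + b.size

end Data

/-- The elementary operations. -/
inductive Op where
  | id
  | const (z : ℤ)
  | fst
  | snd
  | isPair
  | add
  | sub
  | mul
  | div
  | le

open Data in
/-- The effect of the elementary operations; tests return `1` for true and `0` for false, and
operations applied to an argument of the wrong shape return `0`. -/
def Op.eval : Op → Data → Data
  | .id, a => a
  | .const z, _ => num z
  | .fst, pair a _ => a
  | .snd, pair _ b => b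
  | .isPair, pair _ _ => num 1
  | .add, pair (num a) (num b) => num (a + b)
  | .sub, pair (num a) (num b) => num (a - b)
  | .mul, pair (num a) (num b) => num (a * b)
  | .div, pair (num a) (num b) => num (a / b)
  | .le, pair (num a) (num b) => num (if a ≤ b then 1 else 0)
  | _, _ => num 0

/-- Programs. -/
inductive Prog where
  /-- Apply an elementary operation. -/
  | op (o : Op)
  /-- Run the first program, then the second one on its result. -/
  | seq (p q : Prog)
  /-- Run both programs on the argument and form the pair of the results. -/
  | both (p q : Prog)
  /-- Run the first program as a test on the argument, and then, on the same argument, the second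
  program if the result of the test is not `0`, and the third program otherwise. -/
  | ite (c p q : Prog)
  /-- As long as the result of the test `c` on the current value is not `0`, replace the current
  value by the result of `p` on it. -/
  | while (c p : Prog)

/-- `p.Runs a b t`: on argument `a`, the program `p` halts with result `b` after time `t`. -/
inductive Prog.Runs : Prog → Data → Data → ℕ → Prop where
  | op (o : Op) (a : Data) : Runs (.op o) a (o.eval a) (1 + a.size + (o.eval a).size)
  | seq {p q : Prog} {a b d : Data} {s t : ℕ} :
      Runs p a b s → Runs q b d t → Runs (.seq p q) a d (1 + s + t)
  | both {p q : Prog} {a b d : Data} {s t : ℕ} :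
      Runs p a b s → Runs q a d t → Runs (.both p q) a (.pair b d) (1 + s + t)
  | ite_true {c p q : Prog} {a b d : Data} {s t : ℕ} :
      Runs c a b s → b ≠ .num 0 → Runs p a d t → Runs (.ite c p q) a d (1 + s + t)
  | ite_false {c p q : Prog} {a d : Data} {s t : ℕ} :
      Runs c a (.num 0) s → Runs q a d t → Runs (.ite c p q) a d (1 + s + t)
  | while_stop {c p : Prog} {a : Data} {s : ℕ} :
      Runs c a (.num 0) s → Runs (.while c p) a a (1 + s)
  | while_step {c p : Prog} {a b a' d : Data} {s t u : ℕ} :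
      Runs c a b s → b ≠ .num 0 → Runs p a a' t → Runs (.while c p) a' d u →
      Runs (.while c p) a d (1 + s + t + u)

/-! # Encodings -/

namespace Data

/-- Lists. -/
def ofList : List Data → Data
  | [] => num 0
  | a :: l => pair a (ofList l)

/-- Rational numbers, as numerator and denominator. -/
def ofRat (q : ℚ) : Data := pair (num q.num) (num q.den)

open Classical in
/-- Truth values. -/
def ofProp (p : Prop) : Data := num (if p then 1 else 0)

/-- The list of the values of a function on `Fin n`. -/
def ofFun {n : ℕ} (f : Fin n → Data) : Data := ofList (List.ofFn f)

/-- The matrix of the values of a function on unordered pairs. -/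
def ofSymm {n : ℕ} (f : Sym2 (Fin n) → Data) : Data := ofFun fun i => ofFun fun j => f s(i, j)

/-- Subgraphs: the characteristic vector of the vertices and the adjacency matrix. -/
def ofSub {n : ℕ} (T : CompleteSub (Fin n)) : Data :=
  pair (ofFun fun v => ofProp (v ∈ T.verts)) (ofSymm fun e => ofProp (e ∈ T.edgeSet))

/-- Bit strings. -/
def ofBits {m : ℕ} (ω : Fin m → Bool) : Data := ofFun fun i => ofProp (ω i = true)

end Data

open Data in
/-- The encoding of an input with rational numbers. -/
def Input.encode {n k : ℕ} (I : Input ℚ (Fin n) (Fin k)) : Data :=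
  ofList [ofSymm fun e => ofRat (I.c e), num (I.r : ℕ), ofFun fun v => ofRat (I.pen v),
    ofSymm fun e => ofRat (I.x e), ofFun fun v => ofRat (I.y v),
    ofFun fun v => ofProp (v ∈ I.e₀), ofFun fun i => ofSub (I.T i), ofFun fun i => ofRat (I.μ i)]

open Data in
/-- The encoding of a multigraph: the characteristic vector of the vertices and the matrix of the
edge multiplicities. -/
def Multigraph.encode {n : ℕ} (H : Multigraph (Fin n)) : Data :=
  pair (ofFun fun v => ofProp (v ∈ H.verts)) (ofSymm fun e => num (H.mult e : ℤ))

/-- `p` is a randomized polynomial-time algorithm that samples `H` as required, for all valid inputs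
with rational numbers: there are polynomials `len` and `time` such that, for an input with encoding
of size `s` and every string `ω` of `len s` bits, `p` outputs the multigraph `H ω` within time
`time s`, where `H ω` has the required properties for uniformly random `ω`. -/
def Prog.Samples (p : Prog) : Prop :=
  ∃ len time : Polynomial ℕ, ∀ (n k : ℕ) (I : Input ℚ (Fin n) (Fin k)), I.toReal.Valid →
    ∃ H : (Fin (len.eval I.encode.size) → Bool) → Multigraph (Fin n),
      (∀ ω, ∃ t ≤ time.eval I.encode.size,
        p.Runs (.pair I.encode (Data.ofBits ω)) (H ω).encode t) ∧
      I.toReal.GoodSample (PMF.uniformOfFintype _) H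

end PrizeCollecting

end

/-! The expectation in (ii) can be met by one well-chosen outcome, so the multigraph is built
deterministically: the sampler reads no random bits.

Discarding `e₀` from the Held-Karp point leaves a point of the spanning tree polytope of `G₁`: from
the degree equations, `2 z(E[S]) + z(δ(S)) = 2|S|`, hence `z(E[S]) ≤ |S| - 1` for proper subsets
`S`, while `e₀` accounts for the one unit missing in the total (`InHeldKarp.treePolytope`). Each
edge `e_T` is now split into two parallel copies of values `3/4 μ_T` and `1/4 μ_T`. Choosing the
first copy means taking the backbone of `T` together with doubled limbs, choosing the second means
taking the backbone alone. The multilinear function `objective` is the cost of the chosen copies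
plus, for each vertex outside the core, its penalty times the product of `1 - x_k` over the
limb-keeping copies of trees containing it. At the start point the cost part is exactly that of the
bound, because `2 · 3/4 = 3/2`, and the products are at most `exp(-3 y_v / 4)` by `1 - t ≤ exp(-t)`
(`obj_start_le`).

Moving value from one edge to another changes this function by a concave quadratic, since the only
second-order term is minus a product of nonnegative factors (`pairConcave_objective`). So one of the
two directions does not increase it. Pipage rounding moves as far as possible in such a direction.
Convexity shows that no pair becomes movable again (`Movable.of_shift`), and uncrossing tight sets
shows that a point without movable pairs is integral (`TreePolytope.integral_of_not_movable`). An
integral point meets every cut of the core, so the union of the chosen tours is connected; backbones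
have even degree away from the core, and so do doubled limbs (`goodSample`).

For the algorithm, all values are integers over a common denominator `D`. Membership in the spanning
tree polytope is tested by an orientation criterion: for every root `r`, the edge values and an
extra load `D` at `r` must be distributable to endpoints with load at most `D` everywhere. A scaling
method approximates the best distribution by moving loads downhill in amounts that are powers of two
(`Balanced.vload_le`), and multiplying the data by a large integer makes the approximate answer
exact (`inPolytope_iff`). Maximal pipage moves are found by binary search. The class `PT` of
polynomial-time functions is closed under the list operations used, so the program exists by
composition. -/

namespace PrizeCollecting

/-! # Polynomial-time functions -/

/-- Types whose elements are represented by values of the model of computation. -/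
class Enc (α : Type*) where
  enc : α → Data

open Enc (enc)

instance : Enc ℕ := ⟨fun n => .num n⟩
instance : Enc ℤ := ⟨.num⟩
instance : Enc Bool := ⟨fun b => .num (if b then 1 else 0)⟩
instance : Enc Unit := ⟨fun _ => .num 0⟩
instance {α β : Type*} [Enc α] [Enc β] : Enc (α × β) := ⟨fun p => .pair (enc p.1) (enc p.2)⟩
instance {α : Type*} [Enc α] : Enc (List α) := ⟨fun l => .ofList (l.map enc)⟩
instance {α : Type*} [Enc α] (P : α → Prop) : Enc {a // P a} := ⟨fun a => enc a.1⟩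

/-- The size of the representation. -/
def sz {α : Type*} [Enc α] (a : α) : ℕ := (enc a).size

theorem Data.size_pos (a : Data) : 0 < a.size := by
  cases a <;> simp [Data.size]

/-- Every elementary operation pays for reading its argument and writing its result, so running
times also control sizes. -/
theorem Prog.Runs.size_le {p : Prog} {a b : Data} {t : ℕ} (h : p.Runs a b t) :
    a.size ≤ t ∧ b.size ≤ t := by
  induction h with
  | both _ _ h1 h2 => simp only [Data.size]; omega
  | _ => omega

section Bounds

variable {α β γ : Type*} [Enc α] [Enc β] [Enc γ]

/-- Functions that are polynomially bounded in the size of the argument. -/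
def PolyBdd (T : α → ℕ) : Prop := ∃ k : ℕ, ∀ a, T a ≤ (sz a + 2) ^ k

theorem PolyBdd.mono {S T : α → ℕ} (hT : PolyBdd T) (h : ∀ a, S a ≤ T a) : PolyBdd S :=
  hT.imp fun _ hk a => (h a).trans (hk a)

/-- The base `sz a + 2` is at least two, so a larger exponent absorbs constants and sums; no leading
coefficient is needed. -/
theorem PolyBdd.const (c : ℕ) : PolyBdd fun _ : α => c :=
  ⟨c, fun a => (Nat.lt_two_pow_self).le.trans (Nat.pow_le_pow_left (by omega) c)⟩

theorem PolyBdd.sz : PolyBdd fun a : α => sz a := ⟨1, fun a => by simp⟩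

theorem PolyBdd.add {S T : α → ℕ} (hS : PolyBdd S) (hT : PolyBdd T) :
    PolyBdd fun a => S a + T a := by
  obtain ⟨k, hk⟩ := hS
  obtain ⟨l, hl⟩ := hT
  refine ⟨max k l + 1, fun a => ?_⟩
  have h1 := (hk a).trans (Nat.pow_le_pow_right (by omega) (le_max_left k l))
  have h2 := (hl a).trans (Nat.pow_le_pow_right (by omega) (le_max_right k l))
  rw [pow_succ]
  nlinarith

theorem PolyBdd.mul {S T : α → ℕ} (hS : PolyBdd S) (hT : PolyBdd T) :
    PolyBdd fun a => S a * T a := by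
  obtain ⟨k, hk⟩ := hS
  obtain ⟨l, hl⟩ := hT
  exact ⟨k + l, fun a => by rw [pow_add]; exact Nat.mul_le_mul (hk a) (hl a)⟩

theorem PolyBdd.pow {S : α → ℕ} (hS : PolyBdd S) (c : ℕ) : PolyBdd fun a => S a ^ c := by
  obtain ⟨k, hk⟩ := hS
  exact ⟨k * c, fun a => by rw [pow_mul]; exact Nat.pow_le_pow_left (hk a) c⟩

theorem PolyBdd.comp {T : β → ℕ} (hT : PolyBdd T) {g : α → β}
    (hg : PolyBdd fun a => PrizeCollecting.sz (g a)) : PolyBdd fun a => T (g a) := by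
  obtain ⟨k, hk⟩ := hT
  exact ((hg.add (PolyBdd.const 2)).pow k).mono fun a => hk (g a)

/-- Functions that are computed by a program in polynomial time. -/
@[fun_prop]
def PT (f : α → β) : Prop :=
  ∃ (p : Prog) (k : ℕ), ∀ a, ∃ t ≤ (sz a + 2) ^ k, p.Runs (enc a) (enc (f a)) t

theorem PT.of_time {f : α → β} (p : Prog) {T : α → ℕ} (hT : PolyBdd T)
    (h : ∀ a, ∃ t ≤ T a, p.Runs (enc a) (enc (f a)) t) : PT f := by
  obtain ⟨k, hk⟩ := hT
  refine ⟨p, k, fun a => ?_⟩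
  obtain ⟨t, ht, hr⟩ := h a
  exact ⟨t, ht.trans (hk a), hr⟩

theorem PT.exists_time {f : α → β} (hf : PT f) : ∃ (p : Prog) (T : α → ℕ), PolyBdd T ∧
    ∀ a, ∃ t ≤ T a, p.Runs (enc a) (enc (f a)) t := by
  obtain ⟨p, k, h⟩ := hf
  exact ⟨p, _, ⟨k, fun a => le_rfl⟩, h⟩

/-- This is what makes composition polynomial: the second program runs on an argument of polynomial
size. -/
theorem PT.sz_le {f : α → β} (hf : PT f) : PolyBdd fun a => sz (f a) := by
  obtain ⟨p, k, h⟩ := hf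
  refine ⟨k, fun a => ?_⟩
  obtain ⟨t, ht, hr⟩ := h a
  exact hr.size_le.2.trans ht

theorem PT.of_op {f : α → β} (o : Op) (he : ∀ a, o.eval (enc a) = enc (f a))
    {T : α → ℕ} (hT : PolyBdd T) (hs : ∀ a, sz (f a) ≤ T a) : PT f := by
  refine PT.of_time (.op o) (((PolyBdd.const 1).add PolyBdd.sz).add hT)
    fun a => ⟨_, ?_, he a ▸ Prog.Runs.op o (enc a)⟩
  exact Nat.add_le_add_left (hs a) _

/-- Functions that do not change the representation. -/
theorem PT.of_enc_eq {f : α → β} (h : ∀ a, enc (f a) = enc a) : PT f :=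
  PT.of_op .id (fun a => (h a).symm) PolyBdd.sz fun a => by simp [PrizeCollecting.sz, h]

@[fun_prop]
theorem PT.id : PT fun a : α => a := PT.of_enc_eq fun _ => rfl

@[fun_prop]
theorem PT.comp {g : β → γ} {f : α → β} (hg : PT g) (hf : PT f) : PT fun a => g (f a) := by
  obtain ⟨q, S, hS, h2⟩ := hg.exists_time
  have hc := hS.comp hf.sz_le
  obtain ⟨p, T, hT, h1⟩ := hf.exists_time
  refine PT.of_time (.seq p q) (((PolyBdd.const 1).add hT).add hc) fun a => ?_
  obtain ⟨t, ht, hr⟩ := h1 a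
  obtain ⟨s, hs, hr'⟩ := h2 (f a)
  exact ⟨_, by omega, hr.seq hr'⟩

@[fun_prop]
theorem PT.pair {f : α → β} {g : α → γ} (hf : PT f) (hg : PT g) : PT fun a => (f a, g a) := by
  obtain ⟨p, T, hT, h1⟩ := hf.exists_time
  obtain ⟨q, S, hS, h2⟩ := hg.exists_time
  refine PT.of_time (.both p q) (((PolyBdd.const 1).add hT).add hS) fun a => ?_
  obtain ⟨t, ht, hr⟩ := h1 a
  obtain ⟨s, hs, hr'⟩ := h2 a
  exact ⟨_, by omega, hr.both hr'⟩

theorem sz_pair (a : α) (b : β) : sz (a, b) = 1 + sz a + sz b := rfl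

theorem sz_pos (a : α) : 0 < sz a := Data.size_pos _

@[fun_prop]
theorem PT.fst {f : α → β × γ} (hf : PT f) : PT fun a => (f a).1 :=
  PT.comp (g := Prod.fst) (PT.of_op .fst (fun _ => rfl) PolyBdd.sz fun a => by
    obtain ⟨b, c⟩ := a; rw [sz_pair]; simp only; omega) hf

@[fun_prop]
theorem PT.snd {f : α → β × γ} (hf : PT f) : PT fun a => (f a).2 :=
  PT.comp (g := Prod.snd) (PT.of_op .snd (fun _ => rfl) PolyBdd.sz fun a => by
    obtain ⟨b, c⟩ := a; rw [sz_pair]; simp only; omega) hf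

/-- Only integers are available as constant operations; other values are assembled by pairing. Each
leaf reads the argument again, so the time is linear in its size with a factor depending on `d`. -/
theorem exists_prog_const (d : Data) : ∃ (p : Prog) (c : ℕ), ∀ a : Data,
    ∃ t ≤ c * a.size + c, p.Runs a d t := by
  induction d with
  | num z =>
    refine ⟨.op (.const z), 1 + (Data.num z).size, fun a => ⟨_, ?_, .op _ _⟩⟩
    simp only [Op.eval]
    nlinarith [a.size_pos]
  | pair u v hu hv =>
    obtain ⟨p, c, hp⟩ := hu
    obtain ⟨q, d, hq⟩ := hv
    refine ⟨.both p q, 1 + c + d, fun a => ?_⟩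
    obtain ⟨t, ht, hr⟩ := hp a
    obtain ⟨s, hs, hr'⟩ := hq a
    exact ⟨_, by nlinarith [a.size_pos], hr.both hr'⟩

@[fun_prop]
theorem PT.const (b : β) : PT fun _ : α => b := by
  obtain ⟨p, c, hp⟩ := exists_prog_const (enc b)
  exact PT.of_time p (((PolyBdd.const c).mul PolyBdd.sz).add (PolyBdd.const c)) fun a => hp (enc a)

theorem enc_true_ne : (enc true : Data) ≠ .num 0 := by simp [enc]

@[fun_prop]
theorem PT.cond {c : α → Bool} {f g : α → β} (hc : PT c) (hf : PT f) (hg : PT g) :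
    PT fun a => bif c a then f a else g a := by
  obtain ⟨p, T, hT, h1⟩ := hc.exists_time
  obtain ⟨q, S, hS, h2⟩ := hf.exists_time
  obtain ⟨r, R, hR, h3⟩ := hg.exists_time
  refine PT.of_time (.ite p q r) ((((PolyBdd.const 1).add hT).add hS).add hR) fun a => ?_
  obtain ⟨t, ht, hr⟩ := h1 a
  obtain ⟨s, hs, hr'⟩ := h2 a
  obtain ⟨u, hu, hr''⟩ := h3 a
  cases h : c a with
  | true =>
    rw [h] at hr
    exact ⟨_, by omega, hr.ite_true enc_true_ne hr'⟩
  | false =>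
    rw [h] at hr
    exact ⟨_, by omega, Prog.Runs.ite_false hr hr''⟩

@[fun_prop]
theorem PT.not {c : α → Bool} (hc : PT c) : PT fun a => !c a := by
  have : (fun a => !c a) = fun a => bif c a then false else true := by
    funext a; cases c a <;> rfl
  rw [this]; fun_prop

@[fun_prop]
theorem PT.and {c d : α → Bool} (hc : PT c) (hd : PT d) : PT fun a => c a && d a := by
  have : (fun a => c a && d a) = fun a => bif c a then d a else false := by
    funext a; cases c a <;> rfl
  rw [this]; fun_prop

@[fun_prop]
theorem PT.or {c d : α → Bool} (hc : PT c) (hd : PT d) : PT fun a => c a || d a := by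
  have : (fun a => c a || d a) = fun a => bif c a then true else d a := by
    funext a; cases c a <;> rfl
  rw [this]; fun_prop

@[fun_prop]
theorem PT.ite {c : α → Prop} [∀ a, Decidable (c a)] {f g : α → β} (hc : PT fun a => decide (c a))
    (hf : PT f) (hg : PT g) : PT fun a => if c a then f a else g a := by
  have : (fun a => if c a then f a else g a) = fun a => bif decide (c a) then f a else g a := by
    funext a; by_cases h : c a <;> simp [h]
  rw [this]; fun_prop

end Bounds

/-! ## Arithmetic -/

section Arith

variable {α : Type*} [Enc α]

theorem sz_nat (n : ℕ) : sz n = 1 + Nat.size n := rfl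

theorem sz_bool_le (b : Bool) : sz b ≤ 2 := by
  cases b <;> simp [sz, enc, Data.size]

theorem size_add_le (a b : ℕ) : Nat.size (a + b) ≤ Nat.size a + Nat.size b + 1 := by
  rw [Nat.size_le]
  have ha := Nat.lt_size_self a
  have hb := Nat.lt_size_self b
  have h1 : 2 ^ a.size ≤ 2 ^ (a.size + b.size) := Nat.pow_le_pow_right (by omega) (by omega)
  have h2 : 2 ^ b.size ≤ 2 ^ (a.size + b.size) := Nat.pow_le_pow_right (by omega) (by omega)
  rw [pow_succ]; omega

theorem size_mul_le (a b : ℕ) : Nat.size (a * b) ≤ Nat.size a + Nat.size b := by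
  rw [Nat.size_le, pow_add]
  exact Nat.mul_lt_mul'' (Nat.lt_size_self a) (Nat.lt_size_self b)

theorem sz_nat_mono {a b : ℕ} (h : a ≤ b) : sz a ≤ sz b :=
  Nat.add_le_add_left (Nat.size_le_size h) 1

theorem sz_nat_le (a : ℕ) : sz a ≤ a + 1 := by
  rw [sz_nat, add_comm]
  exact Nat.add_le_add_right (Nat.size_le.2 Nat.lt_two_pow_self) 1

@[fun_prop]
theorem PT.natAdd {f g : α → ℕ} (hf : PT f) (hg : PT g) : PT fun a => f a + g a :=
  PT.comp (g := fun p : ℕ × ℕ => p.1 + p.2) (PT.of_op .add (fun _ => by simp [enc, Op.eval])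
    PolyBdd.sz fun p => by
      have := size_add_le p.1 p.2
      obtain ⟨a, b⟩ := p; simp only [sz_pair, sz_nat] at *; omega) (hf.pair hg)

@[fun_prop]
theorem PT.natMul {f g : α → ℕ} (hf : PT f) (hg : PT g) : PT fun a => f a * g a :=
  PT.comp (g := fun p : ℕ × ℕ => p.1 * p.2) (PT.of_op .mul (fun _ => by simp [enc, Op.eval])
    PolyBdd.sz fun p => by
      have := size_mul_le p.1 p.2
      obtain ⟨a, b⟩ := p; simp only [sz_pair, sz_nat] at *; omega) (hf.pair hg)

@[fun_prop]
theorem PT.natDiv {f g : α → ℕ} (hf : PT f) (hg : PT g) : PT fun a => f a / g a :=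
  PT.comp (g := fun p : ℕ × ℕ => p.1 / p.2) (PT.of_op .div (fun _ => by simp [enc, Op.eval])
    PolyBdd.sz fun p => by
      have := sz_nat_mono (Nat.div_le_self p.1 p.2)
      obtain ⟨a, b⟩ := p; simp only [sz_pair] at *; omega) (hf.pair hg)

@[fun_prop]
theorem PT.intLe {f g : α → ℤ} (hf : PT f) (hg : PT g) : PT fun a => decide (f a ≤ g a) :=
  PT.comp (g := fun p : ℤ × ℤ => decide (p.1 ≤ p.2))
    (PT.of_op .le (fun _ => by simp [enc, Op.eval]) (PolyBdd.const 2) fun p => sz_bool_le _)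
    (hf.pair hg)

@[fun_prop]
theorem PT.natCast {f : α → ℕ} (hf : PT f) : PT fun a => (f a : ℤ) :=
  PT.comp (g := fun n : ℕ => (n : ℤ)) (PT.of_enc_eq fun _ => rfl) hf

@[fun_prop]
theorem PT.natLe {f g : α → ℕ} (hf : PT f) (hg : PT g) : PT fun a => decide (f a ≤ g a) := by
  have : (fun a => decide (f a ≤ g a)) = fun a => decide ((f a : ℤ) ≤ g a) := by simp
  rw [this]; fun_prop

@[fun_prop]
theorem PT.natEq {f g : α → ℕ} (hf : PT f) (hg : PT g) : PT fun a => decide (f a = g a) := by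
  have : (fun a => decide (f a = g a)) = fun a => decide (f a ≤ g a) && decide (g a ≤ f a) := by
    funext a; rw [← Bool.decide_and]; exact decide_eq_decide.2 le_antisymm_iff
  rw [this]; fun_prop

@[fun_prop]
theorem PT.intSubNat {f g : α → ℕ} (hf : PT f) (hg : PT g) : PT fun a => (f a : ℤ) - g a :=
  PT.comp (g := fun p : ℕ × ℕ => (p.1 : ℤ) - p.2) (PT.of_op .sub (fun _ => by simp [enc, Op.eval])
    PolyBdd.sz fun p => by
      have h : ((p.1 : ℤ) - p.2).natAbs ≤ p.1 + p.2 := by omega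
      have := (Nat.size_le_size h).trans (size_add_le p.1 p.2)
      have e : sz ((p.1 : ℤ) - p.2) = 1 + Nat.size ((p.1 : ℤ) - p.2).natAbs := rfl
      obtain ⟨a, b⟩ := p; simp only [sz_pair, sz_nat] at *; omega) (hf.pair hg)

@[fun_prop]
theorem PT.toNat {f : α → ℤ} (hf : PT f) : PT fun a => (f a).toNat := by
  -- Natural numbers and nonnegative integers have the same encoding, so on this subtype the
  -- conversion is free; only the clamping of negative values is computed.
  have h1 : PT fun z : {z : ℤ // 0 ≤ z} => z.1.toNat := PT.of_enc_eq fun z => by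
    simp [enc, z.2]
  have h2 : PT fun z : ℤ => bif decide (0 ≤ z) then z else 0 := by fun_prop
  have h3 : PT fun z : ℤ => (⟨bif decide (0 ≤ z) then z else 0, by
      by_cases h : 0 ≤ z <;> simp [h]⟩ : {z : ℤ // 0 ≤ z}) := h2
  have h4 := (h1.comp h3).comp hf
  convert h4 using 2 with a
  by_cases h : 0 ≤ f a
  · simp [h]
  · simp [h]; omega

@[fun_prop]
theorem PT.natSub {f g : α → ℕ} (hf : PT f) (hg : PT g) : PT fun a => f a - g a := by
  have : (fun a => f a - g a) = fun a => ((f a : ℤ) - g a).toNat := by funext a; omega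
  rw [this]; fun_prop

end Arith


/-! ## Lists and iteration -/

theorem Prog.runs_while {c p : Prog} {C : ℕ} (N : ℕ) {d : ℕ → Data}
    (hc : ∀ i < N, ∃ t ≤ C, ∃ b, b ≠ .num 0 ∧ c.Runs (d i) b t)
    (hp : ∀ i < N, ∃ t ≤ C, p.Runs (d i) (d (i + 1)) t)
    (hs : ∃ t ≤ C, c.Runs (d N) (.num 0) t) :
    ∃ t ≤ (N + 1) * (2 * C + 1), (Prog.while c p).Runs (d 0) (d N) t := by
  induction N generalizing d with
  | zero =>
    obtain ⟨t, ht, hr⟩ := hs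
    exact ⟨1 + t, by omega, by constructor; exact hr⟩
  | succ N ih =>
    obtain ⟨t, ht, hr⟩ := ih (d := fun i => d (i + 1)) (fun i hi => hc _ (by omega))
      (fun i hi => hp _ (by omega)) hs
    obtain ⟨u, hu, b, hb, hr'⟩ := hc 0 (by omega)
    obtain ⟨w, hw, hr''⟩ := hp 0 (by omega)
    exact ⟨_, by nlinarith, .while_step hr' hb hr'' hr⟩

section Lists

variable {α β σ τ : Type*} [Enc α] [Enc β] [Enc σ] [Enc τ]

/-- Each branch has to be computable only on the arguments that reach it. This allows partial
functions such as `List.head`, which is the operation `fst` on nonempty lists only. -/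
theorem PT.dite {c : α → Bool} {f : {a // c a = true} → β} {g : {a // ¬ c a = true} → β}
    (hc : PT c) (hf : PT f) (hg : PT g) :
    PT fun a => if h : c a = true then f ⟨a, h⟩ else g ⟨a, h⟩ := by
  obtain ⟨p, k, h1⟩ := hc
  obtain ⟨q, l, h2⟩ := hf
  obtain ⟨r, m, h3⟩ := hg
  have hb (k : ℕ) : PolyBdd fun a : α => (sz a + 2) ^ k :=
    (PolyBdd.sz.add (PolyBdd.const 2)).pow k
  refine PT.of_time (.ite p q r) ((((PolyBdd.const 1).add (hb k)).add (hb l)).add (hb m))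
    fun a => ?_
  obtain ⟨t, ht, hr⟩ := h1 a
  by_cases h : c a = true
  · obtain ⟨s, hs, hr'⟩ := h2 ⟨a, h⟩
    have e : sz (⟨a, h⟩ : {a // c a = true}) = sz a := rfl
    rw [h] at hr
    simp only [h, dite_true]
    rw [e] at hs
    exact ⟨_, by omega, hr.ite_true enc_true_ne hr'⟩
  · obtain ⟨s, hs, hr'⟩ := h3 ⟨a, h⟩
    have e : sz (⟨a, h⟩ : {a // ¬ c a = true}) = sz a := rfl
    have h' : c a = false := by simpa using h
    rw [h'] at hr
    simp only [h]
    rw [e] at hs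
    exact ⟨_, by omega, Prog.Runs.ite_false hr hr'⟩

/-- Iteration while a test succeeds, with a polynomial number of iterations through values of
polynomial size. -/
theorem PT.iterate {s : α → σ} {c : σ → Bool} {f : σ → σ} {N T : α → ℕ} (hs : PT s) (hc : PT c)
    (hf : PT f) (hN : PolyBdd N) (hT : PolyBdd T)
    (hlt : ∀ a, ∀ i < N a, c (f^[i] (s a)) = true) (hend : ∀ a, c (f^[N a] (s a)) = false)
    (hsz : ∀ a, ∀ i ≤ N a, sz (f^[i] (s a)) ≤ T a) : PT fun a => f^[N a] (s a) := by
  obtain ⟨p, S, hS, h1⟩ := hs.exists_time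
  obtain ⟨q, k, h2⟩ := hc
  obtain ⟨r, l, h3⟩ := hf
  have hb (k : ℕ) : PolyBdd fun a : α => (T a + 2) ^ k := (hT.add (PolyBdd.const 2)).pow k
  refine PT.of_time (.seq p (.while q r)) (((PolyBdd.const 1).add hS).add
    ((hN.add (PolyBdd.const 1)).mul
      (((PolyBdd.const 2).mul ((hb k).add (hb l))).add (PolyBdd.const 1)))) fun a => ?_
  obtain ⟨t, ht, hr⟩ := h1 a
  have hmono (k i : ℕ) (hi : i ≤ N a) : (sz (f^[i] (s a)) + 2) ^ k ≤ (T a + 2) ^ k :=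
    Nat.pow_le_pow_left (Nat.add_le_add_right (hsz a i hi) 2) k
  obtain ⟨u, hu, hr'⟩ := Prog.runs_while (c := q) (p := r) (C := (T a + 2) ^ k + (T a + 2) ^ l)
    (N a) (d := fun i => enc (f^[i] (s a)))
    (fun i hi => by
      obtain ⟨t, ht, hr⟩ := h2 (f^[i] (s a))
      rw [hlt a i hi] at hr
      exact ⟨t, (ht.trans (hmono k i hi.le)).trans (Nat.le_add_right _ _), _, enc_true_ne, hr⟩)
    (fun i hi => by
      obtain ⟨t, ht, hr⟩ := h3 (f^[i] (s a))
      rw [← Function.iterate_succ_apply' f i (s a)] at hr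
      exact ⟨t, (ht.trans (hmono l i hi.le)).trans (Nat.le_add_left _ _), hr⟩)
    (by
      obtain ⟨t, ht, hr⟩ := h2 (f^[N a] (s a))
      rw [hend a] at hr
      exact ⟨t, (ht.trans (hmono k _ le_rfl)).trans (Nat.le_add_right _ _), hr⟩)
  exact ⟨_, by omega, hr.seq hr'⟩

theorem sz_nil : sz ([] : List τ) = 1 := rfl

theorem sz_cons (x : τ) (l : List τ) : sz (x :: l) = 1 + sz x + sz l := rfl

theorem length_lt_sz (l : List τ) : l.length < sz l := by
  induction l with
  | nil => simp [sz_nil]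
  | cons x l ih => rw [sz_cons]; simp; omega

theorem sz_mem_lt {l : List τ} {x : τ} (h : x ∈ l) : sz x < sz l := by
  induction l with
  | nil => simp at h
  | cons y l ih =>
    rw [sz_cons]
    rcases List.mem_cons.1 h with rfl | h
    · have := sz_pos l; omega
    · have := ih h; omega

theorem sz_list_le {l : List τ} {B n : ℕ} (hn : l.length ≤ n) (h : ∀ x ∈ l, sz x ≤ B) :
    sz l ≤ 1 + n * (B + 1) := by
  induction l generalizing n with
  | nil => simp [sz_nil]
  | cons x l ih =>
    rw [sz_cons]
    have h1 := h x (by simp)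
    obtain ⟨m, rfl⟩ : ∃ m, n = m + 1 := ⟨n - 1, by simp at hn; omega⟩
    have h2 := ih (n := m) (by simpa using hn) fun y hy => h y (by simp [hy])
    rw [add_mul]; omega

theorem sz_drop_le (l : List τ) (i : ℕ) : sz (l.drop i) ≤ sz l := by
  induction i generalizing l with
  | zero => simp
  | succ i ih =>
    cases l with
    | nil => simp
    | cons x l => rw [List.drop_succ_cons, sz_cons]; exact (ih l).trans (by omega)

@[fun_prop]
theorem PT.cons {f : α → τ} {l : α → List τ} (hf : PT f) (hl : PT l) : PT fun a => f a :: l a :=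
  PT.comp (g := fun p : τ × List τ => p.1 :: p.2) (PT.of_enc_eq fun _ => rfl) (hf.pair hl)

@[fun_prop]
theorem PT.isCons {l : α → List τ} (hl : PT l) : PT fun a => !(l a).isEmpty :=
  PT.comp (g := fun l : List τ => !l.isEmpty) (PT.of_op .isPair (fun l => by cases l <;> rfl)
    (PolyBdd.const 2) fun _ => sz_bool_le _) hl

theorem PT.head : PT fun l : {l : List τ // (!l.isEmpty) = true} =>
    l.1.head (by have := l.2; simpa using this) :=
  PT.of_op .fst (fun ⟨l, h⟩ => by cases l <;> first | rfl | simp at h) PolyBdd.sz fun ⟨l, h⟩ =>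
    (sz_mem_lt (List.head_mem _)).le

@[fun_prop]
theorem PT.tail {l : α → List τ} (hl : PT l) : PT fun a => (l a).tail :=
  PT.comp (g := fun l : List τ => l.tail) (PT.of_op .snd (fun l => by cases l <;> rfl)
    PolyBdd.sz fun l => by rw [← List.drop_one]; exact sz_drop_le l 1) hl

theorem PT.subtype {P : α → Prop} {f : α → β} (hf : PT f) : PT fun a : {a // P a} => f a.1 :=
  PT.comp hf (PT.of_enc_eq fun _ => rfl)

/-- Polynomial steps do not make a fold polynomial, as repeated squaring shows. Hence the separate
size bound on the accumulators, required only for prefixes of the list that is folded. -/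
theorem PT.foldl {l : α → List τ} {s : α → σ} {f : α → σ → τ → σ} {T : α → ℕ} (hl : PT l)
    (hs : PT s) (hf : PT fun p : α × σ × τ => f p.1 p.2.1 p.2.2) (hT : PolyBdd T)
    (hsz : ∀ a l', l' <+: l a → sz (l'.foldl (f a) (s a)) ≤ T a) :
    PT fun a => (l a).foldl (f a) (s a) := by
  -- The loop state consists of the argument, the accumulator and the rest of the list; programs
  -- have no variables, so the argument is carried along.
  let c : α × σ × List τ → Bool := fun p => !p.2.2.isEmpty
  let g : α × σ × List τ → α × σ × List τ := fun p =>
    if h : c p = true then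
      (p.1, f p.1 p.2.1 (p.2.2.head (by simpa [c] using h)), p.2.2.tail)
    else p
  have hc : PT c := by fun_prop
  have hg : PT g := by
    refine PT.dite (f := fun p : {p : α × σ × List τ // c p = true} =>
        (p.1.1, f p.1.1 p.1.2.1 (p.1.2.2.head (by have := p.2; simpa [c] using this)),
          p.1.2.2.tail)) (g := fun p => p.1) hc ?_ (PT.of_enc_eq fun _ => rfl)
    have h1 : PT fun p : {p : α × σ × List τ // c p = true} => p.1.1 :=
      PT.subtype (f := fun p : α × σ × List τ => p.1) (by fun_prop)
    have h2 : PT fun p : {p : α × σ × List τ // c p = true} => p.1.2.1 :=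
      PT.subtype (f := fun p : α × σ × List τ => p.2.1) (by fun_prop)
    have h3 : PT fun p : {p : α × σ × List τ // c p = true} => p.1.2.2.tail :=
      PT.subtype (f := fun p : α × σ × List τ => p.2.2.tail) (by fun_prop)
    have h4 : PT fun p : {p : α × σ × List τ // c p = true} =>
        (⟨p.1.2.2, p.2⟩ : {l : List τ // (!l.isEmpty) = true}) :=
      PT.subtype (f := fun p : α × σ × List τ => p.2.2) (by fun_prop)
    exact h1.pair ((hf.comp (h1.pair (h2.pair (PT.head.comp h4)))).pair h3)
  have hit (a : α) (i : ℕ) (hi : i ≤ (l a).length) : g^[i] (a, s a, l a) =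
      (a, ((l a).take i).foldl (f a) (s a), (l a).drop i) := by
    induction i with
    | zero => simp
    | succ i ih =>
      rw [Function.iterate_succ_apply', ih (by omega)]
      have h : c (a, ((l a).take i).foldl (f a) (s a), (l a).drop i) = true := by
        simp [c]; omega
      simp only [g, h, dite_true, List.tail_drop, List.head_drop]
      rw [← List.take_concat_get' _ _ (show i < (l a).length by omega), List.foldl_append]
      rfl
  have key : PT fun a => g^[(l a).length] (a, s a, l a) := by
    refine PT.iterate (c := c) (T := fun a => 1 + sz a + (1 + T a + sz (l a))) (by fun_prop) hc hg
      (hl.sz_le.mono fun a => (length_lt_sz (l a)).le)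
      (((PolyBdd.const 1).add PolyBdd.sz).add (((PolyBdd.const 1).add hT).add hl.sz_le))
      (fun a i hi => ?_) (fun a => ?_) (fun a i hi => ?_)
    · rw [hit a i hi.le]; simp [c]; omega
    · rw [hit a _ le_rfl]; simp [c]
    · rw [hit a i hi, sz_pair, sz_pair]
      have := hsz a _ ((l a).take_prefix i)
      have := sz_drop_le (l a) i
      omega
  have := key.snd.fst
  convert this using 2 with a
  rw [hit a _ le_rfl]; simp

end Lists


/-! ### Polynomial-time list operations obtained from folds -/

section ListFunctions

variable {α β σ τ : Type*} [Enc α] [Enc β] [Enc σ] [Enc τ]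

theorem sz_prefix_le {l' l : List τ} (h : l' <+: l) : sz l' ≤ sz l := by
  obtain ⟨r, rfl⟩ := h
  induction l' with
  | nil => exact sz_pos _
  | cons x l' ih => rw [List.cons_append, sz_cons, sz_cons]; omega

theorem PT.foldl_inv {l : α → List τ} {s : α → σ} {f : α → σ → τ → σ} {T : α → ℕ}
    (Inv : α → σ → Prop) (hl : PT l) (hs : PT s) (hf : PT fun p : α × σ × τ => f p.1 p.2.1 p.2.2)
    (hT : PolyBdd T) (h0 : ∀ a, Inv a (s a)) (hstep : ∀ a s x, Inv a s → Inv a (f a s x))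
    (hsz : ∀ a s, Inv a s → sz s ≤ T a) : PT fun a => (l a).foldl (f a) (s a) := by
  refine PT.foldl hl hs hf hT fun a l' _ => hsz a _ ?_
  suffices h : ∀ (l' : List τ) (s₀ : σ), Inv a s₀ → Inv a (l'.foldl (f a) s₀) from h _ _ (h0 a)
  intro l'
  induction l' with
  | nil => exact fun _ h => h
  | cons x l' ih => exact fun _ h => ih _ (hstep a _ x h)

theorem PT.exists_bound {l : α → List τ} {f : α → τ → β} (hl : PT l)
    (hf : PT fun p : α × τ => f p.1 p.2) :
    ∃ B : α → ℕ, PolyBdd B ∧ ∀ a, ∀ x ∈ l a, sz (f a x) ≤ B a := by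
  obtain ⟨k, hk⟩ := hf.sz_le
  refine ⟨fun a => (1 + sz a + sz (l a) + 2) ^ k, ((((PolyBdd.const 1).add PolyBdd.sz).add
    hl.sz_le).add (PolyBdd.const 2)).pow k, fun a x hx => (hk (a, x)).trans
    (Nat.pow_le_pow_left ?_ k)⟩
  rw [sz_pair]
  have := sz_mem_lt hx
  omega

theorem foldl_cons_eq {γ δ : Type*} (f : γ → δ) (l : List γ) (s : List δ) :
    l.foldl (fun s x => f x :: s) s = (l.map f).reverse ++ s := by
  induction l generalizing s with
  | nil => rfl
  | cons x l ih => simp [ih]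

theorem sz_append (l l' : List τ) : sz (l ++ l') + 1 = sz l + sz l' := by
  induction l with
  | nil => rw [List.nil_append, sz_nil, add_comm]
  | cons x l ih => rw [List.cons_append, sz_cons, sz_cons]; omega

theorem sz_reverse (l : List τ) : sz l.reverse = sz l := by
  induction l with
  | nil => rfl
  | cons x l ih =>
    have := sz_append l.reverse [x]
    rw [List.reverse_cons, sz_cons]
    rw [sz_cons, sz_nil] at this
    omega

/-- Consing along a fold reverses the list; a second reversal then gives `append`, `map` and
`filter`. -/
theorem PT.revAppend {l s : α → List τ} (hl : PT l) (hs : PT s) :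
    PT fun a => (l a).reverse ++ s a := by
  have : (fun a => (l a).reverse ++ s a) =
      fun a => (l a).foldl (fun s x => x :: s) (s a) := by
    funext a; rw [foldl_cons_eq (fun x : τ => x) (l a) (s a), List.map_id']
  rw [this]
  refine PT.foldl (f := fun a s x => x :: s) hl hs (by fun_prop) (hl.sz_le.add hs.sz_le)
    fun a l' h => ?_
  have h1 := foldl_cons_eq (fun x : τ => x) l' (s a)
  rw [List.map_id'] at h1
  rw [h1]
  have h2 := sz_append l'.reverse (s a)
  have h3 := sz_prefix_le h
  rw [sz_reverse] at h2
  omega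

@[fun_prop]
theorem PT.reverse {l : α → List τ} (hl : PT l) : PT fun a => (l a).reverse := by
  have := PT.revAppend hl (PT.const ([] : List τ))
  simpa using this

@[fun_prop]
theorem PT.append {l s : α → List τ} (hl : PT l) (hs : PT s) : PT fun a => l a ++ s a := by
  have := PT.revAppend hl.reverse hs
  simpa using this

@[fun_prop]
theorem PT.map {l : α → List τ} {f : α → τ → β} (hf : PT fun p : α × τ => f p.1 p.2)
    (hl : PT l) : PT fun a => (l a).map (f a) := by
  have h : PT fun a => (l a).foldl (fun s x => f a x :: s) ([] : List β) := by
    obtain ⟨B, hB, h⟩ := PT.exists_bound hl hf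
    have hf' : PT fun p : α × List β × τ => f p.1 p.2.2 :=
      PT.comp (f := fun p : α × List β × τ => (p.1, p.2.2)) hf (by fun_prop)
    refine PT.foldl (s := fun _ => []) (f := fun a s x => f a x :: s) hl (by fun_prop) (by fun_prop)
      ((PolyBdd.const 1).add (hl.sz_le.mul (hB.add (PolyBdd.const 1)))) fun a l' hl' => ?_
    rw [foldl_cons_eq, List.append_nil, sz_reverse]
    refine sz_list_le ?_ fun y hy => ?_
    · rw [List.length_map]; exact ((length_lt_sz l').le).trans (sz_prefix_le hl')
    · obtain ⟨x, hx, rfl⟩ := List.mem_map.1 hy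
      exact h a x (hl'.subset hx)
  have := h.reverse
  convert this using 2 with a
  rw [foldl_cons_eq]; simp

theorem foldl_filter_eq {γ : Type*} (c : γ → Bool) (l s : List γ) :
    l.foldl (fun s x => bif c x then x :: s else s) s = (l.filter c).reverse ++ s := by
  induction l generalizing s with
  | nil => rfl
  | cons x l ih => cases h : c x <;> simp [ih, h]

@[fun_prop]
theorem PT.filter {l : α → List τ} {c : α → τ → Bool} (hc : PT fun p : α × τ => c p.1 p.2)
    (hl : PT l) : PT fun a => (l a).filter (c a) := by
  have h : PT fun a => (l a).foldl (fun s x => bif c a x then x :: s else s) ([] : List τ) := by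
    have hc' : PT fun p : α × List τ × τ => c p.1 p.2.2 :=
      PT.comp (f := fun p : α × List τ × τ => (p.1, p.2.2)) hc (by fun_prop)
    refine PT.foldl (s := fun _ => []) (f := fun a s x => bif c a x then x :: s else s) hl (by fun_prop)
      (by fun_prop) ((PolyBdd.const 1).add (hl.sz_le.mul (hl.sz_le.add (PolyBdd.const 1))))
      fun a l' hl' => ?_
    rw [foldl_filter_eq, List.append_nil, sz_reverse]
    refine sz_list_le ?_ fun y hy => ?_
    · exact ((List.length_filter_le _ _).trans (length_lt_sz l').le).trans (sz_prefix_le hl')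
    · exact (sz_mem_lt (hl'.subset (List.mem_of_mem_filter hy))).le
  have := h.reverse
  convert this using 2 with a
  rw [foldl_filter_eq]; simp

@[fun_prop]
theorem PT.length {l : α → List τ} (hl : PT l) : PT fun a => (l a).length := by
  have e (l : List τ) (n : ℕ) : l.foldl (fun n _ => n + 1) n = n + l.length := by
    induction l generalizing n with
    | nil => rfl
    | cons x l ih => simp [ih]; omega
  have : (fun a => (l a).length) = fun a => (l a).foldl (fun n _ => n + 1) 0 := by
    funext a; rw [e]; omega
  rw [this]
  refine PT.foldl (f := fun a n x => n + 1) hl (by fun_prop) (by fun_prop) hl.sz_le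
    fun a l' hl' => ?_
  rw [e, zero_add]
  have := length_lt_sz l'
  have := sz_prefix_le hl'
  have := sz_nat_le l'.length
  omega

@[fun_prop]
theorem PT.rangeLength {l : α → List τ} (hl : PT l) : PT fun a => List.range (l a).length := by
  have e (l : List τ) : l.foldl (fun s _ => s.length :: s) [] = (List.range l.length).reverse := by
    induction l using List.reverseRecOn with
    | nil => rfl
    | append_singleton l x ih => simp [ih, List.range_succ]
  have : (fun a => List.range (l a).length) =
      fun a => ((l a).foldl (fun s _ => s.length :: s) []).reverse := by
    funext a; rw [e]; simp
  rw [this]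
  refine PT.reverse (PT.foldl (f := fun a s x => s.length :: s) hl (by fun_prop) (by fun_prop)
    ((PolyBdd.const 1).add (hl.sz_le.mul (hl.sz_le.add (PolyBdd.const 1)))) fun a l' hl' => ?_)
  rw [e, sz_reverse]
  have h1 := length_lt_sz l'
  have h2 := sz_prefix_le hl'
  refine sz_list_le (by simp; omega) fun y hy => ?_
  have h3 := sz_nat_le y
  have h4 := List.mem_range.1 hy
  omega

theorem sz_sum_le (l : List ℕ) : sz l.sum ≤ sz l := by
  induction l with
  | nil => simp [sz_nil, sz_nat]
  | cons x l ih =>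
    have := size_add_le x l.sum
    rw [List.sum_cons, sz_cons]
    simp only [sz_nat] at *
    omega

theorem sz_prod_le (l : List ℕ) : sz l.prod ≤ sz l + 1 := by
  induction l with
  | nil => simp [sz_nil, sz_nat]
  | cons x l ih =>
    have := size_mul_le x l.prod
    rw [List.prod_cons, sz_cons]
    simp only [sz_nat] at *
    omega

@[fun_prop]
theorem PT.sum {l : α → List ℕ} (hl : PT l) : PT fun a => (l a).sum := by
  have : (fun a => (l a).sum) = fun a => (l a).foldl (fun s x => s + x) 0 := by
    funext a; rw [List.sum_eq_foldl]
  rw [this]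
  refine PT.foldl (f := fun a s x => s + x) hl (by fun_prop) (by fun_prop) hl.sz_le
    fun a l' hl' => ?_
  rw [← List.sum_eq_foldl]
  exact (sz_sum_le l').trans (sz_prefix_le hl')

@[fun_prop]
theorem PT.prod {l : α → List ℕ} (hl : PT l) : PT fun a => (l a).prod := by
  have : (fun a => (l a).prod) = fun a => (l a).foldl (fun s x => s * x) 1 := by
    funext a; rw [List.prod_eq_foldl]
  rw [this]
  refine PT.foldl (f := fun a s x => s * x) hl (by fun_prop) (by fun_prop)
    (hl.sz_le.add (PolyBdd.const 1)) fun a l' hl' => ?_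
  rw [← List.prod_eq_foldl]
  exact (sz_prod_le l').trans (Nat.add_le_add_right (sz_prefix_le hl') 1)

@[fun_prop]
theorem PT.any {l : α → List τ} {c : α → τ → Bool} (hc : PT fun p : α × τ => c p.1 p.2)
    (hl : PT l) : PT fun a => (l a).any (c a) := by
  have : (fun a => (l a).any (c a)) = fun a => !((l a).filter (c a)).isEmpty := by
    funext a; induction l a with
    | nil => rfl
    | cons x l ih => cases h : c a x <;> simp [h, ih]
  rw [this]; fun_prop

@[fun_prop]
theorem PT.all {l : α → List τ} {c : α → τ → Bool} (hc : PT fun p : α × τ => c p.1 p.2)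
    (hl : PT l) : PT fun a => (l a).all (c a) := by
  have : (fun a => (l a).all (c a)) = fun a => !(l a).any (fun x => !c a x) := by
    funext a; simp [List.not_any_eq_all_not]
  rw [this]; fun_prop

@[fun_prop]
theorem PT.getD {l : α → List τ} {i : α → ℕ} {d : α → τ} (hl : PT l) (hi : PT i) (hd : PT d) :
    PT fun a => (l a).getD (i a) (d a) := by
  have e (i : ℕ) (d : τ) (l : List τ) : l.foldl
      (fun s x => (s.1 + 1, if s.1 = i then x else s.2)) (0, d) = (l.length, l.getD i d) := by
    induction l using List.reverseRecOn with
    | nil => rfl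
    | append_singleton l x ih =>
      rw [List.foldl_append, ih]
      simp only [List.foldl_cons, List.foldl_nil, List.length_append, List.length_cons,
        List.length_nil, zero_add, Prod.mk.injEq, true_and]
      rcases lt_trichotomy l.length i with h | h | h
      · rw [if_neg h.ne, List.getD_eq_default _ _ h.le, List.getD_eq_default _ _ (by simp; omega)]
      · rw [if_pos h, ← h, List.getD_append_right _ _ _ _ le_rfl]; simp
      · rw [if_neg h.ne', List.getD_append _ _ _ _ h]
  have h : PT fun a => (l a).foldl
      (fun s x => (s.1 + 1, if s.1 = i a then x else s.2)) (0, d a) := by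
    refine PT.foldl (f := fun a (s : ℕ × τ) x => (s.1 + 1, if s.1 = i a then x else s.2)) hl
      (by fun_prop) (by fun_prop) (((PolyBdd.const 1).add hl.sz_le).add (hl.sz_le.add hd.sz_le))
      fun a l' hl' => ?_
    rw [e, sz_pair]
    have h1 := sz_nat_le l'.length
    have h2 := length_lt_sz l'
    have h3 := sz_prefix_le hl'
    have h4 : sz (l'.getD (i a) (d a)) ≤ sz (l a) + sz (d a) := by
      rcases lt_or_ge (i a) l'.length with h | h
      · rw [List.getD_eq_getElem _ _ h]
        have := sz_mem_lt (List.getElem_mem h)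
        omega
      · rw [List.getD_eq_default _ _ h]; omega
    omega
  have := h.snd
  convert this using 2 with a
  rw [e]

/-- The powers of two that are at most `D`, in decreasing order. -/
def powers (D : ℕ) : List ℕ := ((List.range (Nat.size D)).map (2 ^ ·)).reverse

@[fun_prop]
theorem PT.powers {D : α → ℕ} (hD : PT D) : PT fun a => powers (D a) := by
  refine PT.comp (g := PrizeCollecting.powers) ?_ hD
  -- The state is `D`, the next power and the powers so far. Doubling while the power is at most `D`
  -- takes `Nat.size D` rounds.
  let f : ℕ × ℕ × List ℕ → ℕ × ℕ × List ℕ := fun p => (p.1, 2 * p.2.1, p.2.1 :: p.2.2)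
  have e (D i : ℕ) : f^[i] (D, 1, []) = (D, 2 ^ i, ((List.range i).map (2 ^ ·)).reverse) := by
    induction i with
    | zero => rfl
    | succ i ih =>
      rw [Function.iterate_succ_apply', ih]
      simp [f, pow_succ, List.range_succ, mul_comm]
  have h2 (D i : ℕ) (hi : i ≤ Nat.size D) : sz (2 ^ i) ≤ sz D + 1 := by
    rw [sz_nat, sz_nat, Nat.size_pow]; omega
  have hs : PolyBdd fun D : ℕ => Nat.size D := PolyBdd.sz.mono fun D => by rw [sz_nat]; omega
  have h : PT fun D : ℕ => f^[Nat.size D] (D, 1, []) := by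
    refine PT.iterate (s := fun D => (D, 1, [])) (c := fun p => decide (p.2.1 ≤ p.1))
      (T := fun D => 1 + sz D + (1 + (sz D + 1) + (1 + sz D * (sz D + 1 + 1))))
      (by fun_prop) (by fun_prop) (by fun_prop) hs ?_ (fun D i hi => ?_) (fun D => ?_)
      (fun D i hi => ?_)
    · exact ((PolyBdd.const 1).add PolyBdd.sz).add (((PolyBdd.const 1).add (PolyBdd.sz.add
        (PolyBdd.const 1))).add ((PolyBdd.const 1).add (PolyBdd.sz.mul ((PolyBdd.sz.add
        (PolyBdd.const 1)).add (PolyBdd.const 1)))))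
    · rw [e]; simpa using Nat.lt_size.1 hi
    · rw [e]; simpa using Nat.lt_size_self D
    · rw [e, sz_pair, sz_pair, sz_reverse]
      have h3 := h2 D i hi
      have h4 : sz ((List.range i).map (2 ^ ·)) ≤ 1 + sz D * (sz D + 1 + 1) := by
        refine sz_list_le (by simp [sz_nat]; omega) fun y hy => ?_
        obtain ⟨j, hj, rfl⟩ := List.mem_map.1 hy
        exact h2 D j ((List.mem_range.1 hj).le.trans hi)
      omega
  have := h.snd.snd
  convert this using 2 with D
  rw [e]; rfl

end ListFunctions


/-! # Trees and the multigraphs composed of them -/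

section Trees

variable {V : Type*}

/-- Being a tree is a property of `T.coe`, while backbones are defined by walks in `T.spanningCoe`.
A walk that starts in `T` never leaves it, which carries acyclicity from one graph to the other. -/
theorem exists_walk_coe {T : CompleteSub V} {u v : V} (p : T.spanningCoe.Walk u v)
    (hu : u ∈ T.verts) : ∃ (hv : v ∈ T.verts) (q : T.coe.Walk ⟨u, hu⟩ ⟨v, hv⟩),
      q.map T.coeEmbeddingSpanningCoe.toHom = p := by
  induction p with
  | nil => exact ⟨hu, .nil, rfl⟩
  | cons h p ih =>
    have hw := T.edge_vert (SimpleGraph.Subgraph.Adj.symm h)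
    obtain ⟨hv, q, rfl⟩ := ih hw
    have hadj : T.coe.Adj ⟨_, hu⟩ ⟨_, hw⟩ := h
    exact ⟨hv, .cons hadj q, rfl⟩

theorem isAcyclic_spanningCoe {T : CompleteSub V} (hT : T.coe.IsAcyclic) :
    T.spanningCoe.IsAcyclic := by
  intro v p hp
  have hv : v ∈ T.verts := by
    cases p with
    | nil => exact absurd rfl hp.ne_nil
    | cons h p => exact T.edge_vert h
  obtain ⟨_, q, rfl⟩ := exists_walk_coe p hv
  exact hT q hp.of_map

theorem reachable_spanningCoe {T : CompleteSub V} (hT : T.coe.IsTree) {u v : V}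
    (hu : u ∈ T.verts) (hv : v ∈ T.verts) : T.spanningCoe.Reachable u v :=
  (hT.connected.preconnected ⟨u, hu⟩ ⟨v, hv⟩).map T.coeEmbeddingSpanningCoe.toHom

theorem path_unique_of_isTree {T : CompleteSub V} (hT : T.coe.IsTree) {u v : V}
    {p q : T.spanningCoe.Walk u v} (hp : p.IsPath) (hq : q.IsPath) : p = q :=
  congrArg Subtype.val
    (((isAcyclic_spanningCoe hT.isAcyclic).subsingleton_path u v).elim ⟨p, hp⟩ ⟨q, hq⟩)

variable {U : Finset V} {T : CompleteSub V}

theorem mem_anchors {v : V} : v ∈ anchors U T ↔ v ∈ U ∧ v ∈ T.verts := by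
  simp [anchors]

theorem backbone_eq_edges (hT : T.coe.IsTree) {a b : V} (hab : a ≠ b)
    (h : ∀ v, v ∈ anchors U T ↔ v = a ∨ v = b) {p : T.spanningCoe.Walk a b} (hp : p.IsPath) :
    backbone U T = {e | e ∈ p.edges} := by
  ext e
  constructor
  · rintro ⟨a', ha', b', hb', hab', q, hq, he⟩
    rcases (h a').1 ha' with rfl | rfl <;> rcases (h b').1 hb' with rfl | rfl
    · exact absurd rfl hab'
    · rwa [path_unique_of_isTree hT hq hp] at he
    · rw [← path_unique_of_isTree hT hq.reverse hp]
      simpa using he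
    · exact absurd rfl hab'
  · exact fun he => ⟨a, (h a).2 (.inl rfl), b, (h b).2 (.inr rfl), hab, p, hp, he⟩

theorem exists_anchors (h2 : (anchors U T).card = 2) :
    ∃ a b, a ≠ b ∧ ∀ v, v ∈ anchors U T ↔ v = a ∨ v = b := by
  classical
  obtain ⟨a, b, hab, h⟩ := Finset.card_eq_two.1 h2
  exact ⟨a, b, hab, fun v => by rw [h]; simp⟩

theorem exists_backbone_path (hT : T.coe.IsTree) {a b : V} (hab : a ≠ b)
    (h : ∀ v, v ∈ anchors U T ↔ v = a ∨ v = b) :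
    ∃ p : T.spanningCoe.Walk a b, p.IsPath ∧ backbone U T = {e | e ∈ p.edges} := by
  classical
  obtain ⟨p⟩ := reachable_spanningCoe hT (mem_anchors.1 ((h a).2 (.inl rfl))).2
    (mem_anchors.1 ((h b).2 (.inr rfl))).2
  exact ⟨p.bypass, p.bypass_isPath, backbone_eq_edges hT hab h p.bypass_isPath⟩

theorem backbone_subset : backbone U T ⊆ T.edgeSet := by
  rintro e ⟨a, -, b, -, -, p, -, he⟩
  rw [← SimpleGraph.Subgraph.edgeSet_spanningCoe]
  exact p.edges_subset_edgeSet he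

/-- An edge of the tree is in the backbone if and only if its removal separates the anchors. -/
theorem mem_backbone_iff (hT : T.coe.IsTree) {a b : V} (hab : a ≠ b)
    (h : ∀ v, v ∈ anchors U T ↔ v = a ∨ v = b) (e : Sym2 V) :
    e ∈ backbone U T ↔ ¬ (T.spanningCoe.deleteEdges {e}).Reachable a b := by
  classical
  obtain ⟨p, hp, hB⟩ := exists_backbone_path hT hab h
  constructor
  · rintro he ⟨q⟩
    have hq : (q.bypass.mapLe (SimpleGraph.deleteEdges_le {e})).IsPath :=
      q.bypass_isPath.mapLe _
    rw [backbone_eq_edges hT hab h hq] at he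
    have he' : e ∈ q.bypass.edges := by simpa using he
    have := q.bypass.edges_subset_edgeSet he'
    rw [SimpleGraph.edgeSet_deleteEdges] at this
    exact this.2 rfl
  · intro hr
    by_contra he
    rw [hB] at he
    exact hr ⟨p.toDeleteEdge e he⟩

open Classical in
/-- The multiplicities of the edges of a tree whose limbs are doubled if `b` is true, and omitted
otherwise. -/
noncomputable def tourMult (U : Finset V) (T : CompleteSub V) (b : Bool) (e : Sym2 V) : ℕ :=
  (if e ∈ backbone U T then 1 else 0) + 2 * (if b = true ∧ e ∈ limbs U T then 1 else 0)

theorem tourMult_ne_zero {b : Bool} {e : Sym2 V} :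
    tourMult U T b e ≠ 0 ↔ e ∈ backbone U T ∨ b = true ∧ e ∈ limbs U T := by
  unfold tourMult
  split_ifs <;> simp [*]

theorem mem_edgeSet_of_tourMult {b : Bool} {e : Sym2 V} (h : tourMult U T b e ≠ 0) :
    e ∈ T.edgeSet := by
  rcases tourMult_ne_zero.1 h with h | ⟨-, h⟩
  · exact backbone_subset h
  · exact h.1

theorem tourMult_true_ne_zero {e : Sym2 V} (h : e ∈ T.edgeSet) : tourMult U T true e ≠ 0 := by
  rw [tourMult_ne_zero]
  by_cases he : e ∈ backbone U T
  · exact .inl he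
  · exact .inr ⟨rfl, h, he⟩

theorem sum_tourMult_mul [Fintype V] (c : Sym2 V → ℝ) (b : Bool) :
    ∑ e, (tourMult U T b e : ℝ) * c e =
      setCost c (backbone U T) + if b = true then 2 * setCost c (limbs U T) else 0 := by
  classical
  have : ∀ e, (tourMult U T b e : ℝ) * c e = (if e ∈ backbone U T then c e else 0) +
      if b = true then 2 * (if e ∈ limbs U T then c e else 0) else 0 := by
    intro e
    unfold tourMult
    cases b <;> push_cast <;> simp; split_ifs <;> ring
  simp only [this, Finset.sum_add_distrib, setCost, Finset.sum_filter]
  congr 1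
  cases b
  · simp
  · simp [Finset.mul_sum]

-- A path has even degree at every vertex other than its ends, which are anchors and hence in `U`;
-- doubled limbs contribute even degrees everywhere.
open Classical in
theorem even_degree_tourMult [Fintype V] (hT : T.coe.IsTree) (h2 : (anchors U T).card = 2)
    (b : Bool) {v : V} (hv : v ∉ U) :
    Even (∑ e with v ∈ e, tourMult U T b e) := by
  obtain ⟨x, y, hxy, h⟩ := exists_anchors h2
  obtain ⟨p, hp, hB⟩ := exists_backbone_path hT hxy h
  simp only [tourMult, Finset.sum_add_distrib, ← Finset.mul_sum]
  refine Even.add ?_ (even_two_mul _)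
  -- A path repeats no edge, so the backbone degree of `v` counts the entries of `p.edges` that
  -- contain `v`, and parity results on trails apply.
  have hc : (∑ e with v ∈ e, if e ∈ backbone U T then 1 else 0) =
      p.edges.countP fun e => v ∈ e := by
    rw [List.countP_eq_length_filter,
      ← List.toFinset_card_of_nodup (hp.isTrail.edges_nodup.filter _), Finset.card_eq_sum_ones,
      ← Finset.sum_filter, hB]
    refine Finset.sum_congr ?_ fun _ _ => rfl
    ext e
    simp [and_comm]
  rw [hc, hp.isTrail.even_countP_edges_iff]
  intro _
  constructor <;> rintro rfl
  · exact hv (mem_anchors.1 ((h v).2 (.inl rfl))).1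
  · exact hv (mem_anchors.1 ((h v).2 (.inr rfl))).1

/-- Every vertex of the tour of a tree is connected to the anchors by the tour. -/
theorem reachable_of_tourMult (hT : T.coe.IsTree) (h2 : (anchors U T).card = 2) {b : Bool}
    {G : SimpleGraph V} (hG : ∀ u v, tourMult U T b s(u, v) ≠ 0 → G.Adj u v) {a v : V}
    (ha : a ∈ anchors U T) (hv : v ∈ anchors U T ∨ ∃ e, v ∈ e ∧ tourMult U T b e ≠ 0) :
    G.Reachable a v := by
  classical
  obtain ⟨x, y, hxy, h⟩ := exists_anchors h2
  obtain ⟨p, hp, hB⟩ := exists_backbone_path hT hxy h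
  have key : G.Reachable x v ∧ G.Reachable x y := by
    have hpG : ∀ e ∈ p.edges, e ∈ G.edgeSet := by
      intro e he
      induction e with
      | h u w =>
        exact hG u w (tourMult_ne_zero.2 (.inl (by rw [hB]; exact he)))
    have hp' : ∀ w ∈ p.support, G.Reachable x w := fun w hw =>
      ⟨(p.takeUntil w hw).transfer G fun e he => hpG e (p.edges_takeUntil_subset_edges hw he)⟩
    refine ⟨?_, hp' y p.end_mem_support⟩
    rcases hv with hv | ⟨e, hve, he⟩
    · rcases (h v).1 hv with rfl | rfl
      · rfl
      · exact hp' _ p.end_mem_support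
    rcases tourMult_ne_zero.1 he with he' | ⟨rfl, -⟩
    · rw [hB] at he'
      obtain ⟨w, rfl⟩ := Sym2.mem_iff_exists.1 hve
      exact hp' v (p.fst_mem_support_of_mem_edges he')
    · have hvT : v ∈ T.verts := by
        obtain ⟨w, rfl⟩ := Sym2.mem_iff_exists.1 hve
        exact T.edge_vert (mem_edgeSet_of_tourMult he)
      refine (reachable_spanningCoe hT (mem_anchors.1 ((h x).2 (.inl rfl))).2 hvT).mono ?_
      exact fun u w huw => hG u w (tourMult_true_ne_zero huw)
  rcases (h a).1 ha with rfl | rfl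
  · exact key.1
  · exact key.2.symm.trans key.1

/-- A tree with two anchors has a second vertex, so `v` is incident to some edge of `T`. Thus a tour
with kept limbs visits all vertices of its tree. -/
theorem exists_tourMult_true (hT : T.coe.IsTree) (h2 : (anchors U T).card = 2) {v : V}
    (hv : v ∈ T.verts) : ∃ e, v ∈ e ∧ tourMult U T true e ≠ 0 := by
  obtain ⟨x, y, hxy, h⟩ := exists_anchors h2
  obtain ⟨a, ha, hva⟩ : ∃ a ∈ T.verts, v ≠ a := by
    by_cases hvx : v = x
    · exact ⟨y, (mem_anchors.1 ((h y).2 (.inr rfl))).2, hvx ▸ hxy⟩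
    · exact ⟨x, (mem_anchors.1 ((h x).2 (.inl rfl))).2, hvx⟩
  obtain ⟨p⟩ := reachable_spanningCoe hT hv ha
  cases p with
  | nil => exact absurd rfl hva
  | cons h p => exact ⟨s(v, _), Sym2.mem_mk_left _ _, tourMult_true_ne_zero h⟩

end Trees

/-! ### Unions of tours: degrees, connectedness and penalties -/

section Merge

variable {V κ : Type*} [Fintype V] [DecidableEq V]

open Classical in
/-- The union of tours of trees, on the vertices of `U` and all vertices on the tours. -/
noncomputable def mergeTours (U : Finset V) (T : κ → CompleteSub V) (keep : κ → Bool)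
    (S : Finset κ) : Multigraph V where
  verts := U ∪ Finset.univ.filter fun v =>
    ∃ e, v ∈ e ∧ ∑ k ∈ S, tourMult U (T k) (keep k) e ≠ 0
  mult e := ∑ k ∈ S, tourMult U (T k) (keep k) e
  loopless e he := by
    refine Finset.sum_eq_zero fun k _ => ?_
    by_contra h
    have := mem_edgeSet_of_tourMult h
    exact (SimpleGraph.not_isDiag_of_mem_edgeSet _ ((T k).edgeSet_subset this)) he
  incident e he v hv := by
    simpa using Or.inr ⟨e, hv, by simpa using he⟩

variable {U : Finset V} {T : κ → CompleteSub V} {keep : κ → Bool} {S : Finset κ}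

theorem mem_verts_mergeTours {v : V} : v ∈ (mergeTours U T keep S).verts ↔
    v ∈ U ∨ ∃ k ∈ S, ∃ e, v ∈ e ∧ tourMult U (T k) (keep k) e ≠ 0 := by
  simp only [mergeTours, Finset.mem_union, Finset.mem_filter, Finset.mem_univ, true_and, ne_eq,
    Finset.sum_eq_zero_iff, not_forall]
  refine or_congr_right ?_
  constructor
  · rintro ⟨e, hv, k, hk, h⟩; exact ⟨k, hk, e, hv, h⟩
  · rintro ⟨k, hk, e, hv, h⟩; exact ⟨e, hv, k, hk, h⟩

theorem cost_mergeTours (c : Sym2 V → ℝ) : (mergeTours U T keep S).cost c =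
    ∑ k ∈ S, (setCost c (backbone U (T k)) +
      if keep k = true then 2 * setCost c (limbs U (T k)) else 0) := by
  simp only [Multigraph.cost, mergeTours, Nat.cast_sum, Finset.sum_mul]
  rw [Finset.sum_comm]
  exact Finset.sum_congr rfl fun k _ => sum_tourMult_mul c (keep k)

theorem even_degree_mergeTours (hT : ∀ k, (T k).coe.IsTree)
    (h2 : ∀ k, (anchors U (T k)).card = 2) {v : V} (hv : v ∉ U) :
    Even ((mergeTours U T keep S).degree v) := by
  simp only [Multigraph.degree, mergeTours]
  rw [Finset.sum_comm]
  exact Finset.even_sum _ fun k _ => even_degree_tourMult (hT k) (h2 k) (keep k) hv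

/-- If some vertex of `U` were unreachable from `r`, the reachable part of `U` would be a proper
nonempty subset and some chosen tree would have exactly one anchor in it. But its backbone joins
both anchors. -/
theorem connected_mergeTours (hT : ∀ k, (T k).coe.IsTree)
    (h2 : ∀ k, (anchors U (T k)).card = 2) (hU : U.Nonempty)
    (hS : ∀ A ⊂ U, A.Nonempty → ∃ k ∈ S, Crosses (anchors U (T k)) A) :
    (mergeTours U T keep S).graph.Connected := by
  classical
  set H := mergeTours U T keep S with hH
  -- This is the same adjacency on all of `V`, where the walks of the individual trees live; `hlift`
  -- brings reachability back to the vertex set of `H`.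
  let G : SimpleGraph V :=
    { Adj := fun u v => u ≠ v ∧ H.mult s(u, v) ≠ 0
      symm := ⟨fun u v h => ⟨h.1.symm, by rw [Sym2.eq_swap]; exact h.2⟩⟩
      loopless := ⟨fun _ h => h.1 rfl⟩ }
  have hG : ∀ k ∈ S, ∀ u v, tourMult U (T k) (keep k) s(u, v) ≠ 0 → G.Adj u v := by
    intro k hk u v h
    refine ⟨(T k).adj_sub (mem_edgeSet_of_tourMult h), fun h0 => h ?_⟩
    exact Finset.sum_eq_zero_iff.1 h0 k hk
  have hlift : ∀ u v (p : G.Walk u v) (hu : u ∈ H.verts), ∃ hv : v ∈ H.verts,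
      H.graph.Reachable ⟨u, hu⟩ ⟨v, hv⟩ := by
    intro u v p
    induction p with
    | nil => exact fun hu => ⟨hu, .refl _⟩
    | @cons u w v h p ih =>
      intro hu
      obtain ⟨hv, hr⟩ := ih (H.incident _ h.2 w (Sym2.mem_mk_right _ _))
      exact ⟨hv, (SimpleGraph.Adj.reachable (G := H.graph) (u := ⟨u, hu⟩)
        (v := ⟨w, H.incident _ h.2 w (Sym2.mem_mk_right _ _)⟩) ⟨fun e => h.1 (congrArg Subtype.val e), h.2⟩).trans hr⟩
  obtain ⟨r, hr⟩ := hU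
  have hreachU : ∀ v ∈ U, G.Reachable r v := by
    by_contra! hcon
    obtain ⟨v, hv, hrv⟩ := hcon
    obtain ⟨k, hk, hc⟩ := hS (U.filter fun v => G.Reachable r v)
      ⟨Finset.filter_subset _ _, fun h => hrv (Finset.mem_filter.1 (h hv)).2⟩
      ⟨r, by simp [hr]⟩
    obtain ⟨a, ha⟩ := Finset.card_pos.1 (hc.1.symm ▸ Nat.one_pos)
    obtain ⟨b, hb⟩ := Finset.card_pos.1 (hc.2.symm ▸ Nat.one_pos)
    rw [Finset.mem_inter, Finset.mem_filter] at ha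
    rw [Finset.mem_sdiff, Finset.mem_filter] at hb
    exact hb.2 ⟨(mem_anchors.1 hb.1).1, ha.2.2.trans
      (reachable_of_tourMult (hT k) (h2 k) (hG k hk) ha.1 (.inl hb.1))⟩
  have hreach : ∀ v ∈ H.verts, G.Reachable r v := by
    intro v hv
    rcases mem_verts_mergeTours.1 hv with hv | ⟨k, hk, e, hve, he⟩
    · exact hreachU v hv
    · obtain ⟨a, ha⟩ := Finset.card_pos.1 ((h2 k).symm ▸ Nat.two_pos)
      exact (hreachU a (mem_anchors.1 ha).1).trans
        (reachable_of_tourMult (hT k) (h2 k) (hG k hk) ha (.inr ⟨e, hve, he⟩))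
  have hrH : r ∈ H.verts := mem_verts_mergeTours.2 (.inl hr)
  have hroot : ∀ v : H.verts, H.graph.Reachable ⟨r, hrH⟩ v := by
    intro v
    obtain ⟨p⟩ := hreach v.1 v.2
    exact (hlift _ _ p hrH).2
  have : Nonempty H.verts := ⟨⟨r, hrH⟩⟩
  exact ⟨fun u v => (hroot u).symm.trans (hroot v)⟩

/-- The penalty is at most the penalty of the vertices outside `U` that are not in a kept tree. -/
theorem penalty_mergeTours_le (hT : ∀ k, (T k).coe.IsTree)
    (h2 : ∀ k, (anchors U (T k)).card = 2) {pen : V → ℝ} (hpen : ∀ v, 0 ≤ pen v)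
    {q : V → ℝ} (hq : ∀ v, 0 ≤ q v)
    (hq1 : ∀ v, (∀ k ∈ S, keep k = true → v ∉ (T k).verts) → q v = 1) :
    (mergeTours U T keep S).penalty pen ≤ ∑ v ∈ Uᶜ, pen v * q v := by
  classical
  unfold Multigraph.penalty
  refine (Finset.sum_le_sum (g := fun v => pen v * q v) fun v hv => ?_).trans
    (Finset.sum_le_sum_of_subset_of_nonneg ?_ fun v _ _ => mul_nonneg (hpen v) (hq v))
  · simp only [Finset.mem_filter, mem_verts_mergeTours] at hv
    push Not at hv
    rw [hq1 v, mul_one]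
    intro k hk hkeep hvT
    obtain ⟨e, hve, he⟩ := exists_tourMult_true (hT k) (h2 k) hvT
    exact he (hkeep ▸ hv.2.2 k hk e hve)
  · intro v hv
    simp only [Finset.mem_filter, mem_verts_mergeTours] at hv
    push Not at hv
    simpa using hv.2.1

end Merge


/-! # The spanning tree polytope and pipage rounding -/

section Polytope

set_option linter.unusedSectionVars false

variable {V κ : Type*} [DecidableEq V] [Fintype κ] [DecidableEq κ]

/-- The total value of the edges inside `S`. -/
def inside (ends : κ → Finset V) (x : κ → ℝ) (S : Finset V) : ℝ :=
  ∑ k with ends k ⊆ S, x k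

/-- The spanning tree polytope of a multigraph with vertex set `U`. -/
structure TreePolytope (U : Finset V) (ends : κ → Finset V) (x : κ → ℝ) : Prop where
  nonneg : ∀ k, 0 ≤ x k
  le : ∀ S : Finset V, S.Nonempty → inside ends x S ≤ S.card - 1
  total : ∑ k, x k = U.card - 1

/-- Move the value `t` from `f` to `e`. -/
def shift (x : κ → ℝ) (e f : κ) (t : ℝ) : κ → ℝ :=
  fun k => x k + (if k = e then t else 0) - (if k = f then t else 0)

/-- Both directions of moving value between `e` and `f` are feasible. -/
def Movable (U : Finset V) (ends : κ → Finset V) (x : κ → ℝ) (e f : κ) : Prop :=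
  ∃ t > 0, TreePolytope U ends (shift x e f t) ∧ TreePolytope U ends (shift x e f (-t))

theorem shift_swap (x : κ → ℝ) (e f : κ) (t : ℝ) : shift x f e t = shift x e f (-t) := by
  funext k; unfold shift; split_ifs <;> ring

theorem shift_zero (x : κ → ℝ) (e f : κ) : shift x e f 0 = x := by
  funext k; simp [shift]

theorem shift_shift (x : κ → ℝ) (e f : κ) (s t : ℝ) :
    shift (shift x e f s) e f t = shift x e f (s + t) := by
  funext k; unfold shift; split_ifs <;> ring

theorem inside_shift (ends : κ → Finset V) (x : κ → ℝ) (e f : κ) (t : ℝ) (S : Finset V) :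
    inside ends (shift x e f t) S =
      inside ends x S + (if ends e ⊆ S then t else 0) - (if ends f ⊆ S then t else 0) := by
  simp [inside, shift, Finset.sum_add_distrib, Finset.sum_sub_distrib, Finset.sum_filter,
    Finset.sum_ite_eq']

theorem sum_shift (x : κ → ℝ) (e f : κ) (t : ℝ) : ∑ k, shift x e f t k = ∑ k, x k := by
  simp [shift, Finset.sum_add_distrib, Finset.sum_sub_distrib]

variable {U : Finset V} {ends : κ → Finset V}

theorem TreePolytope.combine {x y : κ → ℝ} (hx : TreePolytope U ends x)
    (hy : TreePolytope U ends y) {a b : ℝ} (ha : 0 ≤ a) (hb : 0 ≤ b) (hab : a + b = 1) :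
    TreePolytope U ends fun k => a * x k + b * y k where
  nonneg k := add_nonneg (mul_nonneg ha (hx.nonneg k)) (mul_nonneg hb (hy.nonneg k))
  le S hS := by
    have h : inside ends (fun k => a * x k + b * y k) S =
        a * inside ends x S + b * inside ends y S := by
      simp [inside, Finset.sum_add_distrib, Finset.mul_sum]
    have h1 := mul_le_mul_of_nonneg_left (hx.le S hS) ha
    have h2 := mul_le_mul_of_nonneg_left (hy.le S hS) hb
    rw [h]
    obtain rfl : b = 1 - a := by linarith
    linarith
  total := by
    rw [Finset.sum_add_distrib, ← Finset.mul_sum, ← Finset.mul_sum, hx.total, hy.total,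
      ← add_mul, hab, one_mul]

theorem Movable.symm {x : κ → ℝ} {e f : κ} (h : Movable U ends x e f) : Movable U ends x f e := by
  obtain ⟨t, ht, h1, h2⟩ := h
  exact ⟨t, ht, by rwa [shift_swap], by rwa [shift_swap, neg_neg]⟩

/-- Moving along a direction creates no new movable pairs. -/
theorem Movable.of_shift {x : κ → ℝ} {e f g h : κ} {s t : ℝ} (hs : 0 < s) (ht : 0 ≤ t)
    (hx : TreePolytope U ends (shift x e f (-s)))
    (hm : Movable U ends (shift x e f t) g h) : Movable U ends x g h := by
  obtain ⟨r, hr, h1, h2⟩ := hm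
  have hst : 0 < s + t := by linarith
  have ha : 0 < s / (s + t) := by positivity
  -- The point `x` divides the segment between `shift x e f t` and `shift x e f (-s)` with weights
  -- `s / (s + t)` and `t / (s + t)`. Mixing a perturbation at the first end with the second end
  -- yields the same perturbation at `x`, scaled by `s / (s + t)`.
  have key : ∀ r, shift x g h (s / (s + t) * r) = fun k =>
      s / (s + t) * shift (shift x e f t) g h r k + t / (s + t) * shift x e f (-s) k := by
    intro r
    funext k
    unfold shift
    split_ifs <;> field_simp <;> ring
  have hab : s / (s + t) + t / (s + t) = 1 := by field_simp
  refine ⟨s / (s + t) * r, by positivity, ?_, ?_⟩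
  · rw [key]
    exact h1.combine hx ha.le (by positivity) hab
  · rw [← mul_neg, key]
    exact h2.combine hx ha.le (by positivity) hab

theorem TreePolytope.le_one (hE : ∀ k, (ends k).card = 2) {x : κ → ℝ}
    (hx : TreePolytope U ends x) (k : κ) : x k ≤ 1 := by
  have h := hx.le (ends k) (Finset.card_pos.1 (by rw [hE]; norm_num))
  have h1 : x k ≤ inside ends x (ends k) :=
    Finset.single_le_sum (f := x) (fun i _ => hx.nonneg i) (by simp)
  rw [hE] at h
  push_cast at h
  linarith

/-- This is supermodularity: edges within both sets lie within the intersection, and edges between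
`A \ B` and `B \ A` count only on the right. -/
theorem inside_add_le {x : κ → ℝ} (hx : ∀ k, 0 ≤ x k) (A B : Finset V) :
    inside ends x A + inside ends x B ≤ inside ends x (A ∩ B) + inside ends x (A ∪ B) := by
  simp only [inside, Finset.sum_filter, ← Finset.sum_add_distrib]
  refine Finset.sum_le_sum fun k _ => ?_
  have h1 : ends k ⊆ A → ends k ⊆ A ∪ B := fun h => h.trans Finset.subset_union_left
  have h2 : ends k ⊆ B → ends k ⊆ A ∪ B := fun h => h.trans Finset.subset_union_right
  have := hx k
  simp only [Finset.subset_inter_iff]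
  by_cases hA : ends k ⊆ A <;> by_cases hB : ends k ⊆ B
  · simp [hA, hB, h1 hA]
  · simp [hA, hB, h1 hA]
  · simp [hA, hB, h2 hB]
  · simp only [hA, hB, if_false, and_self, zero_add]; split_ifs <;> simp [this]

/-- If every tight set contained both edges or neither, tight constraints would not notice a shift,
and the finitely many others leave room for a small shift in both directions. -/
theorem exists_tight_of_not_movable [Finite V] (hx : TreePolytope U ends x) {e f : κ}
    (he : 0 < x e) (hf : 0 < x f) (h : ¬ Movable U ends x e f) :
    ∃ S : Finset V, S.Nonempty ∧ inside ends x S = S.card - 1 ∧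
      ((ends e ⊆ S ∧ ¬ ends f ⊆ S) ∨ (ends f ⊆ S ∧ ¬ ends e ⊆ S)) := by
  by_contra! hcon
  refine h ?_
  -- All small positive `t` respect the positive slacks; together with `t ≤ x e` and `t ≤ x f`, one
  -- such `t` serves both signs.
  have hev : ∀ᶠ t in nhdsWithin (0 : ℝ) (Set.Ioi 0), ∀ S : Finset V, S.Nonempty →
      inside ends x S ≠ S.card - 1 → t ≤ S.card - 1 - inside ends x S := by
    refine Filter.eventually_all.2 fun S => ?_
    by_cases hS : S.Nonempty ∧ inside ends x S ≠ S.card - 1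
    · have hpos : 0 < S.card - 1 - inside ends x S :=
        sub_pos.2 (lt_of_le_of_ne (hx.le S hS.1) hS.2)
      filter_upwards [(eventually_le_nhds hpos).filter_mono nhdsWithin_le_nhds] with t ht _ _
      exact ht
    · filter_upwards with t h1 h2
      exact absurd ⟨h1, h2⟩ hS
  obtain ⟨t, ⟨⟨ht, hte⟩, htf⟩, ht0⟩ := (((hev.and
    ((eventually_le_nhds he).filter_mono nhdsWithin_le_nhds)).and
    ((eventually_le_nhds hf).filter_mono nhdsWithin_le_nhds)).and self_mem_nhdsWithin).exists
  have ht0 : 0 < t := ht0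
  have key : ∀ s, |s| ≤ t → TreePolytope U ends (shift x e f s) := by
    intro s hs
    have hs' := abs_le.1 hs
    refine ⟨fun k => ?_, fun S hS => ?_, by rw [sum_shift, hx.total]⟩
    · have := hx.nonneg k
      unfold shift
      split_ifs with h1 h2 h2
      · linarith
      · subst h1; linarith
      · subst h2; linarith
      · linarith
    · rw [inside_shift]
      have h1 := hx.le S hS
      have h2 := ht S hS
      have h3 := hcon S hS
      by_cases hT : inside ends x S = S.card - 1
      · obtain ⟨h4, h5⟩ := h3 hT
        by_cases h6 : ends e ⊆ S
        · simp [h6, h4 h6, hT]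
        · have h7 : ¬ ends f ⊆ S := fun h => h6 (h5 h)
          simp [h6, h7, hT]
      · have := h2 hT
        split_ifs <;> linarith
  exact ⟨t, ht0, key t (abs_of_pos ht0).le, key (-t) (by rw [abs_neg, abs_of_pos ht0])⟩

/-- A point of the spanning tree polytope without movable pairs is integral. -/
theorem TreePolytope.integral_of_not_movable [Fintype V] (hE : ∀ k, (ends k).card = 2)
    (hEU : ∀ k, ends k ⊆ U) {x : κ → ℝ} (hx : TreePolytope U ends x)
    (h : ∀ e f, e ≠ f → ¬ Movable U ends x e f) (k : κ) : x k = 0 ∨ x k = 1 := by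
  classical
  by_contra! hk
  -- These are the tight sets that contain a fractional edge. The set `U` is one of them, and `A`
  -- below is one of minimum cardinality.
  let 𝒯 : Finset (Finset V) := Finset.univ.filter fun S => S.Nonempty ∧
    inside ends x S = S.card - 1 ∧ ∃ k, ends k ⊆ S ∧ x k ≠ 0 ∧ x k ≠ 1
  have hU : U ∈ 𝒯 := by
    simp only [𝒯, Finset.mem_filter, Finset.mem_univ, true_and]
    refine ⟨(Finset.card_pos.1 (by rw [hE k]; norm_num)).mono (hEU k), ?_, k, hEU k, hk⟩
    rw [← hx.total, inside, Finset.filter_true_of_mem fun k _ => hEU k]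
  obtain ⟨A, hA, hmin⟩ := Finset.exists_min_image 𝒯 Finset.card ⟨U, hU⟩
  simp only [𝒯, Finset.mem_filter, Finset.mem_univ, true_and] at hA hmin
  obtain ⟨hAne, hAt, e, heA, he0, he1⟩ := hA
  have hfrac : ∀ k, x k ≠ 0 → x k ≠ 1 → 0 < x k ∧ x k < 1 := fun k h0 h1 =>
    ⟨lt_of_le_of_ne (hx.nonneg k) h0.symm, lt_of_le_of_ne (hx.le_one hE k) h1⟩
  -- The total value inside the tight set `A` is an integer, so a single fractional edge in `A` is
  -- impossible.
  obtain ⟨f, hef, hfA, hf0, hf1⟩ : ∃ f, e ≠ f ∧ ends f ⊆ A ∧ x f ≠ 0 ∧ x f ≠ 1 := by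
    by_contra! hcon
    have hsum : inside ends x A = x e + ∑ k ∈ (Finset.univ.filter fun k => ends k ⊆ A).erase e,
        x k := by
      rw [inside, Finset.add_sum_erase _ _ (by simp [heA])]
    have hint : ∃ n : ℤ, ∑ k ∈ (Finset.univ.filter fun k => ends k ⊆ A).erase e, x k = n := by
      refine ⟨∑ k ∈ (Finset.univ.filter fun k => ends k ⊆ A).erase e, if x k = 0 then 0 else 1, ?_⟩
      push_cast
      refine Finset.sum_congr rfl fun k hk => ?_
      rw [Finset.mem_erase, Finset.mem_filter] at hk
      by_cases h0 : x k = 0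
      · simp [h0]
      · simp [hcon k hk.1.symm hk.2.2 h0]
    obtain ⟨n, hn⟩ := hint
    obtain ⟨h0, h1⟩ := hfrac e he0 he1
    have hxe : x e = ((A.card - 1 - n : ℤ) : ℝ) := by push_cast; linarith
    rw [hxe] at h0 h1
    have h0 : 0 < (A.card - 1 - n : ℤ) := by exact_mod_cast h0
    have h1 : (A.card - 1 - n : ℤ) < 1 := by exact_mod_cast h1
    omega
  obtain ⟨B, hB, hBt, hsep⟩ := exists_tight_of_not_movable hx (hfrac e he0 he1).1
    (hfrac f hf0 hf1).1 (h e f hef)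
  -- Uncrossing: `A ∩ B` contains the edge `g`, so supermodularity makes it tight. By minimality it
  -- equals `A`, which puts `h` inside `B` as well.
  have hcap : ∀ g h : κ, ends g ⊆ A → ends h ⊆ A → x g ≠ 0 → x g ≠ 1 → ends g ⊆ B →
      ¬ ends h ⊆ B → False := by
    intro g h hgA hhA hg0 hg1 hgB hhB
    have hgAB := Finset.subset_inter hgA hgB
    have hne : (A ∩ B).Nonempty := (Finset.card_pos.1 (by rw [hE g]; norm_num)).mono hgAB
    have h1 := inside_add_le (ends := ends) hx.nonneg A B
    have h2 := hx.le _ hne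
    have h3 := hx.le (A ∪ B) (hAne.mono Finset.subset_union_left)
    have h4 : ((A ∪ B).card : ℝ) + (A ∩ B).card = A.card + B.card := by
      exact_mod_cast Finset.card_union_add_card_inter A B
    have h5 := hmin (A ∩ B) ⟨hne, by linarith, g, hgAB, hg0, hg1⟩
    have h6 := Finset.eq_of_subset_of_card_le Finset.inter_subset_left h5
    exact hhB (hhA.trans (by rw [← h6]; exact Finset.inter_subset_right))
  rcases hsep with ⟨h1, h2⟩ | ⟨h1, h2⟩
  · exact hcap e f heA hfA he0 he1 h1 h2
  · exact hcap f e hfA heA hf0 hf1 h1 h2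

theorem isClosed_setOf_treePolytope (x : κ → ℝ) (e f : κ) :
    IsClosed {t | TreePolytope U ends (shift x e f t)} := by
  have h : {t | TreePolytope U ends (shift x e f t)} =
      {t | ∀ k, 0 ≤ shift x e f t k} ∩ ({t | ∀ S : Finset V, S.Nonempty →
        inside ends (shift x e f t) S ≤ S.card - 1} ∩
        {t | ∑ k, shift x e f t k = U.card - 1}) := by
    ext t; exact ⟨fun h => ⟨h.1, h.2, h.3⟩, fun h => ⟨h.1, h.2.1, h.2.2⟩⟩
  have hc : ∀ k, Continuous fun t => shift x e f t k := by
    intro k; unfold shift; split_ifs <;> fun_prop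
  rw [h]
  simp only [Set.ofPred_forall]
  refine (isClosed_iInter fun k => isClosed_le continuous_const (hc k)).inter
    ((isClosed_iInter fun S => isClosed_iInter fun _ => isClosed_le ?_ continuous_const).inter
      (isClosed_eq ?_ continuous_const))
  · unfold inside; fun_prop
  · fun_prop

/-- Moving as far as possible makes a movable pair immovable. -/
theorem Movable.exists_max {x : κ → ℝ} {e f : κ} (hef : e ≠ f) (h : Movable U ends x e f) :
    ∃ t > 0, TreePolytope U ends (shift x e f t) ∧ ¬ Movable U ends (shift x e f t) e f := by
  obtain ⟨r, hr, h1, -⟩ := h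
  have hcpt : IsCompact ({t | TreePolytope U ends (shift x e f t)} ∩ Set.Icc r (x f)) :=
    isCompact_Icc.inter_left (isClosed_setOf_treePolytope x e f)
  have hle : ∀ t, TreePolytope U ends (shift x e f t) → t ≤ x f := by
    intro t ht
    have := ht.nonneg f
    simp only [shift, hef.symm, if_false, if_true] at this
    linarith
  obtain ⟨t, ⟨ht, htr⟩, hmax⟩ := hcpt.exists_isGreatest ⟨r, h1, le_rfl, hle r h1⟩
  refine ⟨t, by linarith [htr.1], ht, ?_⟩
  rintro ⟨s, hs, h2, -⟩
  rw [shift_shift] at h2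
  have := hmax ⟨h2, by linarith [htr.1], hle _ h2⟩
  linarith

/-- Functions that are concave quadratic along all directions that move value between two edges. -/
def PairConcave (U : Finset V) (ends : κ → Finset V) (F : (κ → ℝ) → ℝ) : Prop :=
  ∀ x, TreePolytope U ends x → ∀ e f, e ≠ f →
    ∃ b c : ℝ, c ≤ 0 ∧ ∀ t, F (shift x e f t) = F x + b * t + c * t ^ 2

/-- The sign of the linear coefficient selects the direction, and the concave term can only decrease
the value. -/
theorem PairConcave.le_or_le {F : (κ → ℝ) → ℝ} (hF : PairConcave U ends F) {x : κ → ℝ}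
    (hx : TreePolytope U ends x) {e f : κ} (hef : e ≠ f) {s t : ℝ} (hs : 0 ≤ s) (ht : 0 ≤ t) :
    F (shift x e f t) ≤ F x ∨ F (shift x e f (-s)) ≤ F x := by
  obtain ⟨b, c, hc, h⟩ := hF x hx e f hef
  rw [h, h]
  rcases le_total b 0 with hb | hb
  · left; nlinarith [mul_nonneg (neg_nonneg.2 hb) ht, mul_nonneg (neg_nonneg.2 hc) (sq_nonneg t)]
  · right; nlinarith [mul_nonneg hb hs, mul_nonneg (neg_nonneg.2 hc) (sq_nonneg s)]

/-- Pipage rounding. -/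
theorem TreePolytope.exists_integral [Fintype V] (hE : ∀ k, (ends k).card = 2)
    (hEU : ∀ k, ends k ⊆ U) {F : (κ → ℝ) → ℝ} (hF : PairConcave U ends F) {x : κ → ℝ}
    (hx : TreePolytope U ends x) :
    ∃ z, TreePolytope U ends z ∧ (∀ k, z k = 0 ∨ z k = 1) ∧ F z ≤ F x := by
  classical
  -- The number of movable pairs decreases: a maximal move makes its own pair immovable, and no
  -- other pair becomes movable.
  induction hn : (Finset.univ.filter fun p : κ × κ =>
      p.1 ≠ p.2 ∧ Movable U ends x p.1 p.2).card using Nat.strong_induction_on generalizing x with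
  | _ n ih =>
    by_cases hm : ∀ e f, e ≠ f → ¬ Movable U ends x e f
    · exact ⟨x, hx, hx.integral_of_not_movable hE hEU hm, le_rfl⟩
    push Not at hm
    obtain ⟨e, f, hef, hm⟩ := hm
    have step : ∀ e f : κ, e ≠ f → Movable U ends x e f → ∀ t > 0,
        TreePolytope U ends (shift x e f t) → ¬ Movable U ends (shift x e f t) e f →
        F (shift x e f t) ≤ F x →
        ∃ z, TreePolytope U ends z ∧ (∀ k, z k = 0 ∨ z k = 1) ∧ F z ≤ F x := by
      intro e f hef hm t ht hxt hnm hFt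
      have hlt : (Finset.univ.filter fun p : κ × κ =>
          p.1 ≠ p.2 ∧ Movable U ends (shift x e f t) p.1 p.2).card < n := by
        rw [← hn]
        refine Finset.card_lt_card ⟨fun p hp => ?_, fun hsub => ?_⟩
        · obtain ⟨s, hs, -, h2⟩ := hm
          rw [Finset.mem_filter] at hp ⊢
          exact ⟨hp.1, hp.2.1, hp.2.2.of_shift hs ht.le h2⟩
        · have : (e, f) ∈ _ := hsub (Finset.mem_filter.2 ⟨Finset.mem_univ (e, f), hef, hm⟩)
          rw [Finset.mem_filter] at this
          exact hnm this.2.2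
      obtain ⟨z, h1, h2, h3⟩ := ih _ hlt hxt rfl
      exact ⟨z, h1, h2, h3.trans hFt⟩
    obtain ⟨t, ht, h1, h2⟩ := hm.exists_max hef
    obtain ⟨s, hs, h3, h4⟩ := hm.symm.exists_max hef.symm
    rcases hF.le_or_le hx hef hs.le ht.le with h | h
    · exact step e f hef hm t ht h1 h2 h
    · rw [← shift_swap] at h
      exact step f e hef.symm hm.symm s hs h3 h4 h

/-- The integral points of the spanning tree polytope are connected. -/
theorem TreePolytope.exists_crosses (hE : ∀ k, (ends k).card = 2) (hEU : ∀ k, ends k ⊆ U)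
    {x : κ → ℝ} (hx : TreePolytope U ends x) {A : Finset V} (hA : A ⊂ U) (hne : A.Nonempty) :
    ∃ k, x k ≠ 0 ∧ Crosses (ends k) A := by
  by_contra! hcon
  have hcard : (U \ A).card + A.card = U.card := Finset.card_sdiff_add_card_eq_card hA.1
  have h1 := hx.le A hne
  have h2 := hx.le (U \ A) (Finset.sdiff_nonempty.2 hA.2)
  -- Without a crossing edge in the support, the total `U.card - 1` splits into the values inside
  -- `A` and inside `U \ A`, which together are at most `U.card - 2`.
  have h3 : inside ends x A + inside ends x (U \ A) = ∑ k, x k := by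
    simp only [inside, Finset.sum_filter, ← Finset.sum_add_distrib]
    refine Finset.sum_congr rfl fun k _ => ?_
    by_cases h0 : x k = 0
    · simp [h0]
    have hc := hcon k h0
    have hcc := Finset.card_inter_add_card_sdiff (ends k) A
    rw [hE] at hcc
    unfold Crosses at hc
    have hdj : ∀ {B}, (ends k \ B).card = 0 ↔ ends k ⊆ B := by simp
    have hint : (ends k ∩ A).card = 0 ↔ ends k ⊆ U \ A := by
      rw [Finset.card_eq_zero, ← Finset.disjoint_iff_inter_eq_empty, Finset.subset_sdiff]
      exact ⟨fun h => ⟨hEU k, h⟩, fun h => h.2⟩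
    by_cases h4 : (ends k ∩ A).card = 0
    · have h5 : ¬ ends k ⊆ A := fun h => by rw [← hdj] at h; omega
      rw [if_neg h5, if_pos (hint.1 h4), zero_add]
    · have h5 : ends k ⊆ A := by rw [← hdj]; omega
      rw [if_pos h5, if_neg fun h => h4 (hint.2 h), add_zero]
  have h4 := hx.total
  have h5 : ((U \ A).card : ℝ) + A.card = U.card := by exact_mod_cast hcard
  linarith

end Polytope


/-! # The objective function and the random multigraph -/

section Objective

set_option linter.unusedSectionVars false

variable {V κ : Type*} [DecidableEq V] [Fintype κ] [DecidableEq κ]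

/-- The multilinear extension of edge costs plus penalties for the uncovered vertices in `W`. -/
def objective (w : κ → ℝ) (W : Finset V) (pen : V → ℝ) (cov : V → Finset κ) (x : κ → ℝ) : ℝ :=
  ∑ k, x k * w k + ∑ v ∈ W, pen v * ∏ k ∈ cov v, (1 - x k)

theorem prod_eq_mul_mul_prod_erase {s : Finset κ} {e f : κ} (hef : e ≠ f) (g : κ → ℝ) :
    ∏ k ∈ s, g k = (if e ∈ s then g e else 1) * (if f ∈ s then g f else 1) *
      ∏ k ∈ (s.erase e).erase f, g k := by
  have h : ∀ (s : Finset κ) (e : κ), ∏ k ∈ s, g k = (if e ∈ s then g e else 1) *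
      ∏ k ∈ s.erase e, g k := by
    intro s e
    by_cases he : e ∈ s
    · rw [if_pos he, Finset.mul_prod_erase _ _ he]
    · rw [if_neg he, one_mul, Finset.erase_eq_of_notMem he]
  rw [h s e, h (s.erase e) f, mul_assoc]
  simp [hef.symm]

/-- If both edges occur in the product, it is `(1 - x e - t) (1 - x f + t) Q`, with second-order
coefficient `-Q`; otherwise it is affine in `t`. The remaining product `Q` is nonnegative because no
value exceeds one. -/
theorem exists_quadratic_prod {x : κ → ℝ} (hx : ∀ k, x k ≤ 1) {e f : κ} (hef : e ≠ f)
    (s : Finset κ) : ∃ b c : ℝ, c ≤ 0 ∧ ∀ t,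
      ∏ k ∈ s, (1 - shift x e f t k) = ∏ k ∈ s, (1 - x k) + b * t + c * t ^ 2 := by
  set Q := ∏ k ∈ (s.erase e).erase f, (1 - x k) with hQ
  have hQ0 : 0 ≤ Q := Finset.prod_nonneg fun k _ => sub_nonneg.2 (hx k)
  have hQt : ∀ t, ∏ k ∈ (s.erase e).erase f, (1 - shift x e f t k) = Q := by
    intro t
    refine Finset.prod_congr rfl fun k hk => ?_
    rw [Finset.mem_erase, Finset.mem_erase] at hk
    simp [shift, hk.1, hk.2.1]
  have he : ∀ t, shift x e f t e = x e + t := fun t => by simp [shift, hef]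
  have hf : ∀ t, shift x e f t f = x f - t := fun t => by simp [shift, hef.symm]
  refine ⟨Q * ((if e ∈ s then 1 - x e else 1) * (if f ∈ s then 1 else 0) -
    (if e ∈ s then 1 else 0) * (if f ∈ s then 1 - x f else 1)),
    -(Q * ((if e ∈ s then 1 else 0) * (if f ∈ s then 1 else 0))), ?_, fun t => ?_⟩
  · rw [neg_nonpos]
    refine mul_nonneg hQ0 (mul_nonneg ?_ ?_) <;> split_ifs <;> norm_num
  · rw [prod_eq_mul_mul_prod_erase hef, prod_eq_mul_mul_prod_erase (s := s) hef, hQt, ← hQ, he, hf]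
    split_ifs <;> ring

theorem pairConcave_objective {U : Finset V} {ends : κ → Finset V} (hE : ∀ k, (ends k).card = 2)
    (w : κ → ℝ) (W : Finset V) {pen : V → ℝ} (hpen : ∀ v, 0 ≤ pen v) (cov : V → Finset κ) :
    PairConcave U ends (objective w W pen cov) := by
  intro x hx e f hef
  choose b c hc h using fun v => exists_quadratic_prod (hx.le_one hE) hef (cov v)
  refine ⟨w e - w f + ∑ v ∈ W, pen v * b v, ∑ v ∈ W, pen v * c v,
    Finset.sum_nonpos fun v _ => mul_nonpos_of_nonneg_of_nonpos (hpen v) (hc v), fun t => ?_⟩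
  unfold objective
  simp only [h]
  have hlin : ∑ k, shift x e f t k * w k = ∑ k, x k * w k + (w e - w f) * t := by
    simp only [shift, sub_mul, add_mul, Finset.sum_add_distrib, Finset.sum_sub_distrib, ite_mul,
      zero_mul, Finset.sum_ite_eq', Finset.mem_univ, if_true]
    ring
  rw [hlin]
  simp only [mul_add, Finset.sum_add_distrib, add_mul, Finset.sum_mul, mul_assoc]
  ring

end Objective

/-! ### From the Held-Karp polytope to the spanning tree polytope -/

section HeldKarp

variable {V ι : Type*} [DecidableEq V] [Fintype ι]

theorem crosses_singleton_iff {f : Finset V} (hf : f.card = 2) {v : V} :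
    Crosses f {v} ↔ v ∈ f := by
  unfold Crosses
  have h := Finset.card_inter_add_card_sdiff f {v}
  by_cases hv : v ∈ f
  · rw [Finset.inter_singleton_of_mem hv, Finset.card_singleton] at *
    simp only [hv, iff_true, true_and]
    omega
  · rw [Finset.inter_singleton_of_notMem hv] at *
    simp [hv]

-- The endpoints in `S` are counted: two for an edge inside `S`, one for a crossing edge.
open Classical in
theorem sum_crosses_singleton {f : Finset V} (hf : f.card = 2) (S : Finset V) (z : ℝ) :
    (∑ v ∈ S, if Crosses f {v} then z else 0) =
      2 * (if f ⊆ S then z else 0) + if Crosses f S then z else 0 := by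
  have h1 : (∑ v ∈ S, if Crosses f {v} then z else 0) = (f ∩ S).card * z := by
    simp only [crosses_singleton_iff hf]
    rw [← Finset.sum_filter, Finset.sum_const, nsmul_eq_mul, Finset.inter_comm,
      Finset.filter_mem_eq_inter]
  rw [h1]
  have h2 := Finset.card_inter_add_card_sdiff f S
  rw [hf] at h2
  unfold Crosses
  have h3 : f ⊆ S ↔ (f \ S).card = 0 := by simp
  simp only [h3]
  obtain h | h | h : (f \ S).card = 0 ∨ (f \ S).card = 1 ∨ (f \ S).card = 2 := by omega
  · obtain h' : (f ∩ S).card = 2 := by omega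
    simp [h, h']
  · obtain h' : (f ∩ S).card = 1 := by omega
    simp [h, h']
  · obtain h' : (f ∩ S).card = 0 := by omega
    simp [h, h']

open Classical in
theorem InHeldKarp.degree_sum {U : Finset V} {ends : ι → Finset V} {z : ι → ℝ}
    (h : InHeldKarp U ends z) (hE : ∀ k, (ends k).card = 2) {S : Finset V} (hS : S ⊆ U) :
    2 * inside ends z S + ∑ k with Crosses (ends k) S, z k = 2 * S.card := by
  have h1 : ∑ v ∈ S, ∑ k with Crosses (ends k) {v}, z k = 2 * S.card := by
    rw [Finset.sum_congr rfl fun v hv => h.degree v (hS hv), Finset.sum_const, nsmul_eq_mul,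
      mul_comm]
  rw [← h1]
  simp only [Finset.sum_filter, inside]
  rw [Finset.sum_comm, Finset.mul_sum, ← Finset.sum_add_distrib]
  refine Finset.sum_congr rfl fun k _ => ?_
  rw [sum_crosses_singleton (hE k)]

/-- A point of the Held-Karp polytope without an edge of value one is in the spanning tree
polytope. -/
theorem InHeldKarp.treePolytope {U : Finset V} {f₀ : Finset V} {ends : ι → Finset V} {z : ι → ℝ}
    (h : InHeldKarp (κ := Option ι) U (fun k => k.elim f₀ ends) (fun k => k.elim 1 z))
    (hf₀ : f₀.card = 2) (hf₀U : f₀ ⊆ U) (hE : ∀ k, (ends k).card = 2) (hEU : ∀ k, ends k ⊆ U) :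
    TreePolytope U ends z := by
  classical
  have hE' : ∀ k : Option ι, (k.elim f₀ ends).card = 2 := by
    rintro (_ | k)
    exacts [hf₀, hE k]
  have hz : ∀ k, 0 ≤ z k := fun k => h.nonneg (some k)
  have hin : ∀ S : Finset V, inside (κ := Option ι) (fun k => k.elim f₀ ends)
      (fun k => k.elim 1 z) S = (if f₀ ⊆ S then 1 else 0) + inside ends z S := by
    intro S
    simp only [inside, Finset.sum_filter, Fintype.sum_option, Option.elim_none, Option.elim_some]
    rfl
  have hU := h.degree_sum hE' subset_rfl
  have hcr : ∀ k : Option ι, ¬ Crosses (k.elim f₀ ends) U := by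
    rintro (_ | k) ⟨-, h2⟩
    · rw [Option.elim_none, Finset.sdiff_eq_empty_iff_subset.2 hf₀U] at h2; simp at h2
    · rw [Option.elim_some, Finset.sdiff_eq_empty_iff_subset.2 (hEU k)] at h2; simp at h2
  -- For the whole of `U` nothing crosses, and the special edge contributes one to the total
  -- `U.card`.
  rw [hin, if_pos hf₀U, Finset.filter_false_of_mem fun k _ => hcr k, Finset.sum_empty] at hU
  have htot : ∑ k, z k = U.card - 1 := by
    have : inside ends z U = ∑ k, z k := by
      rw [inside, Finset.filter_true_of_mem fun k _ => hEU k]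
    linarith
  refine ⟨hz, fun S hS => ?_, htot⟩
  -- The polytope imposes a constraint for every vertex set, but the edges see only its part in `U`;
  -- this part may be empty.
  have hSU : inside ends z S = inside ends z (S ∩ U) := by
    unfold inside
    refine Finset.sum_congr (Finset.filter_congr fun k _ => ?_) fun _ _ => rfl
    exact ⟨fun h => Finset.subset_inter h (hEU k), fun h => h.trans Finset.inter_subset_left⟩
  have hle : ((S ∩ U).card : ℝ) ≤ S.card := by
    exact_mod_cast Finset.card_le_card Finset.inter_subset_left
  rw [hSU]
  rcases (S ∩ U).eq_empty_or_nonempty with h0 | h0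
  · have : inside ends z (S ∩ U) = 0 := by
      rw [h0, inside, Finset.filter_false_of_mem, Finset.sum_empty]
      intro k _ hk
      have := hE k
      rw [Finset.subset_empty.1 hk] at this
      simp at this
    have : (1 : ℝ) ≤ S.card := by exact_mod_cast Finset.card_pos.2 hS
    linarith
  rcases (Finset.inter_subset_right : S ∩ U ⊆ U).eq_or_ssubset with h1 | h1
  · have : inside ends z (S ∩ U) = ∑ k, z k := by
      rw [h1, inside, Finset.filter_true_of_mem fun k _ => hEU k]
    rw [h1] at hle
    linarith
  · have h2 := h.degree_sum hE' h1.1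
    have h3 := h.connectivity _ h1 h0
    rw [hin] at h2
    have h4 : (0 : ℝ) ≤ if f₀ ⊆ S ∩ U then 1 else 0 := by split_ifs <;> norm_num
    linarith

end HeldKarp

/-! ### The start point, its value, and the multigraph of an integral point -/

section Input

variable {V ι : Type*} [Fintype V] [DecidableEq V] [Fintype ι]

namespace Input

/-- The edges of the graph `G₁`, with one copy of every edge for keeping the limbs of the tree and
one copy for omitting them. -/
noncomputable def ends (I : Input ℝ V ι) (k : ι × Bool) : Finset V := anchors (core I.y) (I.T k.1)

/-- The cost of the tour of a tree. -/
noncomputable def tourCost (I : Input ℝ V ι) (k : ι × Bool) : ℝ :=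
  setCost I.c (backbone (core I.y) (I.T k.1)) +
    if k.2 = true then 2 * setCost I.c (limbs (core I.y) (I.T k.1)) else 0

open Classical in
/-- The trees that contain `v` and whose limbs are kept. -/
noncomputable def cover (I : Input ℝ V ι) (v : V) : Finset (ι × Bool) :=
  Finset.univ.filter fun k => k.2 = true ∧ v ∈ (I.T k.1).verts

/-- The objective function of the rounding. -/
noncomputable def obj (I : Input ℝ V ι) : (ι × Bool → ℝ) → ℝ :=
  objective I.tourCost (core I.y)ᶜ I.pen I.cover

/-- Limbs are kept with probability `3 / 4`. -/
noncomputable def start (I : Input ℝ V ι) (k : ι × Bool) : ℝ :=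
  (if k.2 = true then 3 / 4 else 1 / 4) * I.μ k.1

variable {I : Input ℝ V ι}

namespace Valid

theorem card_ends (hI : I.Valid) (k : ι × Bool) : (I.ends k).card = 2 := hI.decomposition.two_anchors k.1

theorem ends_subset (_ : I.Valid) (k : ι × Bool) : I.ends k ⊆ core I.y :=
  fun _ hv => (mem_anchors.1 hv).1

theorem treePolytope_start (hI : I.Valid) : TreePolytope (core I.y) I.ends I.start := by
  classical
  have h := hI.decomposition.heldKarp.treePolytope
    (Sym2.card_toFinset_of_not_isDiag _ hI.e₀_edge)
    (fun v hv => hI.e₀_core v (Sym2.mem_toFinset.1 hv)) hI.decomposition.two_anchors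
    (fun k v hv => (mem_anchors.1 hv).1)
  refine ⟨fun k => mul_nonneg (by split_ifs <;> norm_num) (h.nonneg k.1), fun S hS => ?_, ?_⟩
  · refine le_of_eq_of_le ?_ (h.le S hS)
    simp only [inside, Finset.sum_filter, Fintype.sum_prod_type, Fintype.sum_bool]
    refine Finset.sum_congr rfl fun i _ => ?_
    simp only [ends, start]
    by_cases h : anchors (core I.y) (I.T i) ⊆ S
    · simp [h]; ring
    · simp [h]
  · rw [← h.total, Fintype.sum_prod_type]
    refine Finset.sum_congr rfl fun i _ => ?_
    simp [start]
    ring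

/-- Doubled limbs taken with weight `3/4` cost `3/2` times their length, with equality. For
penalties, `1 - t ≤ exp (-t)` is multiplied over the trees containing `v`, whose weights sum to `y
v`. -/
theorem obj_start_le (hI : I.Valid) : I.obj I.start ≤ I.bound := by
  classical
  refine add_le_add (le_of_eq ?_) (Finset.sum_le_sum fun v hv => ?_)
  · rw [Fintype.sum_prod_type]
    refine Finset.sum_congr rfl fun i _ => ?_
    simp [start, tourCost]
    ring
  · refine mul_le_mul_of_nonneg_left ?_ (hI.isInstance.pen_nonneg v)
    have h1 : ∏ k ∈ I.cover v, (1 - I.start k) =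
        ∏ i with v ∈ (I.T i).verts, (1 - 3 / 4 * I.μ i) := by
      simp only [cover, Finset.prod_filter, Fintype.prod_prod_type, Fintype.prod_bool, start]
      refine Finset.prod_congr rfl fun i _ => ?_
      simp
    rw [h1, ← hI.decomposition.incident v (by simpa using hv)]
    have h2 : -(3 * (∑ i with v ∈ (I.T i).verts, I.μ i) / 4) =
        ∑ i with v ∈ (I.T i).verts, -(3 / 4 * I.μ i) := by
      rw [Finset.sum_neg_distrib, ← Finset.mul_sum]; ring
    rw [h2, Real.exp_sum]
    refine Finset.prod_le_prod (fun i _ => ?_) fun i _ => ?_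
    -- Multiplying the inequalities needs nonnegative factors, and these come from `μ ≤ 1`.
    · have := (hI.decomposition.weight_mem i).2
      linarith
    · have := Real.add_one_le_exp (-(3 / 4 * I.μ i))
      linarith

/-- The multigraph given by an integral point of the spanning tree polytope that is at least as good
as the expectation. -/
theorem goodSample (hI : I.Valid) {Ω : Type*} [Fintype Ω] (P : PMF Ω) {z : ι × Bool → ℝ}
    (hz : TreePolytope (core I.y) I.ends z) (hint : ∀ k, z k = 0 ∨ z k = 1)
    (hobj : I.obj z ≤ I.obj I.start) {S : Finset (ι × Bool)} (hS : ∀ k, k ∈ S ↔ z k = 1) :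
    I.GoodSample P fun _ => mergeTours (core I.y) (fun k => I.T k.1) (fun k => k.2) S := by
  classical
  have hT : ∀ k : ι × Bool, (I.T k.1).coe.IsTree := fun k => hI.decomposition.isTree k.1
  refine ⟨fun _ => ?_, fun _ v hv => mem_verts_mergeTours.2 (.inl hv), fun _ v _ hv =>
    even_degree_mergeTours hT hI.card_ends hv, ?_⟩
  · refine connected_mergeTours hT hI.card_ends ?_ fun A hA hne => ?_
    · obtain ⟨v, hv⟩ := Finset.card_pos.1 ((Sym2.card_toFinset_of_not_isDiag _ hI.e₀_edge).symm ▸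
        Nat.two_pos)
      exact ⟨v, hI.e₀_core v (Sym2.mem_toFinset.1 hv)⟩
    · obtain ⟨k, hk, hc⟩ := hz.exists_crosses hI.card_ends hI.ends_subset hA hne
      exact ⟨k, (hS k).2 ((hint k).resolve_left hk), hc⟩
  · have hP : ∑ ω, (P ω).toReal = 1 := by
      have h := P.tsum_coe
      rw [tsum_fintype] at h
      rw [← ENNReal.toReal_sum fun ω _ => P.apply_ne_top ω, h, ENNReal.toReal_one]
    rw [← Finset.sum_mul, hP, one_mul]
    refine le_trans (add_le_add (le_of_eq ?_) ?_) (hobj.trans hI.obj_start_le)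
    · rw [cost_mergeTours, ← Finset.sum_subset (Finset.subset_univ S) fun k _ hk => by
        rw [(hint k).resolve_right fun h => hk ((hS k).2 h), zero_mul]]
      exact Finset.sum_congr rfl fun k hk => by rw [(hS k).1 hk, one_mul]; rfl
    -- At an integral point the product over `I.cover v` equals one for every vertex that no chosen
    -- limb-keeping copy covers, in particular for the vertices outside `H`.
    · refine penalty_mergeTours_le (U := core I.y) hT hI.card_ends hI.isInstance.pen_nonneg
        (q := fun v => ∏ k ∈ I.cover v, (1 - z k))
        (fun v => Finset.prod_nonneg fun k _ => ?_) fun v hv => Finset.prod_eq_one fun k hk => ?_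
      · rcases hint k with h | h <;> rw [h] <;> norm_num
      · rw [cover, Finset.mem_filter] at hk
        rw [(hint k).resolve_right fun h => hv k ((hS k).2 h) hk.2.1 hk.2.2, sub_zero]

theorem exists_goodSample (hI : I.Valid) : ∃ (N : ℕ) (P : PMF (Fin N)) (H : Fin N → Multigraph V),
    I.GoodSample P H := by
  classical
  obtain ⟨z, h1, h2, h3⟩ := hI.treePolytope_start.exists_integral hI.card_ends hI.ends_subset
    (F := I.obj) (pairConcave_objective hI.card_ends _ _ hI.isInstance.pen_nonneg _)
  exact ⟨1, PMF.pure 0, _, hI.goodSample _ h1 h2 h3 (S := Finset.univ.filter fun k => z k = 1)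
    fun k => by simp⟩

end Valid

end Input

end Input


/-! # Testing membership in the spanning tree polytope

Edge `e` has the endpoints `A e` and `B e`.  The value `X e` of every edge is distributed to its
endpoints, `o e` to `A e` and the rest to `B e`, and the load of the endpoints is balanced by moving
smaller and smaller amounts. -/

section Balance

/-- The load of `v`, with an additional load of `D` at the vertex `r`. -/
def vload (m : ℕ) (A B X : ℕ → ℕ) (r D : ℕ) (o : ℕ → ℕ) (v : ℕ) : ℕ :=
  ∑ e ∈ Finset.range m, ((if A e = v then o e else 0) + (if B e = v then X e - o e else 0)) +
    if v = r then D else 0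

variable {m n : ℕ} {A B X : ℕ → ℕ} {r D : ℕ} {o : ℕ → ℕ} {Δ : ℕ}

/-- The amount `Δ` can be moved from the first to the second endpoint of `e`. -/
def CanMove (m : ℕ) (A B X : ℕ → ℕ) (r D Δ : ℕ) (o : ℕ → ℕ) (e : ℕ) : Prop :=
  Δ ≤ o e ∧ vload m A B X r D o (B e) + 2 * Δ ≤ vload m A B X r D o (A e) ∧
    D + 2 * Δ ≤ vload m A B X r D o (A e)

/-- The amount `Δ` can be moved from the second to the first endpoint of `e`. -/
def CanMoveBack (m : ℕ) (A B X : ℕ → ℕ) (r D Δ : ℕ) (o : ℕ → ℕ) (e : ℕ) : Prop :=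
  o e + Δ ≤ X e ∧ vload m A B X r D o (A e) + 2 * Δ ≤ vload m A B X r D o (B e) ∧
    D + 2 * Δ ≤ vload m A B X r D o (B e)

/-- No amount of `Δ` can be moved. -/
def Balanced (m : ℕ) (A B X : ℕ → ℕ) (r D Δ : ℕ) (o : ℕ → ℕ) : Prop :=
  ∀ e < m, ¬ CanMove m A B X r D Δ o e ∧ ¬ CanMoveBack m A B X r D Δ o e

theorem sum_vload (R : Finset ℕ) : ∑ v ∈ R, vload m A B X r D o v =
    ∑ e ∈ Finset.range m, ((if A e ∈ R then o e else 0) + (if B e ∈ R then X e - o e else 0)) +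
      if r ∈ R then D else 0 := by
  simp only [vload, Finset.sum_add_distrib]
  rw [Finset.sum_comm, Finset.sum_comm (s := R)]
  simp

/-- The values `X` together with the load of `D` at `r` can be distributed such that the load of all
vertices is at most `D`. -/
def Distributable (m n : ℕ) (A B X : ℕ → ℕ) (r D : ℕ) : Prop :=
  ∀ R ⊆ Finset.range n, R.Nonempty →
    (∑ e ∈ Finset.range m, if A e ∈ R ∧ B e ∈ R then X e else 0) + (if r ∈ R then D else 0) ≤
      D * R.card

/-- Pigeonhole: otherwise each of the `n` bands of width `δ` below `M` contains the value of some
vertex, in addition to a vertex with value at least `M`. -/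
theorem exists_level (n : ℕ) (f : ℕ → ℕ) (M δ : ℕ) (h : ∃ v < n, M ≤ f v) :
    ∃ i < n, ∀ v < n, M ≤ f v + (i + 1) * δ → M ≤ f v + i * δ := by
  by_contra! hcon
  have hcard : ∀ i ≤ n, i + 1 ≤ ((Finset.range n).filter fun v => M ≤ f v + i * δ).card := by
    intro i
    induction i with
    | zero =>
      intro _
      obtain ⟨v, hv, hM⟩ := h
      exact Finset.card_pos.2 ⟨v, by simp [hv, hM]⟩
    | succ i ih =>
      intro hi
      obtain ⟨v, hv, h1, h2⟩ := hcon i (by omega)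
      refine (Nat.succ_le_succ (ih (by omega))).trans (Finset.card_lt_card ⟨fun u hu => ?_, ?_⟩)
      · rw [Finset.mem_filter] at hu ⊢
        exact ⟨hu.1, hu.2.trans (by rw [add_mul]; omega)⟩
      · intro hsub
        have : v ∈ _ := hsub (Finset.mem_filter.2 ⟨Finset.mem_range.2 hv, h1⟩)
        rw [Finset.mem_filter] at this
        omega
  have h1 := hcard n le_rfl
  have h2 := Finset.card_filter_le (Finset.range n) fun v => M ≤ f v + n * δ
  rw [Finset.card_range] at h2
  omega

/-- Below a too large load `M` there is a gap of width `2 * Δ` in the loads. Let `R` be the vertices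
above the gap. An edge leaving `R` deposits less than `Δ` in `R`, or else a move would be possible.
So the load of `R` exceeds what Hall's condition allows by at most `m * Δ`, although each of its
vertices carries more than `D + m * Δ`. -/
theorem Balanced.vload_le (hA : ∀ e < m, A e < n) (hB : ∀ e < m, B e < n) (ho : ∀ e < m, o e ≤ X e)
    (hX : Distributable m n A B X r D) (h : Balanced m A B X r D Δ o) {v : ℕ} (hv : v < n) :
    vload m A B X r D o v ≤ D + (m + 2 * n) * Δ := by
  by_contra! hcon
  set M := vload m A B X r D o v with hM
  obtain ⟨i, hi, hgap⟩ := exists_level n (vload m A B X r D o) M (2 * Δ) ⟨v, hv, le_rfl⟩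
  set R := (Finset.range n).filter fun u => M ≤ vload m A B X r D o u + i * (2 * Δ) with hR
  have hmemR : ∀ u, u ∈ R ↔ u < n ∧ M ≤ vload m A B X r D o u + i * (2 * Δ) := by simp [hR]
  have hvR : v ∈ R := by rw [hmemR]; exact ⟨hv, by omega⟩
  have hiΔ : (i + 1) * (2 * Δ) ≤ 2 * n * Δ := by
    have := Nat.mul_le_mul_right (2 * Δ) (show i + 1 ≤ n from hi)
    linarith
  rw [add_mul] at hcon hgap hiΔ
  -- The gap lies at most `2 * n * Δ` below `M`. The remaining margin `2 * Δ` over `D` is what the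
  -- last condition of a move demands.
  have hlarge : ∀ u ∈ R, D + m * Δ + 2 * Δ < vload m A B X r D o u := by
    intro u hu
    have := ((hmemR u).1 hu).2
    omega
  have hout : ∀ u < n, u ∉ R → vload m A B X r D o u + i * (2 * Δ) + 2 * Δ < M := by
    intro u hu huR
    by_contra! hle
    exact huR ((hmemR u).2 ⟨hu, hgap u hu (by omega)⟩)
  have hle : ∑ u ∈ R, vload m A B X r D o u ≤ D * R.card + m * Δ := by
    rw [sum_vload]
    have h1 : ∑ e ∈ Finset.range m, ((if A e ∈ R then o e else 0) +
        (if B e ∈ R then X e - o e else 0)) ≤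
        ∑ e ∈ Finset.range m, ((if A e ∈ R ∧ B e ∈ R then X e else 0) + Δ) := by
      refine Finset.sum_le_sum fun e he => ?_
      have he := Finset.mem_range.1 he
      obtain ⟨h2, h3⟩ := h e he
      have hoe := ho e he
      by_cases hAR : A e ∈ R <;> by_cases hBR : B e ∈ R
      · simp only [hAR, hBR, and_self, if_true]; omega
      · have h4 := hout _ (hB e he) hBR
        have h5 := ((hmemR _).1 hAR).2
        have h6 := hlarge _ hAR
        unfold CanMove at h2
        simp only [hAR, hBR, and_false, if_true, if_false]
        by_contra hc
        exact h2 ⟨by omega, by omega, by omega⟩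
      · have h4 := hout _ (hA e he) hAR
        have h5 := ((hmemR _).1 hBR).2
        have h6 := hlarge _ hBR
        unfold CanMoveBack at h3
        simp only [hAR, hBR, false_and, if_true, if_false]
        by_contra hc
        exact h3 ⟨by omega, by omega, by omega⟩
      · simp [hAR, hBR]
    rw [Finset.sum_add_distrib (g := fun _ => Δ), Finset.sum_const, Finset.card_range,
      smul_eq_mul] at h1
    have h2 := hX R (Finset.filter_subset _ _) ⟨v, hvR⟩
    omega
  have hge : R.card * (D + m * Δ + 1) ≤ ∑ u ∈ R, vload m A B X r D o u := by
    rw [← smul_eq_mul]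
    refine Finset.card_nsmul_le_sum _ _ _ fun u hu => ?_
    have := hlarge u hu
    omega
  have hpos : 1 ≤ R.card := Finset.card_pos.2 ⟨v, hvR⟩
  have := Nat.mul_le_mul_right (m * Δ) hpos
  linarith

/-- The potential function that decreases in every move. -/
def potential (m n : ℕ) (A B X : ℕ → ℕ) (r D : ℕ) (o : ℕ → ℕ) : ℕ :=
  ∑ v ∈ Finset.range n, (vload m A B X r D o v - D) ^ 2

theorem vload_eq_of_update {o' : ℕ → ℕ} {e : ℕ} (he : e < m)
    (h : ∀ i < m, i ≠ e → o' i = o i) (v : ℕ) :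
    vload m A B X r D o' v + ((if A e = v then o e else 0) + if B e = v then X e - o e else 0) =
      vload m A B X r D o v +
        ((if A e = v then o' e else 0) + if B e = v then X e - o' e else 0) := by
  unfold vload
  rw [← Finset.add_sum_erase _ _ (Finset.mem_range.2 he),
    ← Finset.add_sum_erase (Finset.range m) (fun e => (if A e = v then o e else 0) +
      if B e = v then X e - o e else 0) (Finset.mem_range.2 he)]
  have : ∑ i ∈ (Finset.range m).erase e,
      ((if A i = v then o' i else 0) + if B i = v then X i - o' i else 0) =
      ∑ i ∈ (Finset.range m).erase e,
      ((if A i = v then o i else 0) + if B i = v then X i - o i else 0) := by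
    refine Finset.sum_congr rfl fun i hi => ?_
    rw [Finset.mem_erase, Finset.mem_range] at hi
    rw [h i hi.2 hi.1]
  omega

/-- The decrease equals `2 * Δ * (p - q) - 2 * Δ ^ 2`, and `p - q` is at least `2 * Δ`. -/
theorem sq_add_sq_le {p q Δ : ℕ} (h : q + 2 * Δ ≤ p) :
    (p - Δ) ^ 2 + (q + Δ) ^ 2 + 2 * Δ ^ 2 ≤ p ^ 2 + q ^ 2 := by
  obtain ⟨c, rfl⟩ := Nat.exists_eq_add_of_le h
  have : q + 2 * Δ + c - Δ = q + Δ + c := by omega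
  rw [this]
  nlinarith [Nat.zero_le (c * Δ)]

theorem sum_sq_le {n D Δ a b : ℕ} {f g : ℕ → ℕ} (ha : a < n) (hb : b < n) (hab : a ≠ b)
    (hga : g a + Δ = f a) (hgb : g b = f b + Δ) (hg : ∀ v, v ≠ a → v ≠ b → g v = f v)
    (h1 : f b + 2 * Δ ≤ f a) (h2 : D + 2 * Δ ≤ f a) :
    ∑ v ∈ Finset.range n, (g v - D) ^ 2 + 2 * Δ ^ 2 ≤ ∑ v ∈ Finset.range n, (f v - D) ^ 2 := by
  have hsplit : ∀ f : ℕ → ℕ, ∑ v ∈ Finset.range n, (f v - D) ^ 2 =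
      (f a - D) ^ 2 + ((f b - D) ^ 2 +
        ∑ v ∈ ((Finset.range n).erase a).erase b, (f v - D) ^ 2) := by
    intro f
    rw [Finset.add_sum_erase _ (fun v => (f v - D) ^ 2) (by simp [hab.symm, hb]),
      Finset.add_sum_erase _ (fun v => (f v - D) ^ 2) (by simp [ha])]
  rw [hsplit f, hsplit g]
  have hrest : ∑ v ∈ ((Finset.range n).erase a).erase b, (g v - D) ^ 2 =
      ∑ v ∈ ((Finset.range n).erase a).erase b, (f v - D) ^ 2 := by
    refine Finset.sum_congr rfl fun v hv => ?_
    rw [Finset.mem_erase, Finset.mem_erase] at hv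
    rw [hg v hv.2.1 hv.1]
  -- The subtraction of `D` is truncated: if `f b` is below `D`, its excess is zero, and the
  -- required gap comes from `h2` instead of `h1`.
  have h3 := sq_add_sq_le (p := f a - D) (q := f b - D) (Δ := Δ) (by omega)
  have h4 : g a - D = f a - D - Δ := by omega
  have h5 : (g b - D) ^ 2 ≤ (f b - D + Δ) ^ 2 := Nat.pow_le_pow_left (by omega) 2
  rw [hrest, h4]
  omega

theorem potential_le_of_canMove {o' : ℕ → ℕ} {e : ℕ} (he : e < m) (hAn : A e < n) (hBn : B e < n)
    (hAB : A e ≠ B e) (ho : o e ≤ X e) (h : ∀ i < m, i ≠ e → o' i = o i)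
    (hc : CanMove m A B X r D Δ o e) (ho' : o' e = o e - Δ) :
    potential m n A B X r D o' + 2 * Δ ^ 2 ≤ potential m n A B X r D o := by
  obtain ⟨h1, h2, h3⟩ := hc
  have key := vload_eq_of_update (r := r) (D := D) (A := A) (B := B) (X := X) he h
  refine sum_sq_le hAn hBn hAB ?_ ?_ (fun v hva hvb => ?_) h2 h3
  · have := key (A e)
    simp only [if_true, hAB.symm, if_false] at this
    omega
  · have := key (B e)
    simp only [if_true, hAB, if_false] at this
    omega
  · have := key v
    simp only [hva.symm, hvb.symm, if_false] at this
    omega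

theorem potential_le_of_canMoveBack {o' : ℕ → ℕ} {e : ℕ} (he : e < m) (hAn : A e < n)
    (hBn : B e < n) (hAB : A e ≠ B e) (h : ∀ i < m, i ≠ e → o' i = o i)
    (hc : CanMoveBack m A B X r D Δ o e) (ho' : o' e = o e + Δ) :
    potential m n A B X r D o' + 2 * Δ ^ 2 ≤ potential m n A B X r D o := by
  obtain ⟨h1, h2, h3⟩ := hc
  have key := vload_eq_of_update (r := r) (D := D) (A := A) (B := B) (X := X) he h
  refine sum_sq_le hBn hAn hAB.symm ?_ ?_ (fun v hvb hva => ?_) h2 h3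
  · have := key (B e)
    simp only [if_true, hAB, if_false] at this
    omega
  · have := key (A e)
    simp only [if_true, hAB.symm, if_false] at this
    omega
  · have := key v
    simp only [hva.symm, hvb.symm, if_false] at this
    omega

end Balance

/-! ## The algorithm -/

section Algorithm

/-- The load of a vertex. -/
def load (er A B X : List ℕ) (r D : ℕ) (o : List ℕ) (v : ℕ) : ℕ :=
  (er.map fun e => (if A.getD e 0 = v then o.getD e 0 else 0) +
    (if B.getD e 0 = v then X.getD e 0 - o.getD e 0 else 0)).sum + if v = r then D else 0

/-- The value of edge `e` at its first endpoint after trying to move the amount `Δ`. -/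
def newValue (er A B X : List ℕ) (r D Δ : ℕ) (o : List ℕ) (e : ℕ) : ℕ :=
  bif decide (Δ ≤ o.getD e 0) && (decide (load er A B X r D o (B.getD e 0) + 2 * Δ ≤
      load er A B X r D o (A.getD e 0)) &&
      decide (D + 2 * Δ ≤ load er A B X r D o (A.getD e 0))) then
    o.getD e 0 - Δ
  else bif decide (o.getD e 0 + Δ ≤ X.getD e 0) &&
      (decide (load er A B X r D o (A.getD e 0) + 2 * Δ ≤ load er A B X r D o (B.getD e 0)) &&
      decide (D + 2 * Δ ≤ load er A B X r D o (B.getD e 0))) then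
    o.getD e 0 + Δ
  else o.getD e 0

/-- Try to move the amount `Δ` along the edge `e`. -/
def relax (er A B X : List ℕ) (r D Δ : ℕ) (o : List ℕ) (e : ℕ) : List ℕ :=
  er.map fun i => if i = e then newValue er A B X r D Δ o e else o.getD i 0

/-- Try to move the amount `Δ` along all edges. -/
def sweep (er A B X : List ℕ) (r D Δ : ℕ) (o : List ℕ) : List ℕ :=
  er.foldl (relax er A B X r D Δ) o

/-- Repeat `sweep` for every triple of elements of `q`. -/
def balance (q er A B X : List ℕ) (r D Δ : ℕ) (o : List ℕ) : List ℕ :=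
  q.foldl (fun o _ => q.foldl (fun o _ => q.foldl (fun o _ => sweep er A B X r D Δ o) o) o) o

/-- Distribute the values `X` to the endpoints of the edges. -/
def distribute (q er A B X : List ℕ) (r D : ℕ) : List ℕ :=
  (powers (X.sum + D)).foldl (fun o Δ => balance q er A B X r D Δ o) (er.map fun _ => 0)

/-- Test whether the values `X` can be distributed. -/
def fits (q vr er A B X : List ℕ) (D r : ℕ) : Bool :=
  vr.all fun v => decide (load er A B X r D (distribute q er A B X r D) v ≤ D + q.length)

/-- Test whether the values `x / D` are in the spanning tree polytope. -/
def inPolytope (vr er A B : List ℕ) (D : ℕ) (x : List ℕ) : Bool :=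
  vr.all fun r => fits (er ++ (vr ++ vr)) vr er A B
    (er.map fun e => (vr.length * (er ++ (vr ++ vr)).length + 1) * x.getD e 0)
    ((vr.length * (er ++ (vr ++ vr)).length + 1) * D) r

theorem getD_map_range {m i : ℕ} (f : ℕ → ℕ) (hi : i < m) :
    ((List.range m).map f).getD i 0 = f i := by
  rw [List.getD_eq_getElem _ _ (by simpa using hi)]; simp

theorem foldl_const_eq_iterate {σ τ : Type*} (f : σ → σ) (l : List τ) (s : σ) :
    l.foldl (fun s _ => f s) s = f^[l.length] s := by
  induction l generalizing s with
  | nil => rfl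
  | cons x l ih => exact ih _

theorem balance_eq (q er A B X : List ℕ) (r D Δ : ℕ) (o : List ℕ) :
    balance q er A B X r D Δ o =
      (sweep er A B X r D Δ)^[q.length * (q.length * q.length)] o := by
  simp only [balance, foldl_const_eq_iterate]
  rw [Function.iterate_mul, Function.iterate_mul]

theorem load_eq {m : ℕ} (A B X : List ℕ) (r D : ℕ) (o : List ℕ) (v : ℕ) :
    load (List.range m) A B X r D o v = vload m (fun e => A.getD e 0) (fun e => B.getD e 0)
      (fun e => X.getD e 0) r D (fun e => o.getD e 0) v := rfl

variable {m n : ℕ} {A B X : List ℕ} {r D : ℕ}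

/-- The first parts of the values are at most the values. -/
def IsSplit (m : ℕ) (X o : List ℕ) : Prop := ∀ e < m, o.getD e 0 ≤ X.getD e 0

theorem getD_relax {Δ : ℕ} {o : List ℕ} {e i : ℕ} (hi : i < m) :
    (relax (List.range m) A B X r D Δ o e).getD i 0 =
      if i = e then newValue (List.range m) A B X r D Δ o e else o.getD i 0 :=
  getD_map_range _ hi

/-- The potential of a list of values. -/
def lpotential (m n : ℕ) (A B X : List ℕ) (r D : ℕ) (o : List ℕ) : ℕ :=
  potential m n (fun e => A.getD e 0) (fun e => B.getD e 0) (fun e => X.getD e 0) r D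
    fun e => o.getD e 0

/-- No amount of `Δ` can be moved along `e`. -/
def Stuck (m : ℕ) (A B X : List ℕ) (r D Δ : ℕ) (o : List ℕ) (e : ℕ) : Prop :=
  ¬ CanMove m (fun e => A.getD e 0) (fun e => B.getD e 0) (fun e => X.getD e 0) r D Δ
    (fun e => o.getD e 0) e ∧
  ¬ CanMoveBack m (fun e => A.getD e 0) (fun e => B.getD e 0) (fun e => X.getD e 0) r D Δ
    (fun e => o.getD e 0) e

/-- A relaxation rebuilds the list even when nothing moves, so lists are compared only at the
indices below `m`. -/
theorem vload_congr {A B X : ℕ → ℕ} {o o' : ℕ → ℕ} (h : ∀ e < m, o e = o' e) (v : ℕ) :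
    vload m A B X r D o v = vload m A B X r D o' v := by
  unfold vload
  congr 1
  exact Finset.sum_congr rfl fun e he => by rw [h e (Finset.mem_range.1 he)]

theorem Stuck.congr {Δ : ℕ} {o o' : List ℕ} (h : ∀ e < m, o.getD e 0 = o'.getD e 0) {e : ℕ}
    (he : e < m) (hs : Stuck m A B X r D Δ o e) : Stuck m A B X r D Δ o' e := by
  have h1 := vload_congr (r := r) (D := D) (A := fun e => A.getD e 0) (B := fun e => B.getD e 0)
    (X := fun e => X.getD e 0) (o := fun e => o.getD e 0) (o' := fun e => o'.getD e 0) h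
  unfold Stuck CanMove CanMoveBack at *
  simp only [← h1, ← h e he]
  exact hs

theorem lpotential_congr {o o' : List ℕ} (h : ∀ e < m, o.getD e 0 = o'.getD e 0) :
    lpotential m n A B X r D o = lpotential m n A B X r D o' := by
  unfold lpotential potential
  exact Finset.sum_congr rfl fun v _ => by rw [vload_congr h]

/-- Well-formed lists of endpoints. -/
structure EndLists (m n : ℕ) (A B : List ℕ) : Prop where
  left_lt : ∀ e < m, A.getD e 0 < n
  right_lt : ∀ e < m, B.getD e 0 < n
  ne : ∀ e < m, A.getD e 0 ≠ B.getD e 0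

theorem relax_spec (hAB : EndLists m n A B) {Δ : ℕ} {o : List ℕ} (ho : IsSplit m X o) {e : ℕ}
    (he : e < m) : IsSplit m X (relax (List.range m) A B X r D Δ o e) ∧
      ((Stuck m A B X r D Δ o e ∧
        ∀ i < m, (relax (List.range m) A B X r D Δ o e).getD i 0 = o.getD i 0) ∨
      (¬ Stuck m A B X r D Δ o e ∧
        lpotential m n A B X r D (relax (List.range m) A B X r D Δ o e) + 2 * Δ ^ 2 ≤
          lpotential m n A B X r D o)) := by
  have hrest : ∀ i < m, i ≠ e → (relax (List.range m) A B X r D Δ o e).getD i 0 = o.getD i 0 :=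
    fun i hi hie => by rw [getD_relax hi, if_neg hie]
  have hself : (relax (List.range m) A B X r D Δ o e).getD e 0 =
      newValue (List.range m) A B X r D Δ o e := by rw [getD_relax he, if_pos rfl]
  have hsplit : newValue (List.range m) A B X r D Δ o e ≤ X.getD e 0 →
      IsSplit m X (relax (List.range m) A B X r D Δ o e) := by
    intro h i hi
    by_cases hie : i = e
    · subst hie; rwa [hself]
    · rw [hrest i hi hie]; exact ho i hi
  by_cases h1 : CanMove m (fun e => A.getD e 0) (fun e => B.getD e 0) (fun e => X.getD e 0) r D Δ
      (fun e => o.getD e 0) e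
  · have hv : newValue (List.range m) A B X r D Δ o e = o.getD e 0 - Δ := by
      have hd : (decide (Δ ≤ o.getD e 0) &&
          (decide (load (List.range m) A B X r D o (B.getD e 0) + 2 * Δ ≤
            load (List.range m) A B X r D o (A.getD e 0)) &&
          decide (D + 2 * Δ ≤ load (List.range m) A B X r D o (A.getD e 0)))) = true := by
        rw [← Bool.decide_and, ← Bool.decide_and, decide_eq_true_iff]
        exact h1
      rw [newValue, hd]; rfl
    refine ⟨hsplit (by rw [hv]; exact (Nat.sub_le _ _).trans (ho e he)), .inr ⟨fun h => h.1 h1, ?_⟩⟩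
    exact potential_le_of_canMove he (hAB.left_lt e he) (hAB.right_lt e he) (hAB.ne e he) (ho e he)
      hrest h1 (by rw [hself, hv])
  have hd1 : (decide (Δ ≤ o.getD e 0) &&
      (decide (load (List.range m) A B X r D o (B.getD e 0) + 2 * Δ ≤
        load (List.range m) A B X r D o (A.getD e 0)) &&
      decide (D + 2 * Δ ≤ load (List.range m) A B X r D o (A.getD e 0)))) = false := by
    rw [← Bool.decide_and, ← Bool.decide_and, decide_eq_false_iff_not]
    exact h1
  by_cases h2 : CanMoveBack m (fun e => A.getD e 0) (fun e => B.getD e 0) (fun e => X.getD e 0) r D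
      Δ (fun e => o.getD e 0) e
  · have hv : newValue (List.range m) A B X r D Δ o e = o.getD e 0 + Δ := by
      have hd : (decide (o.getD e 0 + Δ ≤ X.getD e 0) &&
          (decide (load (List.range m) A B X r D o (A.getD e 0) + 2 * Δ ≤
            load (List.range m) A B X r D o (B.getD e 0)) &&
          decide (D + 2 * Δ ≤ load (List.range m) A B X r D o (B.getD e 0)))) = true := by
        rw [← Bool.decide_and, ← Bool.decide_and, decide_eq_true_iff]
        exact h2
      rw [newValue, hd1, hd]; rfl
    refine ⟨hsplit (by rw [hv]; exact h2.1), .inr ⟨fun h => h.2 h2, ?_⟩⟩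
    exact potential_le_of_canMoveBack he (hAB.left_lt e he) (hAB.right_lt e he) (hAB.ne e he)
      hrest h2 (by rw [hself, hv])
  have hd2 : (decide (o.getD e 0 + Δ ≤ X.getD e 0) &&
      (decide (load (List.range m) A B X r D o (A.getD e 0) + 2 * Δ ≤
        load (List.range m) A B X r D o (B.getD e 0)) &&
      decide (D + 2 * Δ ≤ load (List.range m) A B X r D o (B.getD e 0)))) = false := by
    rw [← Bool.decide_and, ← Bool.decide_and, decide_eq_false_iff_not]
    exact h2
  have hv : newValue (List.range m) A B X r D Δ o e = o.getD e 0 := by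
    rw [newValue, hd1, hd2]; rfl
  refine ⟨hsplit (by rw [hv]; exact ho e he), .inl ⟨⟨h1, h2⟩, fun i hi => ?_⟩⟩
  by_cases hie : i = e
  · subst hie; rw [hself, hv]
  · exact hrest i hi hie

/-- No relaxation increases the potential, so a single actual move accounts for the whole decrease.
If there is none, every edge was tested on the same values and all are stuck. -/
theorem sweep_spec (hAB : EndLists m n A B) {Δ : ℕ} {o : List ℕ} (ho : IsSplit m X o) :
    IsSplit m X (sweep (List.range m) A B X r D Δ o) ∧
      (((∀ e < m, Stuck m A B X r D Δ o e) ∧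
        ∀ i < m, (sweep (List.range m) A B X r D Δ o).getD i 0 = o.getD i 0) ∨
      (¬ (∀ e < m, Stuck m A B X r D Δ o e) ∧
        lpotential m n A B X r D (sweep (List.range m) A B X r D Δ o) + 2 * Δ ^ 2 ≤
          lpotential m n A B X r D o)) := by
  have key : ∀ l : List ℕ, (∀ e ∈ l, e < m) → ∀ o, IsSplit m X o →
      IsSplit m X (l.foldl (relax (List.range m) A B X r D Δ) o) ∧
      (((∀ e ∈ l, Stuck m A B X r D Δ o e) ∧
        ∀ i < m, (l.foldl (relax (List.range m) A B X r D Δ) o).getD i 0 = o.getD i 0) ∨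
      (¬ (∀ e ∈ l, Stuck m A B X r D Δ o e) ∧
        lpotential m n A B X r D (l.foldl (relax (List.range m) A B X r D Δ) o) + 2 * Δ ^ 2 ≤
          lpotential m n A B X r D o)) := by
    intro l
    induction l with
    | nil => exact fun _ o ho => ⟨ho, .inl ⟨by simp, fun _ _ => rfl⟩⟩
    | cons e l ih =>
      intro hl o ho
      have he : e < m := hl e (by simp)
      obtain ⟨h1, h2⟩ := relax_spec (r := r) (D := D) (Δ := Δ) hAB ho he
      obtain ⟨h3, h4⟩ := ih (fun e he => hl e (by simp [he])) _ h1
      refine ⟨h3, ?_⟩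
      rw [List.foldl_cons]
      rcases h2 with ⟨h2, h2'⟩ | ⟨h2, h2'⟩ <;> rcases h4 with ⟨h4, h4'⟩ | ⟨h4, h4'⟩
      · refine .inl ⟨fun e' he' => ?_, fun i hi => (h4' i hi).trans (h2' i hi)⟩
        rcases List.mem_cons.1 he' with rfl | he'
        · exact h2
        · exact (h4 e' he').congr h2' (hl e' (by simp [he']))
      · rw [lpotential_congr h2'] at h4'
        refine .inr ⟨fun h => h4 fun e' he' => ?_, h4'⟩
        exact (h e' (by simp [he'])).congr (fun i hi => (h2' i hi).symm) (hl e' (by simp [he']))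
      · exact .inr ⟨fun h => h2 (h e (by simp)), by rwa [lpotential_congr h4']⟩
      · exact .inr ⟨fun h => h2 (h e (by simp)), by omega⟩
  have := key (List.range m) (fun e he => List.mem_range.1 he) o ho
  simp only [List.mem_range] at this
  exact this

/-- Every sweep that moves something lowers the potential by `2 * Δ ^ 2`, so there are at most `N`
of them; after a sweep without moves, nothing changes any more. -/
theorem iterate_sweep_spec (hAB : EndLists m n A B) {Δ : ℕ} (hΔ : 0 < Δ) (N : ℕ) {o : List ℕ}
    (ho : IsSplit m X o) (hN : lpotential m n A B X r D o < 2 * Δ ^ 2 * (N + 1)) :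
    IsSplit m X ((sweep (List.range m) A B X r D Δ)^[N] o) ∧
      ∀ e < m, Stuck m A B X r D Δ ((sweep (List.range m) A B X r D Δ)^[N] o) e := by
  have hpos : 0 < 2 * Δ ^ 2 := by positivity
  induction N generalizing o with
  | zero =>
    refine ⟨ho, ?_⟩
    rcases (sweep_spec (r := r) (D := D) (Δ := Δ) hAB ho).2 with h | h
    · exact h.1
    · have := h.2; omega
  | succ N ih =>
    obtain ⟨h1, h2⟩ := sweep_spec (r := r) (D := D) (Δ := Δ) hAB ho
    rw [Function.iterate_succ_apply]
    rcases h2 with ⟨h2, h3⟩ | ⟨-, h2⟩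
    · have hst : ∀ N, IsSplit m X ((sweep (List.range m) A B X r D Δ)^[N] o) ∧
          ∀ e < m, Stuck m A B X r D Δ ((sweep (List.range m) A B X r D Δ)^[N] o) e := by
        intro N
        induction N with
        | zero => exact ⟨ho, h2⟩
        | succ N ih =>
          obtain ⟨h4, h5⟩ := ih
          obtain ⟨h6, h7⟩ := sweep_spec (r := r) (D := D) (Δ := Δ) hAB h4
          rw [Function.iterate_succ_apply']
          refine ⟨h6, ?_⟩
          rcases h7 with ⟨h7, h8⟩ | h7
          · exact fun e he => (h7 e he).congr (fun i hi => (h8 i hi).symm) he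
          · exact absurd h5 h7.1
      rw [← Function.iterate_succ_apply]
      exact hst _
    · refine ih h1 ?_
      have : 2 * Δ ^ 2 * (N + 1 + 1) = 2 * Δ ^ 2 * (N + 1) + 2 * Δ ^ 2 := by ring
      omega

end Algorithm


/-! ### Correctness of the scaling method and of the membership test -/

section Membership

variable {m n : ℕ} {A B X : List ℕ} {r D : ℕ}

theorem IsSplit.balance (hAB : EndLists m n A B) {q : List ℕ} {Δ : ℕ} {o : List ℕ}
    (ho : IsSplit m X o) : IsSplit m X (balance q (List.range m) A B X r D Δ o) := by
  rw [balance_eq]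
  generalize q.length * (q.length * q.length) = N
  induction N with
  | zero => exact ho
  | succ N ih =>
    rw [Function.iterate_succ_apply']
    exact (sweep_spec hAB ih).1

theorem IsSplit.distribute (hAB : EndLists m n A B) {q : List ℕ} :
    IsSplit m X (distribute q (List.range m) A B X r D) := by
  unfold PrizeCollecting.distribute
  generalize powers (X.sum + D) = l
  have h0 : IsSplit m X ((List.range m).map fun _ => 0) := fun e he => by
    rw [getD_map_range _ he]; exact Nat.zero_le _
  generalize ((List.range m).map fun _ => 0) = o at h0
  induction l generalizing o with
  | nil => exact h0
  | cons Δ l ih => exact ih _ (h0.balance hAB)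

/-- With excesses at most `2 * q.length * Δ`, the potential is at most `4 * n * (q.length * Δ) ^ 2`.
Since `2 * n ≤ q.length`, this is at most `2 * Δ ^ 2 * q.length ^ 3`, which is why the cube of the
length of `q` suffices as the number of sweeps. -/
theorem load_balance_le (hAB : EndLists m n A B) {q : List ℕ} (hq : q.length = m + 2 * n)
    (hX : Distributable m n (fun e => A.getD e 0) (fun e => B.getD e 0) (fun e => X.getD e 0) r D)
    {Δ : ℕ} (hΔ : 0 < Δ) {o : List ℕ} (ho : IsSplit m X o)
    (hload : ∀ v < n, load (List.range m) A B X r D o v ≤ D + q.length * (2 * Δ)) {v : ℕ}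
    (hv : v < n) : load (List.range m) A B X r D (balance q (List.range m) A B X r D Δ o) v ≤
      D + q.length * Δ := by
  have hpot : lpotential m n A B X r D o <
      2 * Δ ^ 2 * (q.length * (q.length * q.length) + 1) := by
    have h1 : lpotential m n A B X r D o ≤ n * (q.length * (2 * Δ)) ^ 2 := by
      unfold lpotential potential
      rw [← smul_eq_mul]
      refine (Finset.sum_le_card_nsmul _ _ _ fun v hv => ?_).trans (by rw [Finset.card_range])
      have := hload v (Finset.mem_range.1 hv)
      rw [load_eq] at this
      exact Nat.pow_le_pow_left (by omega) 2
    have h2 : (2 * n) * (2 * (Δ * q.length) ^ 2) ≤ q.length * (2 * (Δ * q.length) ^ 2) :=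
      Nat.mul_le_mul_right _ (by omega)
    have h3 : 0 < 2 * Δ ^ 2 := by positivity
    calc _ ≤ n * (q.length * (2 * Δ)) ^ 2 := h1
      _ = (2 * n) * (2 * (Δ * q.length) ^ 2) := by ring
      _ ≤ q.length * (2 * (Δ * q.length) ^ 2) := h2
      _ < q.length * (2 * (Δ * q.length) ^ 2) + 2 * Δ ^ 2 := by omega
      _ = _ := by ring
  obtain ⟨h1, h2⟩ := iterate_sweep_spec hAB hΔ _ ho hpot
  rw [balance_eq, load_eq, hq]
  rw [hq] at h1 h2
  exact Balanced.vload_le hAB.left_lt hAB.right_lt h1 hX h2 hv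

/-- Each phase halves the error bound `q.length * 2 ^ s`, and the error `q.length` remains after the
phase with amount one. -/
theorem load_distribute_le (hAB : EndLists m n A B) {q : List ℕ} (hq : q.length = m + 2 * n)
    (hX : Distributable m n (fun e => A.getD e 0) (fun e => B.getD e 0) (fun e => X.getD e 0) r D)
    (hsum : ∑ e ∈ Finset.range m, X.getD e 0 ≤ X.sum) {v : ℕ} (hv : v < n) :
    load (List.range m) A B X r D (distribute q (List.range m) A B X r D) v ≤ D + q.length := by
  have key : ∀ s (o : List ℕ), IsSplit m X o →
      (∀ v < n, load (List.range m) A B X r D o v ≤ D + q.length * 2 ^ s) →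
      ∀ v < n, load (List.range m) A B X r D
        ((((List.range s).map (2 ^ ·)).reverse).foldl
          (fun o Δ => balance q (List.range m) A B X r D Δ o) o) v ≤ D + q.length := by
    intro s
    induction s with
    | zero => intro o _ h; simpa using h
    | succ s ih =>
      intro o ho h
      rw [List.range_succ, List.map_append, List.reverse_append]
      refine ih _ (ho.balance hAB) fun v hv => ?_
      exact load_balance_le hAB hq hX (by positivity) ho
        (fun v hv => (h v hv).trans (by rw [pow_succ, mul_comm (2 ^ s)])) hv
  refine key _ _ (fun e he => ?_) (fun v _ => ?_) v hv
  · rw [getD_map_range _ he]; exact Nat.zero_le _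
  have h1 : load (List.range m) A B X r D ((List.range m).map fun _ => 0) v ≤ X.sum + D := by
    rw [load_eq, vload]
    refine Nat.add_le_add (le_trans (Finset.sum_le_sum fun e he => ?_) hsum)
      (by split_ifs <;> omega)
    rw [getD_map_range _ (Finset.mem_range.1 he)]
    split_ifs <;> omega
  -- Before the first phase no load exceeds `X.sum + D`, and `q` is nonempty because there is a
  -- vertex `v < n`.
  have h2 := Nat.lt_size_self (X.sum + D)
  have h3 : 1 ≤ q.length := by omega
  have h4 := Nat.mul_le_mul_right (2 ^ (X.sum + D).size) h3
  omega

/-- However the values are split, edges inside `R` deposit all of their value in `R`, so a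
sufficiently violated set exposes a load above the threshold. -/
theorem not_fits_of_lt (hAB : EndLists m n A B) {q : List ℕ} {R : Finset ℕ}
    (hR : R ⊆ Finset.range n) (h : (D + q.length) * R.card <
      (∑ e ∈ Finset.range m, if A.getD e 0 ∈ R ∧ B.getD e 0 ∈ R then X.getD e 0 else 0) +
        if r ∈ R then D else 0) : fits q (List.range n) (List.range m) A B X D r = false := by
  rw [← Bool.not_eq_true]
  intro hf
  simp only [fits, List.all_eq_true, List.mem_range, decide_eq_true_eq] at hf
  have h1 := Finset.sum_le_card_nsmul R (vload m (fun e => A.getD e 0) (fun e => B.getD e 0)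
    (fun e => X.getD e 0) r D fun e => (distribute q (List.range m) A B X r D).getD e 0)
    (D + q.length) fun v hv => hf v (Finset.mem_range.1 (hR hv))
  rw [sum_vload, smul_eq_mul, mul_comm] at h1
  refine absurd h (not_lt.2 (le_trans (Nat.add_le_add_right ?_ _) h1))
  refine Finset.sum_le_sum fun e he => ?_
  have := IsSplit.distribute (X := X) (r := r) (D := D) hAB (q := q) e (Finset.mem_range.1 he)
  by_cases h1 : A.getD e 0 ∈ R <;> by_cases h2 : B.getD e 0 ∈ R
  · rw [if_pos ⟨h1, h2⟩, if_pos h1, if_pos h2]; omega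
  all_goals simp only [h1, h2, and_false, false_and, if_false]; exact Nat.zero_le _

/-- The extra load `D` at `r` replaces `R.card` by `R.card - 1` for the sets containing `r`, and `r`
runs through all vertices. The distribution is only approximate, with an error of `K` per vertex,
hence the scaling by `n * K + 1`. -/
theorem inPolytope_iff (hAB : EndLists m n A B) (x : List ℕ) :
    inPolytope (List.range n) (List.range m) A B D x = true ↔
      ∀ R ⊆ Finset.range n, R.Nonempty →
        (∑ e ∈ Finset.range m, if A.getD e 0 ∈ R ∧ B.getD e 0 ∈ R then x.getD e 0 else 0) + D ≤
          D * R.card := by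
  set K := ((List.range m) ++ ((List.range n) ++ (List.range n))).length with hK
  have hK' : K = m + 2 * n := by simp [hK]; ring
  have hval : ∀ e ∈ Finset.range m,
      ((List.range m).map fun e => (n * K + 1) * x.getD e 0).getD e 0 =
        (n * K + 1) * x.getD e 0 := fun e he => getD_map_range _ (Finset.mem_range.1 he)
  have hsum : ∀ R : Finset ℕ, (∑ e ∈ Finset.range m, if A.getD e 0 ∈ R ∧ B.getD e 0 ∈ R then
      ((List.range m).map fun e => (n * K + 1) * x.getD e 0).getD e 0 else 0) = (n * K + 1) *
      ∑ e ∈ Finset.range m, if A.getD e 0 ∈ R ∧ B.getD e 0 ∈ R then x.getD e 0 else 0 := by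
    intro R
    rw [Finset.mul_sum]
    exact Finset.sum_congr rfl fun e he => by rw [hval e he]; split_ifs <;> simp
  simp only [inPolytope, List.all_eq_true, List.mem_range, List.length_range, ← hK]
  constructor
  · intro h R hR hne
    by_contra! hcon
    obtain ⟨r, hr⟩ := hne
    have hf := h r (Finset.mem_range.1 (hR hr))
    rw [not_fits_of_lt hAB hR] at hf
    · exact Bool.noConfusion hf
    rw [hsum, if_pos hr, ← hK, ← mul_add]
    have h1 : R.card ≤ n := by simpa using Finset.card_le_card hR
    -- A violation of an inequality between integers is at least one, hence at least `n * K + 1`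
    -- after scaling, more than the total error `K * R.card`.
    have h2 := Nat.mul_le_mul_left (n * K + 1) (Nat.succ_le_of_lt hcon)
    have h3 := Nat.mul_le_mul_left K h1
    nlinarith
  · intro h r hr
    simp only [fits, List.all_eq_true, List.mem_range, decide_eq_true_eq]
    intro v hv
    refine load_distribute_le hAB hK' (fun R hR hne => ?_) ?_ hv
    · rw [hsum]
      have h1 := Nat.mul_le_mul_left (n * K + 1) (h R hR hne)
      have h2 : (if r ∈ R then (n * K + 1) * D else 0) ≤ (n * K + 1) * D := by
        split_ifs <;> omega
      rw [mul_assoc]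
      linarith
    · rw [Finset.sum_congr rfl hval]
      exact le_of_eq rfl

end Membership


/-! # Pipage rounding of integer vectors -/

section RoundingAlgorithm

/-- Move the value `Δ` from `f` to `e`. -/
def transfer (er : List ℕ) (x : List ℕ) (e f Δ : ℕ) : List ℕ :=
  er.map fun i => if i = e then x.getD i 0 + Δ else if i = f then x.getD i 0 - Δ else x.getD i 0

/-- Move the value `Δ` from `f` to `e` if this is feasible. -/
def tryTransfer (vr er A B : List ℕ) (D e f : ℕ) (x : List ℕ) (Δ : ℕ) : List ℕ :=
  bif decide (Δ ≤ x.getD f 0) && (decide (x.getD e 0 + Δ ≤ D) &&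
      inPolytope vr er A B D (transfer er x e f Δ)) then
    transfer er x e f Δ
  else x

/-- Move as much value as possible from `f` to `e`. -/
def push (vr er A B : List ℕ) (D e f : ℕ) (x : List ℕ) : List ℕ :=
  (powers D).foldl (tryTransfer vr er A B D e f) x

/-- If value can be moved between `i` and `j` in both directions, move as much as possible in a
direction in which the value of `G` does not increase. -/
def pipageStep (G : List ℕ → ℕ) (vr er A B : List ℕ) (D i j : ℕ) (x : List ℕ) : List ℕ :=
  bif decide (i = j) || (decide ((push vr er A B D i j x).getD i 0 = x.getD i 0) ||
      decide ((push vr er A B D j i x).getD j 0 = x.getD j 0)) then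
    x
  else bif decide (G (push vr er A B D i j x) ≤ G x) then
    push vr er A B D i j x
  else push vr er A B D j i x

/-- Move value between `i` and all other elements. -/
def pipageRow (G : List ℕ → ℕ) (vr er A B : List ℕ) (D : ℕ) (x : List ℕ) (i : ℕ) : List ℕ :=
  er.foldl (fun x j => pipageStep G vr er A B D i j x) x

/-- Pipage rounding. -/
def pipage (G : List ℕ → ℕ) (vr er A B : List ℕ) (D : ℕ) (x : List ℕ) : List ℕ :=
  er.foldl (pipageRow G vr er A B D) x

end RoundingAlgorithm

/-! ### Correctness of integer pipage rounding -/

section RoundingCorrect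

set_option linter.unusedSectionVars false

variable {κ : Type*} [Fintype κ] [DecidableEq κ] {m n : ℕ} {A B : List ℕ} {D : ℕ}

/-- The point with coordinates `x / D`. -/
noncomputable def scaled (ε : κ ≃ Fin m) (D : ℕ) (x : List ℕ) (k : κ) : ℝ :=
  (x.getD (ε k) 0 : ℝ) / D

/-- The lists `A` and `B` contain the endpoints of the edges. -/
structure Represents (ε : κ ≃ Fin m) (ends : κ → Finset (Fin n)) (A B : List ℕ) : Prop where
  endLists : EndLists m n A B
  mem_ends : ∀ k v, v ∈ ends k ↔ (v : ℕ) = A.getD (ε k) 0 ∨ (v : ℕ) = B.getD (ε k) 0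

variable {ε : κ ≃ Fin m} {ends : κ → Finset (Fin n)}

theorem sum_range_eq_sum (ε : κ ≃ Fin m) {M : Type*} [AddCommMonoid M] (g : ℕ → M) :
    ∑ e ∈ Finset.range m, g e = ∑ k, g (ε k) := by
  rw [Finset.sum_range, ← Equiv.sum_comp ε]

theorem Represents.subset_iff (h : Represents ε ends A B) (k : κ) (S : Finset (Fin n)) :
    ends k ⊆ S ↔ A.getD (ε k) 0 ∈ S.map Fin.valEmbedding ∧
      B.getD (ε k) 0 ∈ S.map Fin.valEmbedding := by
  have hmem : ∀ u : ℕ, u < n → (u ∈ S.map Fin.valEmbedding ↔ ∀ v : Fin n, v = u → v ∈ S) := by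
    intro u hu
    simp only [Finset.mem_map, Fin.valEmbedding_apply]
    constructor
    · rintro ⟨w, hw, rfl⟩ v hv
      rwa [Fin.ext hv]
    · exact fun h => ⟨⟨u, hu⟩, h _ rfl, rfl⟩
  rw [hmem _ (h.endLists.left_lt _ (ε k).2), hmem _ (h.endLists.right_lt _ (ε k).2)]
  constructor
  · exact fun hs => ⟨fun v hv => hs ((h.mem_ends k v).2 (.inl hv)),
      fun v hv => hs ((h.mem_ends k v).2 (.inr hv))⟩
  · rintro ⟨h1, h2⟩ v hv
    rcases (h.mem_ends k v).1 hv with hv | hv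
    exacts [h1 v hv, h2 v hv]

theorem Represents.card_ends (h : Represents ε ends A B) (k : κ) : (ends k).card = 2 := by
  rw [Finset.card_eq_two]
  refine ⟨⟨_, h.endLists.left_lt _ (ε k).2⟩, ⟨_, h.endLists.right_lt _ (ε k).2⟩, fun hc =>
    h.endLists.ne _ (ε k).2 (congrArg Fin.val hc), ?_⟩
  ext v
  rw [h.mem_ends k v]
  simp [Fin.ext_iff]

theorem Represents.inside_eq (h : Represents ε ends A B) (x : List ℕ) (S : Finset (Fin n)) :
    inside ends (scaled ε D x) S = ((∑ e ∈ Finset.range m, if A.getD e 0 ∈ S.map Fin.valEmbedding ∧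
      B.getD e 0 ∈ S.map Fin.valEmbedding then x.getD e 0 else 0 : ℕ) : ℝ) / D := by
  rw [sum_range_eq_sum ε, inside, Finset.sum_filter, Nat.cast_sum, Finset.sum_div]
  refine Finset.sum_congr rfl fun k _ => ?_
  simp only [← h.subset_iff k S]
  split_ifs <;> simp [scaled]

theorem Represents.inPolytope_iff (h : Represents ε ends A B) (hD : 0 < D) (x : List ℕ) :
    inPolytope (List.range n) (List.range m) A B D x = true ↔
      ∀ S : Finset (Fin n), S.Nonempty → inside ends (scaled ε D x) S ≤ S.card - 1 := by
  have hD' : (0 : ℝ) < D := by exact_mod_cast hD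
  rw [PrizeCollecting.inPolytope_iff h.endLists]
  have key : ∀ S : Finset (Fin n), inside ends (scaled ε D x) S ≤ S.card - 1 ↔
      (∑ e ∈ Finset.range m, if A.getD e 0 ∈ S.map Fin.valEmbedding ∧
        B.getD e 0 ∈ S.map Fin.valEmbedding then x.getD e 0 else 0) + D ≤
        D * (S.map Fin.valEmbedding).card := by
    intro S
    rw [h.inside_eq, div_le_iff₀ hD', Finset.card_map, ← Nat.cast_le (α := ℝ)]
    push_cast
    constructor <;> intro h <;> linarith
  simp only [key]
  constructor
  · refine fun h S hS => h _ (fun v hv => ?_) (hS.map (f := Fin.valEmbedding))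
    obtain ⟨w, -, rfl⟩ := Finset.mem_map.1 hv
    exact Finset.mem_range.2 w.2
  · intro h R hR hne
    have hRS : R = (R.attachFin fun v hv => Finset.mem_range.1 (hR hv)).map Fin.valEmbedding := by
      ext v
      simp only [Finset.mem_map, Finset.mem_attachFin, Fin.valEmbedding_apply]
      exact ⟨fun hv => ⟨⟨v, Finset.mem_range.1 (hR hv)⟩, hv, rfl⟩, by rintro ⟨w, hw, rfl⟩; exact hw⟩
    rw [hRS] at hne ⊢
    exact h _ (Finset.map_nonempty.1 hne)

variable {U : Finset (Fin n)} {x : List ℕ}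

theorem TreePolytope.getD_le (h : Represents ε ends A B) (hD : 0 < D)
    (hx : TreePolytope U ends (scaled ε D x)) (k : κ) : x.getD (ε k) 0 ≤ D := by
  have hD' : (0 : ℝ) < D := by exact_mod_cast hD
  have := hx.le_one h.card_ends k
  rw [scaled, div_le_one hD'] at this
  exact_mod_cast this

theorem scaled_transfer {e f : κ} (hef : e ≠ f) {Δ : ℕ} (hΔ : Δ ≤ x.getD (ε f) 0) :
    scaled ε D (transfer (List.range m) x (ε e) (ε f) Δ) =
      shift (scaled ε D x) e f ((Δ : ℝ) / D) := by
  funext k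
  unfold scaled shift transfer
  rw [getD_map_range _ (ε k).2]
  have h1 : ∀ k' : κ, ((ε k : ℕ) = ε k') ↔ k = k' := fun k' => by
    rw [← Fin.ext_iff, ε.injective.eq_iff]
  simp only [h1]
  by_cases hke : k = e
  · subst hke; simp [hef]; ring
  by_cases hkf : k = f
  · subst hkf; rw [if_neg hke, if_pos rfl, if_neg hke, if_pos rfl, Nat.cast_sub hΔ]; ring
  · simp [hke, hkf]

theorem le_getD_of_treePolytope_shift (hD : 0 < D) {e f : κ} (hef : e ≠ f) {Δ : ℕ}
    (h : TreePolytope U ends (shift (scaled ε D x) e f ((Δ : ℝ) / D))) : Δ ≤ x.getD (ε f) 0 := by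
  have hD' : (0 : ℝ) < D := by exact_mod_cast hD
  have := h.nonneg f
  simp only [shift, hef.symm, if_false, if_true, scaled, add_zero, ← sub_div] at this
  rw [le_div_iff₀ hD', zero_mul, sub_nonneg] at this
  exact_mod_cast this

theorem tryTransfer_spec (h : Represents ε ends A B) (hD : 0 < D)
    (hx : TreePolytope U ends (scaled ε D x)) {e f : κ} (hef : e ≠ f) (Δ : ℕ) :
    (TreePolytope U ends (shift (scaled ε D x) e f ((Δ : ℝ) / D)) ∧
      scaled ε D (tryTransfer (List.range n) (List.range m) A B D (ε e) (ε f) x Δ) =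
        shift (scaled ε D x) e f ((Δ : ℝ) / D)) ∨
    (¬ TreePolytope U ends (shift (scaled ε D x) e f ((Δ : ℝ) / D)) ∧
      tryTransfer (List.range n) (List.range m) A B D (ε e) (ε f) x Δ = x) := by
  by_cases hP : TreePolytope U ends (shift (scaled ε D x) e f ((Δ : ℝ) / D))
  · have h1 := le_getD_of_treePolytope_shift hD hef hP
    have h2 := scaled_transfer (D := D) hef h1
    have h3 : inPolytope (List.range n) (List.range m) A B D
        (transfer (List.range m) x (ε e) (ε f) Δ) = true := by
      rw [h.inPolytope_iff hD, h2]
      exact hP.le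
    -- For points of the polytope this test is implied by membership. Its purpose is to bound the
    -- entries for arbitrary inputs in the running time analysis.
    have h4 : x.getD (ε e) 0 + Δ ≤ D := by
      rw [← h2] at hP
      have := hP.getD_le h hD e
      rw [transfer, getD_map_range _ (ε e).2, if_pos rfl] at this
      exact this
    refine .inl ⟨hP, ?_⟩
    rw [tryTransfer, decide_eq_true h1, decide_eq_true h4, h3]
    exact h2
  · refine .inr ⟨hP, ?_⟩
    unfold tryTransfer
    by_cases h1 : Δ ≤ x.getD (ε f) 0
    · have h2 := scaled_transfer (D := D) (ε := ε) hef h1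
      have h3 : inPolytope (List.range n) (List.range m) A B D
          (transfer (List.range m) x (ε e) (ε f) Δ) = false := by
        rw [← Bool.not_eq_true]
        intro h3
        rw [h.inPolytope_iff hD, h2] at h3
        refine hP ⟨fun k => ?_, h3, by rw [sum_shift, hx.total]⟩
        rw [← h2]
        exact div_nonneg (Nat.cast_nonneg _) (Nat.cast_nonneg _)
      rw [h3, Bool.and_false, Bool.and_false]; rfl
    · rw [decide_eq_false h1]; rfl

/-- Binary search: the shift by `t / D` stays feasible and the shift by `(t + 2 ^ s) / D` stays
infeasible while `s` decreases to zero. -/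
theorem push_spec (h : Represents ε ends A B) (hD : 0 < D)
    (hx : TreePolytope U ends (scaled ε D x)) {e f : κ} (hef : e ≠ f) :
    ∃ t : ℕ, scaled ε D (push (List.range n) (List.range m) A B D (ε e) (ε f) x) =
        shift (scaled ε D x) e f ((t : ℝ) / D) ∧
      TreePolytope U ends (shift (scaled ε D x) e f ((t : ℝ) / D)) ∧
      ¬ TreePolytope U ends (shift (scaled ε D x) e f (((t : ℝ) + 1) / D)) := by
  have key : ∀ s (y : List ℕ) (t : ℕ), scaled ε D y = shift (scaled ε D x) e f ((t : ℝ) / D) →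
      TreePolytope U ends (shift (scaled ε D x) e f ((t : ℝ) / D)) →
      ¬ TreePolytope U ends (shift (scaled ε D x) e f (((t : ℝ) + 2 ^ s) / D)) →
      ∃ t : ℕ, scaled ε D ((((List.range s).map (2 ^ ·)).reverse).foldl
          (tryTransfer (List.range n) (List.range m) A B D (ε e) (ε f)) y) =
          shift (scaled ε D x) e f ((t : ℝ) / D) ∧
        TreePolytope U ends (shift (scaled ε D x) e f ((t : ℝ) / D)) ∧
        ¬ TreePolytope U ends (shift (scaled ε D x) e f (((t : ℝ) + 1) / D)) := by
    intro s
    induction s with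
    | zero => intro y t h1 h2 h3; exact ⟨t, h1, h2, by simpa using h3⟩
    | succ s ih =>
      intro y t h1 h2 h3
      rw [List.range_succ, List.map_append, List.reverse_append]
      have h4 := tryTransfer_spec h hD (h1 ▸ h2) hef (2 ^ s)
      rw [h1, shift_shift, ← add_div] at h4
      rcases h4 with ⟨h4, h5⟩ | ⟨h4, h5⟩
      · refine ih _ (t + 2 ^ s) ?_ ?_ ?_
        · rw [h5]; push_cast; rfl
        · push_cast at h4 ⊢; exact h4
        · rw [pow_succ, mul_two, ← add_assoc] at h3
          push_cast; exact h3
      · refine ih _ t ?_ h2 ?_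
        · rw [h5, h1]
        · push_cast at h4; exact h4
  refine key (Nat.size D) x 0 ?_ ?_ ?_
  · simp [shift_zero]
  · simpa [shift_zero] using hx
  -- The search starts from an infeasible shift because `2 ^ Nat.size D` exceeds `D`, hence exceeds
  -- the value of `f`.
  · intro hc
    have h1 : TreePolytope U ends (shift (scaled ε D x) e f (((2 ^ Nat.size D : ℕ) : ℝ) / D)) := by
      simpa using hc
    have h2 := le_getD_of_treePolytope_shift hD hef h1
    have h3 := hx.getD_le h hD f
    have h4 := Nat.lt_size_self D
    omega

/-- By integrality, if a positive amount can be moved, then `1 / D` can be moved. -/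
theorem treePolytope_shift_one_div (h : Represents ε ends A B) (hD : 0 < D)
    (hx : TreePolytope U ends (scaled ε D x)) {e f : κ} {t : ℝ} (ht : 0 < t)
    (hP : TreePolytope U ends (shift (scaled ε D x) e f t)) (hef : e ≠ f) :
    TreePolytope U ends (shift (scaled ε D x) e f (1 / D)) := by
  have hD' : (0 : ℝ) < D := by exact_mod_cast hD
  have hinv : (0 : ℝ) < 1 / D := by positivity
  refine ⟨fun k => ?_, fun S hS => ?_, by rw [sum_shift, hx.total]⟩
  · have h1 := hx.nonneg k
    by_cases hk : k = f
    · subst hk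
      have h2 := hP.nonneg k
      simp only [shift, hef.symm, if_false, if_true, add_zero, scaled] at h2 ⊢
      have h3 : (0 : ℝ) < x.getD (ε k) 0 := by
        have : (0 : ℝ) < x.getD (ε k) 0 / D := by linarith
        rwa [lt_div_iff₀ hD', zero_mul] at this
      have h4 : (1 : ℝ) ≤ x.getD (ε k) 0 := by
        exact_mod_cast (show 0 < x.getD (ε k) 0 by exact_mod_cast h3)
      rw [← sub_div]
      exact div_nonneg (by linarith) hD'.le
    · simp only [shift, hk, if_false, sub_zero]
      split_ifs <;> linarith
  · have h1 := hx.le S hS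
    have h2 := hP.le S hS
    rw [inside_shift] at h2 ⊢
    by_cases he : ends e ⊆ S <;> by_cases hf : ends f ⊆ S <;> simp only [he, hf, if_true, if_false]
      at h2 ⊢
    · linarith
    -- Only a set containing `e` but not `f` becomes fuller. It has positive slack, and `N` and `D *
    -- (S.card - 1)` are integers, so the slack is at least one unit `1 / D`.
    · rw [h.inside_eq] at h2 ⊢
      set N := ∑ e ∈ Finset.range m, if A.getD e 0 ∈ S.map Fin.valEmbedding ∧
        B.getD e 0 ∈ S.map Fin.valEmbedding then x.getD e 0 else 0
      have h3 : (N : ℝ) < ((D * (S.card - 1) : ℤ) : ℝ) := by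
        have : (N : ℝ) / D < S.card - 1 := by linarith
        rw [div_lt_iff₀ hD'] at this
        push_cast
        linarith
      have h4 : (N : ℤ) + 1 ≤ D * (S.card - 1) := by exact_mod_cast h3
      have h5 : (N : ℝ) + 1 ≤ D * (S.card - 1) := by exact_mod_cast h4
      rw [sub_zero, ← add_div, div_le_iff₀ hD']
      linarith
    · linarith
    · linarith

theorem not_movable_of_not_shift_one_div (h : Represents ε ends A B) (hD : 0 < D)
    (hx : TreePolytope U ends (scaled ε D x)) {e f : κ} (hef : e ≠ f)
    (hP : ¬ TreePolytope U ends (shift (scaled ε D x) e f (1 / D))) :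
    ¬ Movable U ends (scaled ε D x) e f := by
  rintro ⟨t, ht, h1, -⟩
  exact hP (treePolytope_shift_one_div h hD hx ht h1 hef)

/-- The point `y` is feasible and not worse than `x`, and has no new movable pairs. -/
def Improves (U : Finset (Fin n)) (ends : κ → Finset (Fin n)) (F : (κ → ℝ) → ℝ) (x y : κ → ℝ) :
    Prop :=
  TreePolytope U ends x → TreePolytope U ends y ∧ F y ≤ F x ∧
    ∀ g h, Movable U ends y g h → Movable U ends x g h

theorem Improves.refl (F : (κ → ℝ) → ℝ) (x : κ → ℝ) : Improves U ends F x x :=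
  fun hx => ⟨hx, le_rfl, fun _ _ h => h⟩

theorem Improves.trans {F : (κ → ℝ) → ℝ} {x y z : κ → ℝ} (h1 : Improves U ends F x y)
    (h2 : Improves U ends F y z) : Improves U ends F x z := by
  intro hx
  obtain ⟨a, b, c⟩ := h1 hx
  obtain ⟨d, e, f⟩ := h2 a
  exact ⟨d, e.trans b, fun g h hm => c g h (f g h hm)⟩

/-- `G` compares points in the same way as the function `F`. -/
def Compares (ε : κ ≃ Fin m) (D : ℕ) (F : (κ → ℝ) → ℝ) (G : List ℕ → ℕ) : Prop :=
  ∀ x y : List ℕ, (∀ k, x.getD (ε k) 0 ≤ D) → (∀ k, y.getD (ε k) 0 ≤ D) →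
    (G x ≤ G y ↔ F (scaled ε D x) ≤ F (scaled ε D y))

/-- If a push achieves nothing, the pair is immovable already. Otherwise the push in the opposite
direction provides the feasible point behind `x` that `Movable.of_shift` needs, and maximality makes
the pair immovable. If the first push increases `F`, concavity ensures that the second one does not.
-/
theorem pipageStep_spec (h : Represents ε ends A B) (hD : 0 < D) {F : (κ → ℝ) → ℝ}
    {G : List ℕ → ℕ} (hF : PairConcave U ends F) (hG : Compares ε D F G)
    (hx : TreePolytope U ends (scaled ε D x)) (e f : κ) :
    Improves U ends F (scaled ε D x)
      (scaled ε D (pipageStep G (List.range n) (List.range m) A B D (ε e) (ε f) x)) ∧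
    (e ≠ f → ¬ Movable U ends
      (scaled ε D (pipageStep G (List.range n) (List.range m) A B D (ε e) (ε f) x)) e f) := by
  have hD' : (0 : ℝ) < D := by exact_mod_cast hD
  by_cases hef : e = f
  · have : pipageStep G (List.range n) (List.range m) A B D (ε e) (ε f) x = x := by
      rw [pipageStep, hef, decide_eq_true rfl]; rfl
    rw [this]
    exact ⟨.refl _ _, fun h => absurd hef h⟩
  have hεef : ¬ (ε e : ℕ) = ε f := by rwa [← Fin.ext_iff, ε.injective.eq_iff]
  obtain ⟨t, ht1, ht2, ht3⟩ := push_spec h hD hx hef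
  obtain ⟨s, hs1, hs2, hs3⟩ := push_spec h hD hx (Ne.symm hef)
  have hval : ∀ {e f : κ} {t : ℕ}, e ≠ f →
      scaled ε D (push (List.range n) (List.range m) A B D (ε e) (ε f) x) =
        shift (scaled ε D x) e f ((t : ℝ) / D) →
      (push (List.range n) (List.range m) A B D (ε e) (ε f) x).getD (ε e) 0 =
        x.getD (ε e) 0 + t := by
    intro e f t hef ht
    have := congrFun ht e
    simp only [scaled, shift, hef, if_true, if_false, sub_zero, ← add_div] at this
    rw [div_left_inj' hD'.ne'] at this
    exact_mod_cast this
  have hvt := hval hef ht1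
  have hvs := hval (Ne.symm hef) hs1
  set p := push (List.range n) (List.range m) A B D (ε e) (ε f) x with hp
  set q := push (List.range n) (List.range m) A B D (ε f) (ε e) x with hq
  have hstep : pipageStep G (List.range n) (List.range m) A B D (ε e) (ε f) x =
      bif decide (p.getD (ε e) 0 = x.getD (ε e) 0) || decide (q.getD (ε f) 0 = x.getD (ε f) 0) then x
      else bif decide (G p ≤ G x) then p else q := by
    rw [pipageStep, decide_eq_false hεef, Bool.false_or]
  by_cases ht0 : t = 0
  · rw [hstep, decide_eq_true (by omega), Bool.true_or]
    refine ⟨.refl _ _, fun _ => not_movable_of_not_shift_one_div h hD hx hef ?_⟩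
    simpa [ht0] using ht3
  by_cases hs0 : s = 0
  · rw [hstep, decide_eq_true (show q.getD (ε f) 0 = x.getD (ε f) 0 by omega), Bool.or_true]
    refine ⟨.refl _ _, fun _ hm => not_movable_of_not_shift_one_div h hD hx (Ne.symm hef) ?_ hm.symm⟩
    simpa [hs0] using hs3
  have hne1 : decide (p.getD (ε e) 0 = x.getD (ε e) 0) = false := decide_eq_false (by omega)
  have hne2 : decide (q.getD (ε f) 0 = x.getD (ε f) 0) = false := decide_eq_false (by omega)
  have htp : 0 < (t : ℝ) / D := div_pos (by exact_mod_cast Nat.pos_of_ne_zero ht0) hD'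
  have hsp : 0 < (s : ℝ) / D := div_pos (by exact_mod_cast Nat.pos_of_ne_zero hs0) hD'
  have hpP : TreePolytope U ends (scaled ε D p) := ht1 ▸ ht2
  have hqP : TreePolytope U ends (scaled ε D q) := hs1 ▸ hs2
  have hGp := hG p x (hpP.getD_le h hD) (hx.getD_le h hD)
  by_cases hFp : F (scaled ε D p) ≤ F (scaled ε D x)
  · have hy : pipageStep G (List.range n) (List.range m) A B D (ε e) (ε f) x = p := by
      rw [hstep, hne1, hne2, decide_eq_true (hGp.2 hFp)]; rfl
    rw [hy]
    refine ⟨fun _ => ⟨hpP, hFp, fun g g' hm => ?_⟩, fun _ =>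
      not_movable_of_not_shift_one_div h hD hpP hef ?_⟩
    · rw [ht1] at hm
      rw [shift_swap] at hs2
      exact hm.of_shift hsp htp.le hs2
    · rwa [ht1, shift_shift, ← add_div]
  · have hy : pipageStep G (List.range n) (List.range m) A B D (ε e) (ε f) x = q := by
      rw [hstep, hne1, hne2, decide_eq_false fun hc => hFp (hGp.1 hc)]; rfl
    rw [hy]
    have hFq : F (scaled ε D q) ≤ F (scaled ε D x) := by
      rcases hF.le_or_le hx hef hsp.le htp.le with h1 | h1
      · rw [← ht1] at h1; exact absurd h1 hFp
      · rwa [← shift_swap, ← hs1] at h1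
    refine ⟨fun _ => ⟨hqP, hFq, fun g g' hm => ?_⟩, fun _ hm =>
      not_movable_of_not_shift_one_div h hD hqP (Ne.symm hef) ?_ hm.symm⟩
    · rw [hs1] at hm
      rw [shift_swap] at ht2
      exact hm.of_shift htp hsp.le ht2
    · rwa [hs1, shift_shift, ← add_div]

/-- One pass suffices: what the step for `e` achieves is preserved by all later improvements. The
lemma serves both the loop over rows and the loop within a row. -/
theorem foldl_improves {F : (κ → ℝ) → ℝ} (φ : List ℕ → ℕ → List ℕ) (Q : κ → (κ → ℝ) → Prop)
    (h1 : ∀ e x, TreePolytope U ends (scaled ε D x) →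
      Improves U ends F (scaled ε D x) (scaled ε D (φ x (ε e))) ∧ Q e (scaled ε D (φ x (ε e))))
    (h2 : ∀ e x y, Q e x → Improves U ends F x y → TreePolytope U ends x → Q e y) (l : List ℕ)
    (hl : ∀ i ∈ l, i < m) (x : List ℕ) (hx : TreePolytope U ends (scaled ε D x)) :
    Improves U ends F (scaled ε D x) (scaled ε D (l.foldl φ x)) ∧
      ∀ e : κ, (ε e : ℕ) ∈ l → Q e (scaled ε D (l.foldl φ x)) := by
  induction l generalizing x with
  | nil => exact ⟨.refl _ _, by simp⟩
  | cons i l ih =>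
    obtain ⟨e, he⟩ : ∃ e, (ε e : ℕ) = i := ⟨ε.symm ⟨i, hl i (by simp)⟩, by simp⟩
    obtain ⟨h3, h4⟩ := h1 e x hx
    rw [he] at h3 h4
    obtain ⟨h5, h6⟩ := ih (fun i hi => hl i (by simp [hi])) (φ x i) (h3 hx).1
    rw [List.foldl_cons]
    refine ⟨h3.trans h5, fun e' he' => ?_⟩
    rcases List.mem_cons.1 he' with h7 | h7
    · have : e' = e := ε.injective (Fin.ext (h7.trans he.symm))
      rw [this]
      exact h2 e _ _ h4 h5 (h3 hx).1
    · exact h6 e' h7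

theorem pipageRow_spec (h : Represents ε ends A B) (hD : 0 < D) {F : (κ → ℝ) → ℝ}
    {G : List ℕ → ℕ} (hF : PairConcave U ends F) (hG : Compares ε D F G) (e : κ)
    (hx : TreePolytope U ends (scaled ε D x)) :
    Improves U ends F (scaled ε D x)
      (scaled ε D (pipageRow G (List.range n) (List.range m) A B D x (ε e))) ∧
    ∀ f : κ, e ≠ f → ¬ Movable U ends
      (scaled ε D (pipageRow G (List.range n) (List.range m) A B D x (ε e))) e f := by
  obtain ⟨h1, h2⟩ := foldl_improves
    (fun x j => pipageStep G (List.range n) (List.range m) A B D (ε e) j x)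
    (fun f x => e ≠ f → ¬ Movable U ends x e f)
    (fun f x hx => pipageStep_spec h hD hF hG hx e f)
    (fun f x y h1 h2 h3 hef hm => h1 hef ((h2 h3).2.2 e f hm))
    (List.range m) (fun i hi => List.mem_range.1 hi) x hx
  exact ⟨h1, fun f => h2 f (List.mem_range.2 (ε f).2)⟩

theorem pipage_spec (h : Represents ε ends A B) (hD : 0 < D) (hEU : ∀ k, ends k ⊆ U)
    {F : (κ → ℝ) → ℝ} {G : List ℕ → ℕ} (hF : PairConcave U ends F) (hG : Compares ε D F G)
    (hx : TreePolytope U ends (scaled ε D x)) :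
    TreePolytope U ends (scaled ε D (pipage G (List.range n) (List.range m) A B D x)) ∧
      (∀ k, scaled ε D (pipage G (List.range n) (List.range m) A B D x) k = 0 ∨
        scaled ε D (pipage G (List.range n) (List.range m) A B D x) k = 1) ∧
      F (scaled ε D (pipage G (List.range n) (List.range m) A B D x)) ≤ F (scaled ε D x) := by
  obtain ⟨h1, h2⟩ := foldl_improves
    (pipageRow G (List.range n) (List.range m) A B D)
    (fun e x => ∀ f : κ, e ≠ f → ¬ Movable U ends x e f)
    (fun e x hx => pipageRow_spec h hD hF hG e hx)
    (fun e x y h1 h2 h3 f hef hm => h1 f hef ((h2 h3).2.2 e f hm))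
    (List.range m) (fun i hi => List.mem_range.1 hi) x hx
  rw [← pipage] at h1 h2
  obtain ⟨h3, h4, -⟩ := h1 hx
  exact ⟨h3, fun k => h3.integral_of_not_movable h.card_ends hEU
    (fun e f hef => h2 e (List.mem_range.2 (ε e).2) f hef) k, h4⟩

end RoundingCorrect


/-! # The running time of the rounding algorithm -/

section Running

set_option linter.unusedSectionVars false

variable {α τ : Type*} [Enc α] [Enc τ]

/-- The list `l` has length at most `n` and entries at most `M`. -/
def Within (n M : ℕ) (l : List ℕ) : Prop := l.length ≤ n ∧ ∀ x ∈ l, x ≤ M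

theorem Within.getD_le {n M : ℕ} {l : List ℕ} (h : Within n M l) (i : ℕ) : l.getD i 0 ≤ M := by
  rcases lt_or_ge i l.length with hi | hi
  · rw [List.getD_eq_getElem _ _ hi]; exact h.2 _ (List.getElem_mem hi)
  · rw [List.getD_eq_default _ _ hi]; exact Nat.zero_le _

theorem within_sum (l : List ℕ) : Within (sz l) l.sum l :=
  ⟨(length_lt_sz l).le, fun _ hx => List.le_sum_of_mem hx⟩

theorem Within.mono {n M n' M' : ℕ} {l : List ℕ} (h : Within n M l) (hn : n ≤ n') (hM : M ≤ M') :
    Within n' M' l :=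
  ⟨h.1.trans hn, fun x hx => (h.2 x hx).trans hM⟩

theorem Within.map {n M : ℕ} {l : List ℕ} {f : ℕ → ℕ} (hl : sz l ≤ n) (hf : ∀ i ∈ l, f i ≤ M) :
    Within n M (l.map f) := by
  refine ⟨by rw [List.length_map]; exact (length_lt_sz l).le.trans hl, fun x hx => ?_⟩
  obtain ⟨i, hi, rfl⟩ := List.mem_map.1 hx
  exact hf i hi

theorem Within.foldl {n M : ℕ} {l : List τ} {f : List ℕ → τ → List ℕ} {s : List ℕ}
    (hs : Within n M s) (hf : ∀ s x, Within n M s → Within n M (f s x)) :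
    Within n M (l.foldl f s) := by
  induction l generalizing s with
  | nil => exact hs
  | cons x l ih => exact ih (hf s x hs)

/-- The entries may be exponentially large. A list has polynomial size as soon as its length and the
bit length of the bound `M` are polynomial. -/
theorem PT.foldl_within {l : α → List τ} {s : α → List ℕ} {f : α → List ℕ → τ → List ℕ}
    {n M : α → ℕ} (hl : PT l) (hs : PT s) (hf : PT fun p : α × List ℕ × τ => f p.1 p.2.1 p.2.2)
    (hn : PolyBdd n) (hM : PT M) (h0 : ∀ a, Within (n a) (M a) (s a))
    (hstep : ∀ a s x, Within (n a) (M a) s → Within (n a) (M a) (f a s x)) :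
    PT fun a => (l a).foldl (f a) (s a) :=
  PT.foldl_inv (fun a s => Within (n a) (M a) s) hl hs hf
    ((PolyBdd.const 1).add (hn.mul (hM.sz_le.add (PolyBdd.const 1)))) h0 hstep fun _ _ h =>
    sz_list_le h.1 fun x hx => sz_nat_mono (h.2 x hx)

variable {q vr er A B X o x : α → List ℕ} {r D Δ e f i j v : α → ℕ}

@[fun_prop]
theorem PT.load (her : PT er) (hA : PT A) (hB : PT B) (hX : PT X) (hr : PT r) (hD : PT D)
    (ho : PT o) (hv : PT v) :
    PT fun a => load (er a) (A a) (B a) (X a) (r a) (D a) (o a) (v a) := by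
  unfold PrizeCollecting.load; fun_prop

@[fun_prop]
theorem PT.newValue (her : PT er) (hA : PT A) (hB : PT B) (hX : PT X) (hr : PT r) (hD : PT D)
    (hΔ : PT Δ) (ho : PT o) (he : PT e) :
    PT fun a => newValue (er a) (A a) (B a) (X a) (r a) (D a) (Δ a) (o a) (e a) := by
  unfold PrizeCollecting.newValue; fun_prop

@[fun_prop]
theorem PT.relax (her : PT er) (hA : PT A) (hB : PT B) (hX : PT X) (hr : PT r) (hD : PT D)
    (hΔ : PT Δ) (ho : PT o) (he : PT e) :
    PT fun a => relax (er a) (A a) (B a) (X a) (r a) (D a) (Δ a) (o a) (e a) := by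
  unfold PrizeCollecting.relax; fun_prop

/-- Running times must be bounded for all lists, meaningful or not. A forward move lowers the entry,
and a backward move is made only if the result is at most the value in `X`. -/
theorem Within.relax {er A B X o : List ℕ} {r D Δ n M : ℕ} (hn : sz er ≤ n) (hM : X.sum ≤ M)
    (ho : Within n M o) (e : ℕ) : Within n M (relax er A B X r D Δ o e) := by
  refine Within.map hn fun i _ => ?_
  split_ifs
  · unfold PrizeCollecting.newValue
    have h1 := ho.getD_le e
    have h2 := (within_sum X).getD_le e
    cases h : (decide (Δ ≤ o.getD e 0) && (decide (PrizeCollecting.load er A B X r D o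
      (B.getD e 0) + 2 * Δ ≤ PrizeCollecting.load er A B X r D o (A.getD e 0)) &&
      decide (D + 2 * Δ ≤ PrizeCollecting.load er A B X r D o (A.getD e 0)))) with
    | true => exact (Nat.sub_le _ _).trans h1
    | false =>
      rw [cond_false]
      by_cases h3 : o.getD e 0 + Δ ≤ X.getD e 0
      · cases (decide (o.getD e 0 + Δ ≤ X.getD e 0) &&
          (decide (PrizeCollecting.load er A B X r D o (A.getD e 0) + 2 * Δ ≤
            PrizeCollecting.load er A B X r D o (B.getD e 0)) &&
          decide (D + 2 * Δ ≤ PrizeCollecting.load er A B X r D o (B.getD e 0)))) with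
        | true => exact h3.trans (h2.trans hM)
        | false => exact h1
      · rw [decide_eq_false h3]; exact h1
  · exact ho.getD_le i

theorem Within.sweep {er A B X o : List ℕ} {r D Δ n M : ℕ} (hn : sz er ≤ n) (hM : X.sum ≤ M)
    (ho : Within n M o) : Within n M (sweep er A B X r D Δ o) :=
  ho.foldl fun _ e h => h.relax hn hM e

theorem Within.balance {q er A B X o : List ℕ} {r D Δ n M : ℕ} (hn : sz er ≤ n) (hM : X.sum ≤ M)
    (ho : Within n M o) : Within n M (balance q er A B X r D Δ o) :=
  ho.foldl fun _ _ h => h.foldl fun _ _ h => h.foldl fun _ _ h => h.sweep hn hM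

@[fun_prop]
theorem PT.sweep (her : PT er) (hA : PT A) (hB : PT B) (hX : PT X) (hr : PT r) (hD : PT D)
    (hΔ : PT Δ) (ho : PT o) :
    PT fun a => sweep (er a) (A a) (B a) (X a) (r a) (D a) (Δ a) (o a) := by
  refine PT.foldl_within (n := fun a => sz (er a) + sz (o a)) (M := fun a => (X a).sum + (o a).sum)
    her ho (by fun_prop) (her.sz_le.add ho.sz_le) (by fun_prop)
    (fun a => (within_sum _).mono (by omega) (by omega))
    fun a s x h => h.relax (by omega) (by omega) x

@[fun_prop]
theorem PT.balance (hq : PT q) (her : PT er) (hA : PT A) (hB : PT B) (hX : PT X) (hr : PT r)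
    (hD : PT D) (hΔ : PT Δ) (ho : PT o) :
    PT fun a => balance (q a) (er a) (A a) (B a) (X a) (r a) (D a) (Δ a) (o a) := by
  -- One level of the triple repetition; it is applied to the sweep, to its repetition, and to the
  -- repetition of that.
  have aux (g : α → List ℕ → List ℕ) (hg : PT fun p : α × List ℕ => g p.1 p.2)
      (hw : ∀ a n M s, sz (er a) ≤ n → (X a).sum ≤ M → Within n M s → Within n M (g a s)) :
      PT fun p : α × List ℕ => (q p.1).foldl (fun o _ => g p.1 o) p.2 := by
    have h1 : PT fun p : α × List ℕ => er p.1 := by fun_prop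
    have h2 : PT fun p : α × List ℕ => p.2 := by fun_prop
    refine PT.foldl_within (n := fun p : α × List ℕ => sz (er p.1) + sz p.2)
      (M := fun p => (X p.1).sum + p.2.sum) (f := fun p o _ => g p.1 o)
      (by fun_prop) h2 ?_ (h1.sz_le.add h2.sz_le) (by fun_prop)
      (fun a => (within_sum _).mono (by omega) (by omega))
      fun a s x h => hw _ _ _ _ (by omega) (by omega) h
    exact PT.comp (f := fun p : (α × List ℕ) × List ℕ × ℕ => (p.1.1, p.2.1)) hg (by fun_prop)
  let g a s := PrizeCollecting.sweep (er a) (A a) (B a) (X a) (r a) (D a) (Δ a) s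
  let g' a s := (q a).foldl (fun o _ => g a o) s
  let g'' a s := (q a).foldl (fun o _ => g' a o) s
  have hw : ∀ a n M s, sz (er a) ≤ n → (X a).sum ≤ M → Within n M s → Within n M (g a s) :=
    fun a n M s h1 h2 h => h.sweep h1 h2
  have hw' : ∀ a n M s, sz (er a) ≤ n → (X a).sum ≤ M → Within n M s → Within n M (g' a s) :=
    fun a n M s h1 h2 h => h.foldl fun _ _ h => hw a n M _ h1 h2 h
  have h3 := aux g'' (aux g' (aux g (by fun_prop) hw) hw')
    fun a n M s h1 h2 h => h.foldl fun _ _ h => hw' a n M _ h1 h2 h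
  exact PT.comp (f := fun a => (a, o a)) h3 (by fun_prop)

@[fun_prop]
theorem PT.distribute (hq : PT q) (her : PT er) (hA : PT A) (hB : PT B) (hX : PT X) (hr : PT r)
    (hD : PT D) : PT fun a => distribute (q a) (er a) (A a) (B a) (X a) (r a) (D a) := by
  unfold PrizeCollecting.distribute
  refine PT.foldl_within (n := fun a => sz (er a)) (M := fun a => (X a).sum)
    (f := fun a o Δ => PrizeCollecting.balance (q a) (er a) (A a) (B a) (X a) (r a) (D a) Δ o)
    (s := fun a => (er a).map fun _ => 0) (by fun_prop) (by fun_prop) (by fun_prop) her.sz_le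
    (by fun_prop) (fun a => .map le_rfl fun _ _ => Nat.zero_le _)
    fun a s x h => h.balance le_rfl le_rfl

@[fun_prop]
theorem PT.fits (hq : PT q) (hvr : PT vr) (her : PT er) (hA : PT A) (hB : PT B) (hX : PT X)
    (hD : PT D) (hr : PT r) :
    PT fun a => fits (q a) (vr a) (er a) (A a) (B a) (X a) (D a) (r a) := by
  unfold PrizeCollecting.fits; fun_prop

@[fun_prop]
theorem PT.inPolytope (hvr : PT vr) (her : PT er) (hA : PT A) (hB : PT B) (hD : PT D)
    (hx : PT x) : PT fun a => inPolytope (vr a) (er a) (A a) (B a) (D a) (x a) := by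
  unfold PrizeCollecting.inPolytope; fun_prop

@[fun_prop]
theorem PT.transfer (her : PT er) (hx : PT x) (he : PT e) (hf : PT f) (hΔ : PT Δ) :
    PT fun a => transfer (er a) (x a) (e a) (f a) (Δ a) := by
  unfold PrizeCollecting.transfer; fun_prop

@[fun_prop]
theorem PT.tryTransfer (hvr : PT vr) (her : PT er) (hA : PT A) (hB : PT B) (hD : PT D)
    (he : PT e) (hf : PT f) (hx : PT x) (hΔ : PT Δ) :
    PT fun a => tryTransfer (vr a) (er a) (A a) (B a) (D a) (e a) (f a) (x a) (Δ a) := by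
  unfold PrizeCollecting.tryTransfer; fun_prop

theorem Within.tryTransfer {vr er A B x : List ℕ} {D e f n M : ℕ} (hn : sz er ≤ n) (hM : D ≤ M)
    (hx : Within n M x) (Δ : ℕ) : Within n M (tryTransfer vr er A B D e f x Δ) := by
  unfold PrizeCollecting.tryTransfer
  by_cases h : x.getD e 0 + Δ ≤ D
  · cases (decide (Δ ≤ x.getD f 0) && (decide (x.getD e 0 + Δ ≤ D) &&
      PrizeCollecting.inPolytope vr er A B D (PrizeCollecting.transfer er x e f Δ))) with
    | true =>
      refine Within.map hn fun i _ => ?_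
      have := hx.getD_le i
      split_ifs with h1
      · rw [h1]; omega
      · omega
      · omega
    | false => exact hx
  · rw [decide_eq_false h, Bool.false_and, Bool.and_false]; exact hx

theorem Within.push {vr er A B x : List ℕ} {D e f n M : ℕ} (hn : sz er ≤ n) (hM : D ≤ M)
    (hx : Within n M x) : Within n M (push vr er A B D e f x) :=
  hx.foldl fun _ Δ h => h.tryTransfer hn hM Δ

@[fun_prop]
theorem PT.push (hvr : PT vr) (her : PT er) (hA : PT A) (hB : PT B) (hD : PT D) (he : PT e)
    (hf : PT f) (hx : PT x) :
    PT fun a => push (vr a) (er a) (A a) (B a) (D a) (e a) (f a) (x a) := by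
  refine PT.foldl_within (n := fun a => sz (er a) + sz (x a)) (M := fun a => D a + (x a).sum)
    (by fun_prop) hx (by fun_prop) (her.sz_le.add hx.sz_le) (by fun_prop)
    (fun a => (within_sum _).mono (by omega) (by omega))
    fun a s Δ h => h.tryTransfer (by omega) (by omega) Δ

variable {G : α → List ℕ → ℕ}

theorem PT.pipageStep (hG : PT fun p : α × List ℕ => G p.1 p.2) (hvr : PT vr) (her : PT er)
    (hA : PT A) (hB : PT B) (hD : PT D) :
    PT fun p : α × ℕ × ℕ × List ℕ =>
      pipageStep (G p.1) (vr p.1) (er p.1) (A p.1) (B p.1) (D p.1) p.2.1 p.2.2.1 p.2.2.2 := by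
  have h1 : PT fun p : α × ℕ × ℕ × List ℕ => G p.1 p.2.2.2 :=
    PT.comp (f := fun p : α × ℕ × ℕ × List ℕ => (p.1, p.2.2.2)) hG (by fun_prop)
  have h2 : PT fun p : α × ℕ × ℕ × List ℕ => G p.1 (PrizeCollecting.push (vr p.1) (er p.1) (A p.1)
      (B p.1) (D p.1) p.2.1 p.2.2.1 p.2.2.2) :=
    PT.comp (f := fun p : α × ℕ × ℕ × List ℕ => (p.1, PrizeCollecting.push (vr p.1) (er p.1)
      (A p.1) (B p.1) (D p.1) p.2.1 p.2.2.1 p.2.2.2)) hG (by fun_prop)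
  unfold PrizeCollecting.pipageStep
  fun_prop

theorem Within.pipageStep {G : List ℕ → ℕ} {vr er A B x : List ℕ} {D i j n M : ℕ}
    (hn : sz er ≤ n) (hM : D ≤ M) (hx : Within n M x) :
    Within n M (pipageStep G vr er A B D i j x) := by
  unfold PrizeCollecting.pipageStep
  cases (decide (i = j) || (decide ((PrizeCollecting.push vr er A B D i j x).getD i 0 = x.getD i 0)
      || decide ((PrizeCollecting.push vr er A B D j i x).getD j 0 = x.getD j 0))) with
  | true => exact hx
  | false =>
    cases decide (G (PrizeCollecting.push vr er A B D i j x) ≤ G x) with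
    | true => exact hx.push hn hM
    | false => exact hx.push hn hM

theorem Within.pipageRow {G : List ℕ → ℕ} {vr er A B x : List ℕ} {D n M : ℕ}
    (hn : sz er ≤ n) (hM : D ≤ M) (hx : Within n M x) (i : ℕ) :
    Within n M (pipageRow G vr er A B D x i) :=
  hx.foldl fun _ _ h => h.pipageStep hn hM

theorem PT.pipageRow (hG : PT fun p : α × List ℕ => G p.1 p.2) (hvr : PT vr) (her : PT er)
    (hA : PT A) (hB : PT B) (hD : PT D) :
    PT fun p : α × List ℕ × ℕ =>
      pipageRow (G p.1) (vr p.1) (er p.1) (A p.1) (B p.1) (D p.1) p.2.1 p.2.2 := by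
  have h1 : PT fun p : α × List ℕ × ℕ => er p.1 := by fun_prop
  have h2 : PT fun p : α × List ℕ × ℕ => p.2.1 := by fun_prop
  refine PT.foldl_within (n := fun p => sz (er p.1) + sz p.2.1)
    (M := fun p => D p.1 + p.2.1.sum) (f := fun p x j => PrizeCollecting.pipageStep (G p.1)
      (vr p.1) (er p.1) (A p.1) (B p.1) (D p.1) p.2.2 j x) h1 h2 ?_ (h1.sz_le.add h2.sz_le)
    (by fun_prop) (fun a => (within_sum _).mono (by omega) (by omega))
    fun a s x h => h.pipageStep (by omega) (by omega)
  exact PT.comp (f := fun p : (α × List ℕ × ℕ) × List ℕ × ℕ => (p.1.1, p.1.2.2, p.2.2, p.2.1))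
    (PT.pipageStep hG hvr her hA hB hD) (by fun_prop)

theorem PT.pipage (hG : PT fun p : α × List ℕ => G p.1 p.2) (hvr : PT vr) (her : PT er)
    (hA : PT A) (hB : PT B) (hD : PT D) (hx : PT x) :
    PT fun a => pipage (G a) (vr a) (er a) (A a) (B a) (D a) (x a) := by
  refine PT.foldl_within (n := fun a => sz (er a) + sz (x a)) (M := fun a => D a + (x a).sum)
    her hx (PT.pipageRow hG hvr her hA hB hD) (her.sz_le.add hx.sz_le) (by fun_prop)
    (fun a => (within_sum _).mono (by omega) (by omega))
    fun a s i h => h.pipageRow (by omega) (by omega) i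

end Running


/-! # The algorithm -/

/-- A tree, given by the characteristic vector of the vertices and the adjacency matrix. -/
abbrev RawTree := List Bool × List (List Bool)

/-- An input, given by lists. -/
abbrev RawInput := List (List (ℤ × ℕ)) × ℕ × List (ℤ × ℕ) × List (List (ℤ × ℕ)) × List (ℤ × ℕ) ×
  List Bool × List RawTree × List (ℤ × ℕ) × Unit

/-- The numerator of a nonnegative fraction with respect to the denominator `Q`. -/
def scale (Q : ℕ) (q : ℤ × ℕ) : ℕ := q.1.toNat * (Q / q.2)

namespace RawTree

/-- One round of graph search without the edge `{u, v}`. -/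
def grow (vr : List ℕ) (T : RawTree) (u v : ℕ) (R : List Bool) : List Bool :=
  vr.map fun w => R.getD w false || vr.any fun z => R.getD z false && ((T.2.getD z []).getD w false
    && !((decide (z = u) && decide (w = v)) || (decide (z = v) && decide (w = u))))

/-- The vertices reachable from `a` without the edge `{u, v}`. -/
def reach (vr : List ℕ) (T : RawTree) (u v a : ℕ) : List Bool :=
  vr.foldl (fun R _ => grow vr T u v R) (vr.map fun w => decide (w = a))

/-- The list of anchors. -/
def anchors (vr : List ℕ) (cr : List Bool) (T : RawTree) : List ℕ :=
  vr.filter fun v => cr.getD v false && T.1.getD v false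

/-- Test for edges of the backbone. -/
def inBackbone (vr : List ℕ) (cr : List Bool) (T : RawTree) (u v : ℕ) : Bool :=
  !((reach vr T u v ((anchors vr cr T).getD 0 0)).getD ((anchors vr cr T).getD 1 0) false)

/-- The multiplicity of an edge in the tour of a tree. -/
def tourMult (vr : List ℕ) (cr : List Bool) (T : Bool × RawTree) (u v : ℕ) : ℕ :=
  bif (T.2.2.getD u []).getD v false then
    bif inBackbone vr cr T.2 u v then 1 else bif T.1 then 2 else 0
  else 0

end RawTree

namespace RawInput

/-- The vertices. -/
def verts (d : RawInput) : List ℕ := List.range d.2.2.1.length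

/-- The characteristic vector of the core. -/
def core (d : RawInput) : List Bool := d.2.2.2.2.1.map fun q => decide (q.1.toNat = q.2)

/-- The edges of the graph `G₁`. -/
def arcs (d : RawInput) : List (Bool × RawTree) :=
  (d.2.2.2.2.2.2.1.map fun T => (false, T)) ++ d.2.2.2.2.2.2.1.map fun T => (true, T)

/-- A common denominator of the weights of the trees. -/
def denom (d : RawInput) : ℕ := (d.2.2.2.2.2.2.2.1.map fun q => q.2).prod

/-- The initial point, with denominator `4 * denom d`. -/
def start (d : RawInput) : List ℕ :=
  (d.2.2.2.2.2.2.2.1.map fun q => scale (denom d) q) ++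
    d.2.2.2.2.2.2.2.1.map fun q => 3 * scale (denom d) q

/-- A common denominator of the lengths and penalties. -/
def costDenom (d : RawInput) : ℕ :=
  (d.1.map fun l => (l.map fun q => q.2).prod).prod * (d.2.2.1.map fun q => q.2).prod

/-- Twice the cost of the tour of a tree, with denominator `costDenom d`. -/
def tourCost (d : RawInput) (T : Bool × RawTree) : ℕ :=
  ((verts d).map fun u => ((verts d).map fun v => RawTree.tourMult (verts d) (core d) T u v *
    scale (costDenom d) ((d.1.getD u []).getD v (0, 1))).sum).sum

/-- Twice the penalty of a vertex outside the core, with denominator `costDenom d`. -/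
def penalty (d : RawInput) (v : ℕ) : ℕ :=
  bif (core d).getD v false then 0 else 2 * scale (costDenom d) (d.2.2.1.getD v (0, 1))

/-- The objective function. -/
def objective (d : RawInput) (x : List ℕ) : ℕ :=
  -- With `D = 4 * denom d`, both parts are scaled by `2 * costDenom d * D ^ (m + 1)` for `m` edges:
  -- the linear part lacks `D ^ m`, and each product has `m` factors, where edges not covering `v`
  -- contribute `D`, so it lacks one `D`.
  ((List.range (arcs d).length).map fun e =>
      x.getD e 0 * ((arcs d).map fun T => tourCost d T).getD e 0).sum *
    ((arcs d).map fun _ => 4 * denom d).prod +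
  4 * denom d * ((verts d).map fun v => penalty d v * ((List.range (arcs d).length).map fun e =>
    bif ((arcs d).map fun T => T.1 && T.2.1.getD v false).getD e false then
      4 * denom d - x.getD e 0 else 4 * denom d).prod).sum

/-- The first or second endpoints of the edges of `G₁`. -/
def ends (d : RawInput) (i : ℕ) : List ℕ :=
  (arcs d).map fun T => (RawTree.anchors (verts d) (core d) T.2).getD i 0

/-- The rounded point. -/
def rounded (d : RawInput) : List ℕ :=
  pipage (objective d) (verts d) (List.range (arcs d).length) (ends d 0) (ends d 1) (4 * denom d)
    (start d)

/-- The edge multiplicities of the multigraph given by the point `z`. -/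
def mult (d : RawInput) (z : List ℕ) (u v : ℕ) : ℕ :=
  ((List.range (arcs d).length).map fun e => bif decide (z.getD e 0 = 4 * denom d) then
    ((arcs d).map fun T => RawTree.tourMult (verts d) (core d) T u v).getD e 0 else 0).sum

/-- The multigraph given by the point `z`. -/
def graph (d : RawInput) (z : List ℕ) : List Bool × List (List ℕ) :=
  ((verts d).map fun v => (core d).getD v false ||
      (verts d).any fun u => !decide (mult d z u v = 0),
    (verts d).map fun u => (verts d).map fun v => mult d z u v)

end RawInput

/-! ### Running time of the algorithm on raw inputs -/

section Running

variable {α : Type*} [Enc α] {d : α → RawInput} {vr x z : α → List ℕ} {cr R : α → List Bool}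
  {T : α → RawTree} {T' : α → Bool × RawTree} {Q i u v : α → ℕ} {q : α → ℤ × ℕ}

@[fun_prop]
theorem PT.scale (hQ : PT Q) (hq : PT q) : PT fun a => scale (Q a) (q a) := by
  unfold PrizeCollecting.scale; fun_prop

@[fun_prop]
theorem PT.grow (hvr : PT vr) (hT : PT T) (hu : PT u) (hv : PT v) (hR : PT R) :
    PT fun a => RawTree.grow (vr a) (T a) (u a) (v a) (R a) := by
  unfold RawTree.grow; fun_prop

@[fun_prop]
theorem PT.reach (hvr : PT vr) (hT : PT T) (hu : PT u) (hv : PT v) (hi : PT i) :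
    PT fun a => RawTree.reach (vr a) (T a) (u a) (v a) (i a) := by
  refine PT.foldl_inv (fun a R => R.length = (vr a).length) (T := fun a => 1 + sz (vr a) * (2 + 1))
    (f := fun a R _ => RawTree.grow (vr a) (T a) (u a) (v a) R)
    (s := fun a => (vr a).map fun w => decide (w = i a)) hvr (by fun_prop) (by fun_prop)
    ((PolyBdd.const 1).add (hvr.sz_le.mul (PolyBdd.const 3))) (fun a => List.length_map _)
    (fun a R _ _ => List.length_map _) fun a R h => ?_
  exact sz_list_le (h.le.trans (length_lt_sz _).le) fun b _ => sz_bool_le b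

@[fun_prop]
theorem PT.anchors (hvr : PT vr) (hcr : PT cr) (hT : PT T) :
    PT fun a => RawTree.anchors (vr a) (cr a) (T a) := by
  unfold RawTree.anchors; fun_prop

@[fun_prop]
theorem PT.inBackbone (hvr : PT vr) (hcr : PT cr) (hT : PT T) (hu : PT u) (hv : PT v) :
    PT fun a => RawTree.inBackbone (vr a) (cr a) (T a) (u a) (v a) := by
  unfold RawTree.inBackbone; fun_prop

@[fun_prop]
theorem PT.tourMult (hvr : PT vr) (hcr : PT cr) (hT : PT T') (hu : PT u) (hv : PT v) :
    PT fun a => RawTree.tourMult (vr a) (cr a) (T' a) (u a) (v a) := by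
  unfold RawTree.tourMult; fun_prop

@[fun_prop]
theorem PT.verts (hd : PT d) : PT fun a => RawInput.verts (d a) := by
  unfold RawInput.verts; fun_prop

@[fun_prop]
theorem PT.core (hd : PT d) : PT fun a => RawInput.core (d a) := by
  unfold RawInput.core; fun_prop

@[fun_prop]
theorem PT.arcs (hd : PT d) : PT fun a => RawInput.arcs (d a) := by
  unfold RawInput.arcs; fun_prop

@[fun_prop]
theorem PT.denom (hd : PT d) : PT fun a => RawInput.denom (d a) := by
  unfold RawInput.denom; fun_prop

@[fun_prop]
theorem PT.start (hd : PT d) : PT fun a => RawInput.start (d a) := by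
  unfold RawInput.start; fun_prop

@[fun_prop]
theorem PT.costDenom (hd : PT d) : PT fun a => RawInput.costDenom (d a) := by
  unfold RawInput.costDenom; fun_prop

@[fun_prop]
theorem PT.tourCost (hd : PT d) (hT : PT T') : PT fun a => RawInput.tourCost (d a) (T' a) := by
  unfold RawInput.tourCost; fun_prop

@[fun_prop]
theorem PT.penalty (hd : PT d) (hv : PT v) : PT fun a => RawInput.penalty (d a) (v a) := by
  unfold RawInput.penalty; fun_prop

@[fun_prop]
theorem PT.objective (hd : PT d) (hx : PT x) : PT fun a => RawInput.objective (d a) (x a) := by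
  unfold RawInput.objective; fun_prop

@[fun_prop]
theorem PT.ends (hd : PT d) (hi : PT i) : PT fun a => RawInput.ends (d a) (i a) := by
  unfold RawInput.ends; fun_prop

@[fun_prop]
theorem PT.rounded (hd : PT d) : PT fun a => RawInput.rounded (d a) :=
  PT.pipage (by fun_prop) (by fun_prop) (by fun_prop) (by fun_prop) (by fun_prop) (by fun_prop)
    (by fun_prop)

@[fun_prop]
theorem PT.mult (hd : PT d) (hz : PT z) (hu : PT u) (hv : PT v) :
    PT fun a => RawInput.mult (d a) (z a) (u a) (v a) := by
  unfold RawInput.mult; fun_prop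

@[fun_prop]
theorem PT.graph (hd : PT d) (hz : PT z) : PT fun a => RawInput.graph (d a) (z a) := by
  unfold RawInput.graph; fun_prop

end Running


/-! # Correctness of the algorithm -/

section Encoding

variable {n k : ℕ}

theorem getD_ofFn {τ : Type*} (f : Fin n → τ) (i : Fin n) (d : τ) :
    (List.ofFn f).getD i d = f i := by
  rw [List.getD_eq_getElem _ _ (by simp)]; simp

theorem map_range_eq_ofFn {τ : Type*} (f : ℕ → τ) :
    (List.range n).map f = List.ofFn fun i : Fin n => f i := by
  rw [List.ofFn_eq_map, ← List.map_coe_finRange_eq_range, List.map_map]; rfl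

open Classical in
/-- The lists representing a tree. -/
noncomputable def rawTree (T : CompleteSub (Fin n)) : RawTree :=
  (List.ofFn fun v => decide (v ∈ T.verts),
    List.ofFn fun u => List.ofFn fun v => decide (s(u, v) ∈ T.edgeSet))

/-- Numerator and denominator. -/
def fraction (q : ℚ) : ℤ × ℕ := (q.num, q.den)

open Classical in
/-- The lists representing an input. -/
noncomputable def Input.raw (I : Input ℚ (Fin n) (Fin k)) : RawInput :=
  (List.ofFn fun u => List.ofFn fun v => fraction (I.c s(u, v)), I.r,
    List.ofFn fun v => fraction (I.pen v),
    List.ofFn fun u => List.ofFn fun v => fraction (I.x s(u, v)), List.ofFn fun v => fraction (I.y v),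
    List.ofFn fun v => decide (v ∈ I.e₀), List.ofFn fun i => rawTree (I.T i),
    List.ofFn fun i => fraction (I.μ i), ())

theorem enc_ofFn {τ : Type*} [Enc τ] (f : Fin n → τ) :
    enc (List.ofFn f) = Data.ofFun fun i => enc (f i) := by
  change Data.ofList _ = _
  rw [List.map_ofFn]; rfl

theorem enc_decide (p : Prop) [Decidable p] : enc (decide p) = Data.ofProp p := by
  by_cases h : p <;> simp [enc, Data.ofProp, h]

theorem enc_rawTree (T : CompleteSub (Fin n)) : enc (rawTree T) = Data.ofSub T := by
  classical
  change Data.pair _ _ = Data.pair _ _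
  simp only [rawTree, enc_ofFn, enc_decide]; rfl

/-- The program operates on nested pairs of lists. The final `()` is encoded like the end of a list,
which makes the nested pairs agree with the list of eight components. -/
theorem enc_raw (I : Input ℚ (Fin n) (Fin k)) : enc I.raw = I.encode := by
  classical
  have hT (T : CompleteSub (Fin n)) : Data.pair (enc (rawTree T).1) (enc (rawTree T).2) =
    Data.ofSub T := enc_rawTree T
  have hp {α β : Type} [Enc α] [Enc β] (a : α) (b : β) : enc (a, b) = .pair (enc a) (enc b) := rfl
  simp only [Input.raw, hp, enc_ofFn, enc_decide, hT]
  rfl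

open Classical in
theorem enc_multigraph (H : Multigraph (Fin n)) :
    enc (List.ofFn fun v => decide (v ∈ H.verts),
      List.ofFn fun u => List.ofFn fun v => H.mult s(u, v)) = H.encode := by
  change Data.pair (enc _) (enc _) = _
  simp only [enc_ofFn, enc_decide]; rfl

theorem scale_fraction {q : ℚ} (hq : 0 ≤ q) {Q : ℕ} (h : q.den ∣ Q) :
    (scale Q (fraction q) : ℝ) = q * Q := by
  obtain ⟨r, rfl⟩ := h
  have h1 : ((q.num.toNat : ℕ) : ℤ) = q.num := Int.toNat_of_nonneg (Rat.num_nonneg.2 hq)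
  have h2 : ((q.num.toNat : ℕ) : ℝ) = q.num := by exact_mod_cast h1
  have h3 : (q : ℝ) = q.num / q.den := by exact_mod_cast (Rat.num_div_den q).symm
  have h4 : (q.den : ℝ) ≠ 0 := by exact_mod_cast q.den_nz
  simp only [scale, fraction]
  rw [Nat.mul_div_cancel_left _ q.den_pos]
  push_cast
  rw [h2, h3]
  field_simp

theorem toNat_num_eq_den_iff (q : ℚ) : q.num.toNat = q.den ↔ q = 1 := by
  have h1 := q.den_pos
  constructor
  · intro h
    have h2 : q.num = q.den := by omega
    have h3 := Rat.num_div_den q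
    rw [h2] at h3
    rw [← h3, Int.cast_natCast, div_self (by exact_mod_cast h1.ne')]
  · rintro rfl; rfl

/-- The numbering of the edges of `G₁`. -/
def arcEquiv (k : ℕ) : Fin k × Bool ≃ Fin (k + k) :=
  ((Equiv.prodComm _ _).trans (Equiv.boolProdEquivSum _)).trans finSumFinEquiv

theorem arcEquiv_false (i : Fin k) : (arcEquiv k (i, false) : ℕ) = i := rfl

theorem arcEquiv_true (i : Fin k) : (arcEquiv k (i, true) : ℕ) = k + i := rfl

theorem getD_append_ofFn {τ : Type*} (f : Bool → Fin k → τ) (i : Fin k × Bool) (d : τ) :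
    (List.ofFn (f false) ++ List.ofFn (f true)).getD (arcEquiv k i) d = f i.2 i.1 := by
  obtain ⟨i, b⟩ := i
  cases b
  · rw [arcEquiv_false, List.getD_append _ _ _ _ (by simp)]
    exact getD_ofFn (f false) i d
  · rw [arcEquiv_true, List.getD_append_right _ _ _ _ (by simp), List.length_ofFn,
      Nat.add_sub_cancel_left]
    exact getD_ofFn (f true) i d

variable (I : Input ℚ (Fin n) (Fin k))

theorem verts_raw : RawInput.verts I.raw = List.range n := by
  simp [RawInput.verts, Input.raw]

theorem arcs_raw : RawInput.arcs I.raw = List.ofFn (fun i => (false, rawTree (I.T i))) ++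
    List.ofFn fun i => (true, rawTree (I.T i)) := by
  simp only [RawInput.arcs, Input.raw, List.map_ofFn]; rfl

theorem length_arcs_raw : (RawInput.arcs I.raw).length = k + k := by
  rw [arcs_raw]; simp

theorem getD_arcs_raw {τ : Type*} (f : Bool × RawTree → τ) (i : Fin k × Bool) (d : τ) :
    ((RawInput.arcs I.raw).map f).getD (arcEquiv k i) d = f (i.2, rawTree (I.T i.1)) := by
  rw [arcs_raw, List.map_append, List.map_ofFn, List.map_ofFn]
  exact getD_append_ofFn (fun b i => f (b, rawTree (I.T i))) i d

theorem mem_core_toReal {v : Fin n} : v ∈ core I.toReal.y ↔ I.y v = 1 := by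
  rw [core, Finset.mem_filter]
  exact (and_iff_right (Finset.mem_univ v)).trans (by simp only [Input.toReal]; exact_mod_cast Iff.rfl)

open Classical in
theorem getD_core_raw (v : Fin n) :
    (RawInput.core I.raw).getD v false = decide (v ∈ core I.toReal.y) := by
  simp only [RawInput.core, Input.raw, List.map_ofFn]
  rw [getD_ofFn]
  exact decide_eq_decide.2 ((toNat_num_eq_den_iff _).trans (mem_core_toReal I).symm)

theorem den_dvd_denom (i : Fin k) : (I.μ i).den ∣ RawInput.denom I.raw := by
  refine List.dvd_prod ?_
  simp only [Input.raw, List.map_ofFn, List.mem_ofFn]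
  exact ⟨i, rfl⟩

theorem denom_pos : 0 < RawInput.denom I.raw := by
  refine List.prod_pos fun q hq => ?_
  simp only [Input.raw, List.map_ofFn, List.mem_ofFn] at hq
  obtain ⟨i, rfl⟩ := hq
  exact (I.μ i).den_pos

theorem den_length_dvd (u v : Fin n) : (I.c s(u, v)).den ∣ RawInput.costDenom I.raw := by
  refine Dvd.dvd.mul_right (dvd_trans (b := (List.ofFn fun v => (I.c s(u, v)).den).prod)
    (List.dvd_prod (List.mem_ofFn.2 ⟨v, rfl⟩)) (List.dvd_prod ?_)) _
  simp only [Input.raw, List.map_ofFn, List.mem_ofFn]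
  exact ⟨u, by simp only [Function.comp_apply, List.map_ofFn]; rfl⟩

theorem den_pen_dvd (v : Fin n) : (I.pen v).den ∣ RawInput.costDenom I.raw := by
  refine Dvd.dvd.mul_left (List.dvd_prod ?_) _
  simp only [Input.raw, List.map_ofFn, List.mem_ofFn]
  exact ⟨v, rfl⟩

theorem costDenom_pos : 0 < RawInput.costDenom I.raw := by
  refine Nat.mul_pos (List.prod_pos fun q hq => ?_) (List.prod_pos fun q hq => ?_)
  · simp only [Input.raw, List.map_ofFn, List.mem_ofFn] at hq
    obtain ⟨u, rfl⟩ := hq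
    refine List.prod_pos fun q hq => ?_
    simp only [List.map_ofFn, List.mem_ofFn] at hq
    obtain ⟨v, rfl⟩ := hq
    exact (I.c s(u, v)).den_pos
  · simp only [Input.raw, List.map_ofFn, List.mem_ofFn] at hq
    obtain ⟨v, rfl⟩ := hq
    exact (I.pen v).den_pos

end Encoding


/-! ### Correctness of graph search and of the backbone test -/

section TreeCorrect

variable {n : ℕ} (T : CompleteSub (Fin n))

theorem getD_map_range_fin {τ : Type*} (f : ℕ → τ) (i : Fin n) (d : τ) :
    ((List.range n).map f).getD i d = f i := by
  rw [map_range_eq_ofFn, getD_ofFn]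

theorem any_range (f : ℕ → Bool) : (List.range n).any f = true ↔ ∃ i : Fin n, f i = true := by
  rw [List.any_eq_true]
  exact ⟨fun ⟨i, hi, h⟩ => ⟨⟨i, List.mem_range.1 hi⟩, h⟩, fun ⟨i, h⟩ => ⟨i, List.mem_range.2 i.2, h⟩⟩

open Classical in
theorem getD_adj_rawTree (u v : Fin n) :
    ((rawTree T).2.getD u []).getD v false = decide (T.Adj u v) := by
  simp only [rawTree, getD_ofFn, SimpleGraph.Subgraph.mem_edgeSet]

open Classical in
theorem getD_verts_rawTree (v : Fin n) : (rawTree T).1.getD v false = decide (v ∈ T.verts) := by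
  simp only [rawTree, getD_ofFn]

theorem getD_grow (u v w : Fin n) (R : List Bool) :
    (RawTree.grow (List.range n) (rawTree T) u v R).getD w false = true ↔
      R.getD w false = true ∨ ∃ z : Fin n, R.getD z false = true ∧
        (T.spanningCoe.deleteEdges {s(u, v)}).Adj z w := by
  classical
  rw [RawTree.grow, getD_map_range_fin, Bool.or_eq_true, any_range]
  simp only [Bool.and_eq_true, getD_adj_rawTree, decide_eq_true_iff, SimpleGraph.deleteEdges_adj,
    SimpleGraph.Subgraph.spanningCoe_adj, Set.mem_singleton_iff, Sym2.eq_iff, Bool.not_eq_true',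
    ← Bool.not_eq_true, Bool.or_eq_true, Fin.val_inj]

theorem getD_iterate_grow (u v a w : Fin n) (i : ℕ) :
    ((RawTree.grow (List.range n) (rawTree T) u v)^[i]
      ((List.range n).map fun w => decide (w = (a : ℕ)))).getD w false = true ↔
    ∃ p : (T.spanningCoe.deleteEdges {s(u, v)}).Walk a w, p.length ≤ i := by
  induction i generalizing w with
  | zero =>
    rw [Function.iterate_zero, id, getD_map_range_fin, decide_eq_true_iff, Fin.val_inj]
    constructor
    · rintro rfl; exact ⟨.nil, le_rfl⟩
    · rintro ⟨p, hp⟩; exact (SimpleGraph.Walk.eq_of_length_eq_zero (Nat.le_zero.1 hp)).symm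
  | succ i ih =>
    rw [Function.iterate_succ_apply', getD_grow]
    simp only [ih]
    constructor
    · rintro (⟨p, hp⟩ | ⟨z, ⟨p, hp⟩, h⟩)
      · exact ⟨p, by omega⟩
      · exact ⟨p.concat h, by rw [SimpleGraph.Walk.length_concat]; omega⟩
    · rintro ⟨p, hp⟩
      rcases Nat.lt_or_ge i p.length with h | h
      · right
        have hnil : ¬ p.Nil := by
          rw [← SimpleGraph.Walk.length_eq_zero_iff]; omega
        refine ⟨p.penultimate, ⟨p.dropLast, ?_⟩, p.adj_penultimate hnil⟩
        have := SimpleGraph.Walk.length_dropLast_add_one hnil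
        omega
      · exact .inl ⟨p, h⟩

/-- A path has fewer than `n` edges, so `n` rounds of search find everything that is reachable. -/
theorem getD_reach (u v a w : Fin n) :
    (RawTree.reach (List.range n) (rawTree T) u v a).getD w false = true ↔
      (T.spanningCoe.deleteEdges {s(u, v)}).Reachable a w := by
  rw [RawTree.reach, foldl_const_eq_iterate, getD_iterate_grow, List.length_range]
  constructor
  · exact fun ⟨p, _⟩ => ⟨p⟩
  · intro h
    obtain ⟨p, hp⟩ := h.exists_isPath
    exact ⟨p, by simpa using hp.length_lt.le⟩

variable {T} {U : Finset (Fin n)} {cr : List Bool}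

open Classical in
theorem exists_anchors_eq (hcr : ∀ v : Fin n, cr.getD v false = decide (v ∈ U))
    (h2 : (anchors U T).card = 2) : ∃ a b : Fin n,
      RawTree.anchors (List.range n) cr (rawTree T) = [(a : ℕ), (b : ℕ)] ∧ a ≠ b ∧
      ∀ v, v ∈ anchors U T ↔ v = a ∨ v = b := by
  set l := RawTree.anchors (List.range n) cr (rawTree T) with hl
  have hmem : ∀ i : ℕ, i ∈ l ↔ ∃ v ∈ anchors U T, (v : ℕ) = i := by
    intro i
    rw [hl, RawTree.anchors, List.mem_filter, List.mem_range]
    constructor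
    · rintro ⟨hi, h⟩
      have h1 := hcr ⟨i, hi⟩
      have h2 := getD_verts_rawTree T ⟨i, hi⟩
      simp only at h1 h2
      rw [h1, h2, ← Bool.decide_and, decide_eq_true_iff] at h
      exact ⟨⟨i, hi⟩, mem_anchors.2 h, rfl⟩
    · rintro ⟨v, hv, rfl⟩
      rw [hcr, getD_verts_rawTree, ← Bool.decide_and, decide_eq_true_iff]
      exact ⟨v.2, mem_anchors.1 hv⟩
  have hnd : l.Nodup := List.nodup_range.filter _
  have hlen : l.length = 2 := by
    rw [← List.toFinset_card_of_nodup hnd, ← h2, ← Finset.card_map Fin.valEmbedding]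
    congr 1
    ext i
    simp [hmem]
  obtain ⟨x, y, hxy⟩ := List.length_eq_two.1 hlen
  obtain ⟨a, ha, rfl⟩ := (hmem x).1 (by simp [hxy])
  obtain ⟨b, hb, rfl⟩ := (hmem y).1 (by simp [hxy])
  refine ⟨a, b, hxy, fun hab => ?_, fun v => ?_⟩
  · rw [hxy, hab] at hnd; simp at hnd
  · have := hmem v
    rw [hxy] at this
    simp only [List.mem_cons, List.not_mem_nil, or_false, Fin.val_inj, exists_eq_right] at this
    exact this.symm

-- The search without the edge decides separation of the anchors, which characterises the backbone
-- by `mem_backbone_iff`.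
open Classical in
theorem tourMult_rawTree (hT : T.coe.IsTree) (hcr : ∀ v : Fin n, cr.getD v false = decide (v ∈ U))
    (h2 : (anchors U T).card = 2) (b : Bool) (u v : Fin n) :
    RawTree.tourMult (List.range n) cr (b, rawTree T) u v = tourMult U T b s(u, v) := by
  obtain ⟨a, a', hl, hne, hmem⟩ := exists_anchors_eq hcr h2
  have hbb : RawTree.inBackbone (List.range n) cr (rawTree T) u v =
      decide (s(u, v) ∈ backbone U T) := by
    rw [RawTree.inBackbone, hl, Bool.eq_iff_iff, decide_eq_true_iff, mem_backbone_iff hT hne hmem,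
      Bool.not_eq_true', ← Bool.not_eq_true]
    exact not_congr (getD_reach T u v a a')
  have hadj : s(u, v) ∈ backbone U T → T.Adj u v := fun h =>
    SimpleGraph.Subgraph.mem_edgeSet.1 (backbone_subset h)
  have hlimb : s(u, v) ∈ limbs U T ↔ T.Adj u v ∧ s(u, v) ∉ backbone U T := Iff.rfl
  simp only [RawTree.tourMult, getD_adj_rawTree, hbb, tourMult, hlimb]
  by_cases h1 : T.Adj u v
  · by_cases h3 : s(u, v) ∈ backbone U T
    · simp [h1, h3]
    · cases b <;> simp [h1, h3]
  · have h3 : s(u, v) ∉ backbone U T := fun h => h1 (hadj h)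
    simp [h1, h3]

end TreeCorrect


/-! ### The integer data compute the real objective, and the sampler -/

section Sampling

variable {n k : ℕ}

theorem sum_map_range_fin (f : ℕ → ℕ) : ((List.range n).map f).sum = ∑ i : Fin n, f i := by
  rw [map_range_eq_ofFn, List.sum_ofFn]

theorem sum_map_range_arcs (f : ℕ → ℕ) :
    ((List.range (k + k)).map f).sum = ∑ i, f (arcEquiv k i) := by
  rw [sum_map_range_fin, ← Equiv.sum_comp (arcEquiv k)]

theorem prod_map_range_arcs (f : ℕ → ℕ) :
    ((List.range (k + k)).map f).prod = ∏ i, f (arcEquiv k i) := by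
  rw [map_range_eq_ofFn, List.prod_ofFn, ← Equiv.prod_comp (arcEquiv k)]

/-- The matrices list every edge twice. This is the origin of the factor 2 in the integer costs,
which the integer penalties have to match. -/
theorem sum_sum_sym2 (f : Sym2 (Fin n) → ℝ) (hf : ∀ e, e.IsDiag → f e = 0) :
    ∑ u, ∑ v, f s(u, v) = 2 * ∑ e, f e := by
  have h1 : ∑ e, f e = ∑ p ∈ (Finset.univ : Finset (Fin n)).offDiag with p.1 < p.2, f s(p.1, p.2) := by
    rw [← Finset.sum_sym2_filter_not_isDiag, Finset.sum_filter, Finset.sym2_univ]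
    exact Finset.sum_congr rfl fun e _ => by by_cases h : e.IsDiag <;> simp [h, hf]
  have h2 : ∑ e, f e = ∑ u, ∑ v, if u < v then f s(u, v) else 0 := by
    rw [h1, ← Fintype.sum_prod_type', ← Finset.sum_filter]
    refine Finset.sum_congr ?_ fun _ _ => rfl
    ext p
    simp only [Finset.mem_filter, Finset.mem_offDiag, Finset.mem_univ, true_and, and_iff_right_iff_imp]
    exact ne_of_lt
  have h3 : ∑ e, f e = ∑ u, ∑ v, if v < u then f s(u, v) else 0 := by
    rw [h2, Finset.sum_comm]
    simp only [Sym2.eq_swap]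
  rw [two_mul]
  nth_rw 1 [h2]
  rw [h3, ← Finset.sum_add_distrib]
  refine Finset.sum_congr rfl fun u _ => ?_
  rw [← Finset.sum_add_distrib]
  refine Finset.sum_congr rfl fun v _ => ?_
  rcases lt_trichotomy u v with h | h | h
  · simp [h, h.not_gt]
  · subst h; simp [hf]
  · simp [h, h.not_gt]

variable {I : Input ℚ (Fin n) (Fin k)}

namespace Input.Valid

theorem represents_raw (hI : I.toReal.Valid) : Represents (arcEquiv k) I.toReal.ends
    (RawInput.ends I.raw 0) (RawInput.ends I.raw 1) := by
  classical
  have h (κ : Fin k × Bool) : ∃ a b : Fin n, (RawInput.ends I.raw 0).getD (arcEquiv k κ) 0 = a ∧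
      (RawInput.ends I.raw 1).getD (arcEquiv k κ) 0 = b ∧ a ≠ b ∧
      ∀ v, v ∈ I.toReal.ends κ ↔ v = a ∨ v = b := by
    obtain ⟨a, b, h1, h2, h3⟩ := exists_anchors_eq (getD_core_raw I) (hI.card_ends κ)
    refine ⟨a, b, ?_, ?_, h2, h3⟩ <;> rw [RawInput.ends, getD_arcs_raw, verts_raw]
    · exact congrArg (fun l => l.getD 0 0) h1
    · exact congrArg (fun l => l.getD 1 0) h1
  have h' (e : ℕ) (he : e < k + k) : ∃ a b : Fin n, (RawInput.ends I.raw 0).getD e 0 = a ∧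
      (RawInput.ends I.raw 1).getD e 0 = b ∧ a ≠ b := by
    obtain ⟨a, b, h1, h2, h3, -⟩ := h ((arcEquiv k).symm ⟨e, he⟩)
    rw [Equiv.apply_symm_apply] at h1 h2
    exact ⟨a, b, h1, h2, h3⟩
  refine ⟨⟨fun e he => ?_, fun e he => ?_, fun e he => ?_⟩, fun κ v => ?_⟩
  · obtain ⟨a, b, h1, h2, h3⟩ := h' e he
    rw [h1]; exact a.2
  · obtain ⟨a, b, h1, h2, h3⟩ := h' e he
    rw [h2]; exact b.2
  · obtain ⟨a, b, h1, h2, h3⟩ := h' e he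
    rw [h1, h2]; exact fun hc => h3 (Fin.ext hc)
  · obtain ⟨a, b, h1, h2, -, h4⟩ := h κ
    rw [h1, h2, h4, Fin.ext_iff, Fin.ext_iff]

theorem tourMult_raw (hI : I.toReal.Valid) (κ : Fin k × Bool) (u v : Fin n) :
    RawTree.tourMult (RawInput.verts I.raw) (RawInput.core I.raw) (κ.2, rawTree (I.T κ.1)) u v =
      tourMult (core I.toReal.y) (I.T κ.1) κ.2 s(u, v) := by
  rw [verts_raw]
  exact tourMult_rawTree (hI.decomposition.isTree κ.1) (getD_core_raw I) (hI.card_ends κ) _ _ _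

theorem tourCost_raw (hI : I.toReal.Valid) (κ : Fin k × Bool) :
    (RawInput.tourCost I.raw (κ.2, rawTree (I.T κ.1)) : ℝ) =
      2 * RawInput.costDenom I.raw * I.toReal.tourCost κ := by
  have hdiag : ∀ e : Sym2 (Fin n), e.IsDiag → tourMult (core I.toReal.y) (I.T κ.1) κ.2 e = 0 := by
    intro e he
    by_contra h
    exact SimpleGraph.not_isDiag_of_mem_edgeSet _
      (SimpleGraph.Subgraph.edgeSet_subset _ (mem_edgeSet_of_tourMult h)) he
  have hc (u v : Fin n) : (tourMult (core I.toReal.y) (I.T κ.1) κ.2 s(u, v) : ℝ) *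
      scale (RawInput.costDenom I.raw) ((I.raw.1.getD u []).getD v (0, 1)) =
      RawInput.costDenom I.raw * (tourMult (core I.toReal.y) (I.T κ.1) κ.2 s(u, v) *
        I.toReal.c s(u, v)) := by
    -- Diagonal entries of the length matrix are arbitrary, possibly negative, but they are
    -- multiplied by multiplicity zero.
    by_cases huv : u = v
    · rw [hdiag _ (by simpa using huv)]; simp
    · have h1 : (I.raw.1.getD u []).getD v (0, 1) = fraction (I.c s(u, v)) := by
        simp only [Input.raw, getD_ofFn]
      have h2 : 0 ≤ I.c s(u, v) := by
        have : (0 : ℝ) ≤ (I.c s(u, v) : ℝ) :=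
          hI.isInstance.length_nonneg s(u, v) (by simpa using huv)
        exact_mod_cast this
      rw [h1, scale_fraction h2 (den_length_dvd I u v)]
      simp only [Input.toReal]
      ring
  have h := sum_tourMult_mul (U := core I.toReal.y) (T := I.T κ.1) I.toReal.c κ.2
  rw [RawInput.tourCost, verts_raw, sum_map_range_fin]
  simp only [sum_map_range_fin]
  rw [← verts_raw I]
  simp only [hI.tourMult_raw]
  push_cast
  simp only [hc, ← Finset.mul_sum]
  rw [sum_sum_sym2 (fun e => (tourMult (core I.toReal.y) (I.T κ.1) κ.2 e : ℝ) * I.toReal.c e)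
    fun e he => by rw [hdiag e he]; simp, h]
  simp only [Input.tourCost, Input.toReal]
  ring

theorem penalty_raw (hI : I.toReal.Valid) (v : Fin n) : (RawInput.penalty I.raw v : ℝ) =
    if v ∈ (core I.toReal.y)ᶜ then 2 * RawInput.costDenom I.raw * I.toReal.pen v else 0 := by
  classical
  have h1 : I.raw.2.2.1.getD v (0, 1) = fraction (I.pen v) := by simp only [Input.raw, getD_ofFn]
  have h2 : 0 ≤ I.pen v := by
    have : (0 : ℝ) ≤ (I.pen v : ℝ) := hI.isInstance.pen_nonneg v
    exact_mod_cast this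
  rw [RawInput.penalty, getD_core_raw, h1]
  by_cases hv : v ∈ core I.toReal.y
  · simp [hv]
  · rw [decide_eq_false hv, cond_false, if_pos (Finset.mem_compl.2 hv)]
    push_cast
    rw [scale_fraction h2 (den_pen_dvd I v)]
    simp only [Input.toReal]
    ring

theorem objective_raw (hI : I.toReal.Valid) {x : List ℕ}
    (hx : ∀ κ, x.getD (arcEquiv k κ) 0 ≤ 4 * RawInput.denom I.raw) :
    (RawInput.objective I.raw x : ℝ) =
      2 * RawInput.costDenom I.raw * ((4 * RawInput.denom I.raw : ℕ) : ℝ) ^ (k + k + 1) *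
        I.toReal.obj (scaled (arcEquiv k) (4 * RawInput.denom I.raw) x) := by
  classical
  have hpos : (0 : ℝ) < ((4 * RawInput.denom I.raw : ℕ) : ℝ) := by
    exact_mod_cast Nat.mul_pos (by norm_num) (denom_pos I)
  unfold RawInput.objective
  set D := 4 * RawInput.denom I.raw with hD
  have h1 : ((RawInput.arcs I.raw).map fun _ => D).prod = D ^ (k + k) := by
    rw [List.map_const', List.prod_replicate, length_arcs_raw]
  have h2 (v : Fin n) : ((∏ κ, bif ((RawInput.arcs I.raw).map fun T =>
      T.1 && T.2.1.getD v false).getD (arcEquiv k κ) false then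
      D - x.getD (arcEquiv k κ) 0 else D : ℕ) : ℝ) =
      (D : ℝ) ^ (k + k) * ∏ κ ∈ I.toReal.cover v, (1 - scaled (arcEquiv k) D x κ) := by
    have h3 (κ : Fin k × Bool) : ((bif ((RawInput.arcs I.raw).map fun T =>
        T.1 && T.2.1.getD v false).getD (arcEquiv k κ) false then
        D - x.getD (arcEquiv k κ) 0 else D : ℕ) : ℝ) =
        D * if κ ∈ I.toReal.cover v then 1 - scaled (arcEquiv k) D x κ else 1 := by
      have h4 : ((RawInput.arcs I.raw).map fun T =>
          T.1 && T.2.1.getD v false).getD (arcEquiv k κ) false =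
          decide (κ ∈ I.toReal.cover v) := by
        rw [getD_arcs_raw I (fun T => T.1 && T.2.1.getD v false), getD_verts_rawTree,
          Bool.eq_iff_iff, decide_eq_true_iff, Bool.and_eq_true, decide_eq_true_iff, Input.cover,
          Finset.mem_filter]
        exact (and_iff_right (Finset.mem_univ κ)).symm
      rw [h4]
      by_cases h5 : κ ∈ I.toReal.cover v
      -- The bound `hx` makes the truncated subtraction exact.
      · rw [decide_eq_true h5, cond_true, if_pos h5, Nat.cast_sub (hx κ), scaled]
        field_simp
      · rw [decide_eq_false h5, cond_false, if_neg h5, mul_one]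
    rw [Nat.cast_prod]
    simp only [h3]
    rw [Finset.prod_mul_distrib, Finset.prod_const, Finset.prod_ite_mem, Finset.univ_inter,
      Finset.card_univ, Fintype.card_prod, Fintype.card_fin, Fintype.card_bool, mul_two]
  have h3 (κ : Fin k × Bool) :
      ((RawInput.arcs I.raw).map fun T => RawInput.tourCost I.raw T).getD (arcEquiv k κ) 0 =
      RawInput.tourCost I.raw (κ.2, rawTree (I.T κ.1)) := getD_arcs_raw I _ κ 0
  rw [h1, length_arcs_raw, sum_map_range_arcs, verts_raw, sum_map_range_fin]
  simp only [prod_map_range_arcs, h3]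
  push_cast [hI.tourCost_raw, hI.penalty_raw]
  have h4 := fun v => h2 v
  push_cast at h4
  simp only [h4]
  simp only [Input.obj, PrizeCollecting.objective]
  rw [mul_add, Finset.sum_mul, Finset.mul_sum, Finset.mul_sum, Finset.mul_sum]
  congr 1
  · refine Finset.sum_congr rfl fun κ _ => ?_
    rw [scaled, pow_succ]
    field_simp
  · rw [← Finset.sum_subset (Finset.subset_univ (core I.toReal.y)ᶜ) fun v _ hv => by
      rw [if_neg hv]; ring]
    refine Finset.sum_congr rfl fun v hv => ?_
    rw [if_pos hv]
    ring

/-- Both objective values carry the same positive factor, so comparing natural numbers decides the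
pipage direction exactly. -/
theorem compares_raw (hI : I.toReal.Valid) : Compares (arcEquiv k) (4 * RawInput.denom I.raw)
    I.toReal.obj (RawInput.objective I.raw) := by
  intro x y hx hy
  have hpos : (0 : ℝ) < 2 * RawInput.costDenom I.raw *
      ((4 * RawInput.denom I.raw : ℕ) : ℝ) ^ (k + k + 1) := by
    have h1 : (0 : ℝ) < RawInput.costDenom I.raw := by exact_mod_cast costDenom_pos I
    have h2 : (0 : ℝ) < ((4 * RawInput.denom I.raw : ℕ) : ℝ) := by
      exact_mod_cast Nat.mul_pos (by norm_num) (denom_pos I)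
    positivity
  rw [← Nat.cast_le (α := ℝ), hI.objective_raw hx, hI.objective_raw hy]
  exact mul_le_mul_iff_right₀ hpos

theorem scaled_start (hI : I.toReal.Valid) :
    scaled (arcEquiv k) (4 * RawInput.denom I.raw) (RawInput.start I.raw) = I.toReal.start := by
  funext κ
  let f (b : Bool) (i : Fin k) : ℕ := bif b then
    3 * scale (RawInput.denom I.raw) (fraction (I.μ i)) else
    scale (RawInput.denom I.raw) (fraction (I.μ i))
  have h1 : RawInput.start I.raw = List.ofFn (f false) ++ List.ofFn (f true) := by
    simp only [RawInput.start, Input.raw, List.map_ofFn]; rfl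
  have h2 : 0 ≤ I.μ κ.1 := by
    have := (hI.decomposition.weight_mem κ.1).1
    simp only [Input.toReal] at this
    exact_mod_cast this
  have h3 : (RawInput.denom I.raw : ℝ) ≠ 0 := by exact_mod_cast (denom_pos I).ne'
  rw [scaled, h1, getD_append_ofFn f κ, Input.start]
  obtain ⟨i, b⟩ := κ
  have h4 := scale_fraction h2 (den_dvd_denom I i)
  simp only at h4
  cases b
  · simp only [f, cond_false, Input.toReal]
    push_cast
    rw [h4]
    field_simp
  · simp only [f, cond_true, Input.toReal]
    push_cast
    rw [h4]
    field_simp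

/-- The edges of `G₁` of value one. -/
noncomputable def chosen (D : ℕ) (z : List ℕ) : Finset (Fin k × Bool) :=
  Finset.univ.filter fun κ => z.getD (arcEquiv k κ) 0 = D

theorem mult_raw (hI : I.toReal.Valid) (z : List ℕ) (u v : Fin n) :
    RawInput.mult I.raw z u v = (mergeTours (core I.toReal.y) (fun κ : Fin k × Bool => I.T κ.1)
      (fun κ => κ.2) (chosen (4 * RawInput.denom I.raw) z)).mult s(u, v) := by
  have h3 (κ : Fin k × Bool) : ((RawInput.arcs I.raw).map fun T =>
      RawTree.tourMult (RawInput.verts I.raw) (RawInput.core I.raw) T u v).getD (arcEquiv k κ) 0 =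
      tourMult (core I.toReal.y) (I.T κ.1) κ.2 s(u, v) :=
    (getD_arcs_raw I _ κ 0).trans (hI.tourMult_raw κ u v)
  rw [RawInput.mult, length_arcs_raw, sum_map_range_arcs]
  simp only [h3, mergeTours, chosen, Finset.sum_filter, Bool.cond_decide]

theorem graph_raw (hI : I.toReal.Valid) (z : List ℕ) : enc (RawInput.graph I.raw z) =
    (mergeTours (core I.toReal.y) (fun κ : Fin k × Bool => I.T κ.1)
      (fun κ => κ.2) (chosen (4 * RawInput.denom I.raw) z)).encode := by
  classical
  rw [← enc_multigraph, RawInput.graph]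
  simp only [verts_raw, map_range_eq_ofFn, hI.mult_raw]
  congr 2
  refine congrArg List.ofFn (funext fun v => ?_)
  rw [getD_core_raw, Bool.eq_iff_iff, Bool.or_eq_true, any_range, decide_eq_true_iff,
    decide_eq_true_iff, mergeTours]
  simp only [Finset.mem_union, Finset.mem_filter, Finset.mem_univ, true_and]
  refine or_congr_right ⟨fun ⟨u, h⟩ => ?_, fun ⟨e, h1, h2⟩ => ?_⟩
  · rw [hI.mult_raw] at h
    exact ⟨s(u, v), Sym2.mem_mk_right _ _, by simpa [mergeTours] using h⟩
  · obtain ⟨u, rfl⟩ := h1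
    refine ⟨u, ?_⟩
    rw [hI.mult_raw, Sym2.eq_swap]
    simpa [mergeTours] using h2

theorem goodSample_raw (hI : I.toReal.Valid) {Ω : Type*} [Fintype Ω] (P : PMF Ω) :
    I.toReal.GoodSample P fun _ => mergeTours (core I.toReal.y) (fun κ : Fin k × Bool => I.T κ.1)
      (fun κ => κ.2) (chosen (4 * RawInput.denom I.raw) (RawInput.rounded I.raw)) := by
  have hD : 0 < 4 * RawInput.denom I.raw := Nat.mul_pos (by norm_num) (denom_pos I)
  have hs := hI.treePolytope_start
  rw [← hI.scaled_start] at hs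
  have h := pipage_spec hI.represents_raw hD hI.ends_subset
    (pairConcave_objective hI.card_ends _ _ hI.isInstance.pen_nonneg _) hI.compares_raw hs
  have hr : RawInput.rounded I.raw = pipage (RawInput.objective I.raw) (List.range n)
      (List.range (k + k)) (RawInput.ends I.raw 0) (RawInput.ends I.raw 1)
      (4 * RawInput.denom I.raw) (RawInput.start I.raw) := by
    rw [RawInput.rounded, verts_raw, length_arcs_raw]
  rw [← hr, hI.scaled_start] at h
  refine hI.goodSample P h.1 h.2.1 h.2.2 fun κ => ?_
  have hD' : ((4 * RawInput.denom I.raw : ℕ) : ℝ) ≠ 0 := by exact_mod_cast hD.ne'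
  rw [chosen, Finset.mem_filter, scaled, div_eq_one_iff_eq hD', Nat.cast_inj]
  exact and_iff_right (Finset.mem_univ κ)

end Input.Valid

theorem exists_samples : ∃ p : Prog, p.Samples := by
  have hPT : PT fun p : RawInput × List Bool => RawInput.graph p.1 (RawInput.rounded p.1) := by
    fun_prop
  obtain ⟨p, c, hp⟩ := hPT
  -- The number of random bits is the zero polynomial. The empty bit string has the encoding of the
  -- empty list, and `X + 5` covers the extra constants for the pair and for the base in `PT`.
  refine ⟨p, 0, (Polynomial.X + 5) ^ c, fun n k I hI => ⟨_, fun ω => ?_, hI.goodSample_raw _⟩⟩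
  obtain ⟨t, ht, hr⟩ := hp (I.raw, [])
  rw [hI.graph_raw] at hr
  have h1 : enc (I.raw, ([] : List Bool)) = .pair I.encode (Data.ofBits ω) := by
    have h2 : ∀ (m : ℕ) (ω : Fin m → Bool), m = 0 → Data.ofBits ω = .num 0 := by
      rintro m ω rfl; rfl
    rw [h2 _ ω (by simp), ← enc_raw]; rfl
  refine ⟨t, ht.trans ?_, h1 ▸ hr⟩
  have h3 : sz (I.raw, ([] : List Bool)) = 1 + I.encode.size + 1 := by
    rw [← enc_raw]; rfl
  rw [h3]
  simp only [Polynomial.eval_pow, Polynomial.eval_add, Polynomial.eval_X, Polynomial.eval_ofNat]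
  exact Nat.pow_le_pow_left (by omega) c

end Sampling

end PrizeCollecting

theorem lemma7 :
    (∀ (V ι : Type*) [Fintype V] [DecidableEq V] [Fintype ι]
      (I : PrizeCollecting.Input ℝ V ι), I.Valid →
        ∃ (N : ℕ) (P : PMF (Fin N)) (H : Fin N → PrizeCollecting.Multigraph V),
          I.GoodSample P H) ∧
    (∃ p : PrizeCollecting.Prog, p.Samples) :=
  ⟨fun _ _ _ _ _ _ hI => hI.exists_goodSample, PrizeCollecting.exists_samples⟩
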